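/- **Setting.** Let $d\ge 2$ and let $\overline\Omega\subset\mathbb R^d$ be a closed polytopic domain (a connected finite union of nondegenerate closed $d$-simplices) with interior $\Omega$ and boundary $\partial\Omega$, where $\partial\Omega=\partial\Omega_D\cup\partial\Omega_R\cup\partial\Omega_t$ is a disjoint decomposition. Let $T\in(0,\infty)$. The generalised faces are the intersections of the open $(d-1)$-dimensional faces with $\partial\Omega_D,\partial\Omega_R,\partial\Omega_t$. $PC(\partial\Omega)$ is the space of bounded functions on $\partial\Omega$ that are continuous on each generalised face. The tangent cone $K(x)$ consists of all $x'$ with $x+\lambda x'\in\overline\Omega$ for all $\lambda\in[0,\Lambda]$, for some $\Lambda>0$. All sup norms are pointwise suprema. Let $A$ be a compact metric space. For $\alpha\in A$ let $a^\alpha,c^\alpha,f^\alpha\in C(\overline\Omega)$, $b^\alpha\in C(\overline\Omega,\mathbb R^d)$, $c^\alpha_{\partial\Omega},g^\alpha\in PC(\partial\Omega)$ and $b^\alpha_{\partial\Omega}\in PC(\partial\Omega,\mathbb R^d)$ depend continuously on $\alpha$ in the sup norm. Let $g\in C(\partial\Omega)$ and $v_T\in C(\overline\Omega)$. Assume $a^\alpha,c^\alpha,c^\alpha_{\partial\Omega},g^\alpha,g,v_T\ge0$,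 $b^\alpha_{\partial\Omega}(x)\in K(x)$ for all $x\in\partial\Omega$, and $v_T=g$ on $\partial\Omega_D$. Put $$L^\alpha(x,q,p,s)=-a^\alpha(x)q-b^\alpha(x)\cdot p+c^\alpha(x)s,\qquad L^\alpha_{\partial\Omega}(x,p,s)=-b^\alpha_{\partial\Omega}(x)\cdot p+c^\alpha_{\partial\Omega}(x)s,$$ and define $F(t,x,q,p,r,s)$ on $[0,T]\times\overline\Omega\times\mathbb R\times\mathbb R^d\times\mathbb R\times\mathbb R$ to be * $-r+\sup_\alpha(L^\alpha(x,q,p,s)-f^\alpha(x))$ for $t<T$, $x\in\Omega$; * $-r+\sup_\alpha(L^\alpha_{\partial\Omega}(x,p,s)-g^\alpha(x))$ for $t<T$, $x\in\partial\Omega_t$; * $\sup_\alpha(L^\alpha_{\partial\Omega}(x,p,s)-g^\alpha(x))$ for $t<T$, $x\in\partial\Omega_R$; * $s-g(x)$ for $t<T$, $x\in\partial\Omega_D$; * $s-v_T(x)$ for $t=T$. $F^\alpha$ denotes the same operator for the single control $\alpha$. Upper and lower semicontinuous envelopes, relative to $[0,T]\times\overline\Omega$ for functions and to the domain of $F$ for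 $F$, are denoted by ${}^*$ and ${}_*$. A bounded function $u$ on $[0,T]\times\overline\Omega$ is a viscosity subsolution if, for all $\psi\in C^2(\mathbb R\times\mathbb R^d)$, $F_*(t,x,\Delta\psi,\nabla\psi,\partial_t\psi,u^*)\le0$ at every $(t,x)\in[0,T]\times\overline\Omega$ where $u^*-\psi$ has a local maximum relative to $[0,T]\times\overline\Omega$. It is a viscosity supersolution if $F^*(t,x,\Delta\psi,\nabla\psi,\partial_t\psi,u_*)\ge0$ wherever $u_*-\psi$ has a local minimum, and a viscosity solution if it is both. **Scheme.** For $i\in\mathbb N$ let $\mathcal T_i$ be a conforming simplicial mesh of $\overline\Omega$ with mesh size $\Delta x_i\to0$, the family being shape-regular and each open boundary mesh face lying in a generalised face. Let $V_i$ be the space of continuous piecewise affine functions on $\mathcal T_i$, with nodes $y_i^\ell$, hat functions $\phi_i^\ell$ and $\hat\phi_i^\ell=\phi_i^\ell/\|\phi_i^\ell\|_{L^1(\Omega)}$. Let $h_i\to0$ be time steps with $h_i>0$, $T/h_i\in\mathbb N$, and let $s_i^k=kh_i$. For each $i,\alpha$ let coefficients $\bar a,\bar b,\bar c$ (explicit)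 and $\bar{\bar a},\bar{\bar b},\bar{\bar c}$ (implicit), and $f_i^\alpha$, be given that are continuous on $\overline\Omega$. Let $\bar b_{\partial},\bar c_{\partial},\bar{\bar b}_{\partial},\bar{\bar c}_{\partial},g_i^\alpha$ be given in $PC(\partial\Omega)$. All $c$-coefficients, $f_i^\alpha$ and $g_i^\alpha$ are $\ge0$, and $\bar b_\partial(x),\bar{\bar b}_\partial(x)\in K(x)$. Define the entries for $w\in V_i$ by: * interior node: $(\mathsf E_i^\alpha w)_\ell=\bar a(y_i^\ell)\langle\nabla w,\nabla\hat\phi_i^\ell\rangle+\langle-\bar b\cdot\nabla w+\bar c\,w,\hat\phi_i^\ell\rangle$, $(\mathsf I_i^\alpha w)_\ell$ likewise with double bars, and $(\mathsf F_i^\alpha)_\ell=\langle f_i^\alpha,\hat\phi_i^\ell\rangle$; * node on $\partial\Omega_t\cup\partial\Omega_R$: $(\mathsf E_i^\alpha w)_\ell=\partial_{-\bar b_\partial(y_i^\ell)}w(y_i^\ell)+\bar c_\partial(y_i^\ell)w(y_i^\ell)$, $(\mathsf I_i^\alpha w)_\ell$ likewise with double bars, and $(\mathsf F_i^\alpha)_\ell=g_i^\alpha(y_i^\ell)$,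 where $\partial_{-b}w(x)=\liminf_{\lambda\downarrow0}\lambda^{-1}(w(x)-w(x+\lambda b))$; * node on $\partial\Omega_D$: $(\mathsf E_i^\alpha w)_\ell=0$, $(\mathsf I_i^\alpha w)_\ell=w(y_i^\ell)$, $(\mathsf F_i^\alpha)_\ell=g(y_i^\ell)$. A numerical solution is $v_i$ with $v_i(s_i^k,\cdot)\in V_i$, with $v_i(T,\cdot)$ the nodal interpolant of $v_T$, and, for all $k<T/h_i$ and all nodes, $$-(d_iv_i(s_i^k,\cdot))_\ell+\sup_{\alpha\in A}\bigl(\mathsf E_i^\alpha v_i(s_i^{k+1},\cdot)+\mathsf I_i^\alpha v_i(s_i^k,\cdot)-\mathsf F_i^\alpha\bigr)_\ell=0,$$ where $(d_iw(s_i^k,\cdot))_\ell=(w(s_i^{k+1},y_i^\ell)-w(s_i^k,y_i^\ell))/h_i$ at nodes in $\Omega\cup\partial\Omega_t$ and $0$ otherwise. **Assumptions.** 1. *Consistency of the coefficients.* Uniformly in $\alpha$, as $i\to\infty$: $\sup_{x\in\operatorname{supp}\hat\phi_i^\ell}|a^\alpha(x)-\bar a(y_i^\ell)-\bar{\bar a}(y_i^\ell)|\to0$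 uniformly over the non-Dirichlet nodes. The sums $\bar b+\bar{\bar b}$, $\bar c+\bar{\bar c}$ and $f_i^\alpha$ converge uniformly on $\overline\Omega$ to $b^\alpha,c^\alpha,f^\alpha$. The sums $\bar b_\partial+\bar{\bar b}_\partial$, $\bar c_\partial+\bar{\bar c}_\partial$ and $g_i^\alpha$ converge uniformly on $\partial\Omega$ to $b^\alpha_{\partial\Omega},c^\alpha_{\partial\Omega},g^\alpha$. For each $i$ all these coefficients depend continuously on $\alpha$ in the sup norm. The vector fields $\bar b,\bar{\bar b},\bar b_\partial,\bar{\bar b}_\partial$ are bounded uniformly in $i,\alpha$. On $\partial\Omega_R$: $\bar b_\partial=0$, $\bar c_\partial=0$, $\bar{\bar c}_\partial>0$. 2. *Strict acuteness and artificial diffusion.* For each $i$ there is $\theta\in(0,\pi/2)$ such that $\nabla\phi_i^\ell\cdot\nabla\phi_i^l\le-\sin\theta\,|\nabla\phi_i^\ell||\nabla\phi_i^l|$ on every element, for every non-Dirichlet node $\ell$ and every node $l\ne\ell$. Moreover, for all $\alpha$ and interior nodes $y_i^\ell$ there are $\bar\nu,\bar{\bar\nu}\ge0$ with $\bar a(y_i^\ell)\ge\bar\nu$,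 $\bar{\bar a}(y_i^\ell)\ge\bar{\bar\nu}$ and $|\bar b|_K+\operatorname{diam}(K)\|\bar c\|_{L^\infty(K)}\le\bar\nu\sin\theta\,|\nabla\hat\phi_i^\ell|_K\operatorname{vol}(K)$ for all elements $K$ with vertex $y_i^\ell$, and likewise with double bars, where $|u|_K=(\sum_j\|u_j\|^2_{L^\infty(K)})^{1/2}$. 3. *Time step restriction.* $h_i(\mathsf E_i^\alpha\phi_i^\ell)_\ell\le1$ for all $i,\alpha$ and all nodes in $\Omega\cup\partial\Omega_t$. 4. *Elliptic projection.* There are linear maps $P_i:C^\infty(\mathbb R^d)\to V_i$ with $\langle\nabla P_iw,\nabla\hat\phi_i^\ell\rangle=\langle\nabla w,\nabla\hat\phi_i^\ell\rangle$ for interior nodes, with $\|P_iw\|_{W^{1,\infty}(\Omega)}\le C\|w\|_{W^{1,\infty}(\Omega)}$ for a constant $C$ independent of $i,w$, and with $\|P_iw-w\|_{W^{1,\infty}(\Omega)}\to0$. 5. *Strict supersolution.* There are $\alpha\in A$, $w\in C^2(\mathbb R\times\mathbb R^d)$ and $\varepsilon>0$ with $F^\alpha(t,x,\Delta w,\nabla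 w,\partial_tw,w)\ge\varepsilon$ on $[0,T]\times\overline\Omega$. 6. *Comparison principle.* Every upper semicontinuous viscosity subsolution is $\le$ every lower semicontinuous viscosity supersolution on $[0,T]\times\overline\Omega$. **Theorem.** Let $v_i$, $i\in\mathbb N$, be the numerical solutions, and for $(t,x)\in[0,T]\times\overline\Omega$ let $$\overline v(t,x)=\limsup_{i\to\infty,\ (s_i^k,y_i^\ell)\to(t,x)}v_i(s_i^k,y_i^\ell),\qquad\underline v(t,x)=\liminf_{i\to\infty,\ (s_i^k,y_i^\ell)\to(t,x)}v_i(s_i^k,y_i^\ell)$$ be their upper and lower envelopes. Then there is exactly one viscosity solution $v$; it satisfies $v(T,\cdot)=v_T$ and $\underline v=\overline v=v$ on $[0,T]\times\overline\Omega$. Moreover $\max_{0\le k\le T/h_i}\sup_{x\in\overline\Omega}|v_i(s_i^k,x)-v(s_i^k,x)|\to0$ and, with $v_i$ extended to $[0,T]$ by affine interpolation between time steps, $$\lim_{i\to\infty}\|v_i-v\|_{L^\infty((0,T)\times\Omega)}=0.$$ -/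

import Mathlib

open Set Filter Topology MeasureTheory
open scoped RealInnerProductSpace NNReal ENNReal

noncomputable section

namespace HJBFEM

/-- The ambient Euclidean space. -/
abbrev E (d : ℕ) := EuclideanSpace ℝ (Fin d)

/-! ### Polytopic domains with a decomposed boundary -/

/-- A polytopic domain, given as a closed set: a connected finite union of nondegenerate
closed `d`-simplices.  The open domain is `interior P`, the boundary is `frontier P`. -/
def IsPolytopicDomain {d : ℕ} (P : Set (E d)) : Prop :=
  IsConnected P ∧ ∃ S : Finset (Finset (E d)),
    (∀ s ∈ S, s.card = d + 1 ∧ AffineIndependent ℝ ((↑) : s → E d)) ∧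
    P = ⋃ s ∈ S, convexHull ℝ (s : Set (E d))

/-- Boundary points near which the boundary is a piece of a hyperplane. -/
def flatPoints {d : ℕ} (P : Set (E d)) : Set (E d) :=
  {x ∈ frontier P | ∃ H : AffineSubspace ℝ (E d), Module.finrank ℝ H.direction + 1 = d ∧ x ∈ H ∧
    ∀ᶠ y in 𝓝 x, (y ∈ frontier P ↔ y ∈ H)}

/-- The open `(d-1)`-dimensional faces of `P`. -/
def openFacets {d : ℕ} (P : Set (E d)) : Set (Set (E d)) :=
  {ω | ∃ x ∈ flatPoints P, ω = connectedComponentIn (flatPoints P) x}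

/-- The tangent cone of the polytopic domain `P` at `x`. -/
def tangentCone {d : ℕ} (P : Set (E d)) (x : E d) : Set (E d) :=
  {y | ∃ Λ : ℝ, 0 < Λ ∧ ∀ l ∈ Icc (0 : ℝ) Λ, x + l • y ∈ P}

/-- The space-time domain: a polytopic domain whose boundary is split into a Dirichlet part, a
Robin part without time derivative and a Robin part with time derivative, and a final time. -/
structure Domain (d : ℕ) where
  /-- the closed domain -/
  P : Set (E d)
  /-- Dirichlet part of the boundary -/
  bdD : Set (E d)
  /-- Robin part of the boundary without time derivative -/
  bdR : Set (E d)
  /-- Robin part of the boundary with time derivative -/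
  bdt : Set (E d)
  /-- final time -/
  T : ℝ
  polytopic : IsPolytopicDomain P
  T_pos : 0 < T
  disjoint_DR : Disjoint bdD bdR
  disjoint_Dt : Disjoint bdD bdt
  disjoint_Rt : Disjoint bdR bdt
  union_bd : bdD ∪ bdR ∪ bdt = frontier P

namespace Domain

variable {d : ℕ} (D : Domain d)

/-- The open domain. -/
def Ω : Set (E d) := interior D.P

/-- The closed space-time cylinder `[0,T] × P`. -/
def Q : Set (ℝ × E d) := Icc 0 D.T ×ˢ D.P

/-- Generalised faces: intersections of open facets with one of the three boundary parts. -/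
def genFaces : Set (Set (E d)) :=
  {ω | ∃ ω' ∈ openFacets D.P, ω = ω' ∩ D.bdD ∨ ω = ω' ∩ D.bdR ∨ ω = ω' ∩ D.bdt}

/-- Piecewise continuous functions on the boundary: bounded, and continuous on each generalised
face. -/
def IsPC {V : Type*} [NormedAddCommGroup V] (u : E d → V) : Prop :=
  (∃ C : ℝ, ∀ x ∈ frontier D.P, ‖u x‖ ≤ C) ∧ ∀ ω ∈ D.genFaces, ContinuousOn u ω

end Domain

/-! ### The Bellman problem -/

/-- Continuity of a family of functions with respect to its parameter `α`, in the supremum norm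
over `S`. -/
def SupNormContinuous {A X V : Type*} [TopologicalSpace A] [UniformSpace V]
    (S : Set X) (u : A → X → V) : Prop :=
  ∀ α₀, TendstoUniformlyOn u (u α₀) (𝓝 α₀) S

/-- Data of the final time boundary value problem with the standing conditions on them. The
coefficients are only used on the closed domain `P`, respectively on its boundary. -/
structure Problem (d : ℕ) (A : Type*) [TopologicalSpace A] extends Domain d where
  /-- coefficients and data of the differential operators -/
  a : A → E d → ℝ
  b : A → E d → E d
  c : A → E d → ℝ
  f : A → E d → ℝ
  /-- coefficients and data of the Robin operators -/
  bB : A → E d → E d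
  cB : A → E d → ℝ
  gB : A → E d → ℝ
  /-- Dirichlet data -/
  g : E d → ℝ
  /-- final time data -/
  vT : E d → ℝ
  a_cont : ∀ α, ContinuousOn (a α) P
  b_cont : ∀ α, ContinuousOn (b α) P
  c_cont : ∀ α, ContinuousOn (c α) P
  f_cont : ∀ α, ContinuousOn (f α) P
  a_ctrl : SupNormContinuous P a
  b_ctrl : SupNormContinuous P b
  c_ctrl : SupNormContinuous P c
  f_ctrl : SupNormContinuous P f
  bB_pc : ∀ α, toDomain.IsPC (bB α)
  cB_pc : ∀ α, toDomain.IsPC (cB α)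
  gB_pc : ∀ α, toDomain.IsPC (gB α)
  bB_ctrl : SupNormContinuous (frontier P) bB
  cB_ctrl : SupNormContinuous (frontier P) cB
  gB_ctrl : SupNormContinuous (frontier P) gB
  a_nonneg : ∀ α, ∀ x ∈ P, 0 ≤ a α x
  c_nonneg : ∀ α, ∀ x ∈ P, 0 ≤ c α x
  cB_nonneg : ∀ α, ∀ x ∈ frontier P, 0 ≤ cB α x
  gB_nonneg : ∀ α, ∀ x ∈ frontier P, 0 ≤ gB α x
  bB_cone : ∀ α, ∀ x ∈ frontier P, bB α x ∈ tangentCone P x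
  g_cont : ContinuousOn g (frontier P)
  g_nonneg : ∀ x ∈ frontier P, 0 ≤ g x
  vT_cont : ContinuousOn vT P
  vT_nonneg : ∀ x ∈ P, 0 ≤ vT x
  vT_eq_g : ∀ x ∈ bdD, vT x = g x

/-- Arguments of the nonlinear operator: `((t, x), (q, p, r, s))`, where `q` stands for the
Laplacian, `p` for the gradient, `r` for the time derivative and `s` for the value. -/
abbrev OpArg (d : ℕ) := (ℝ × E d) × (ℝ × E d × ℝ × ℝ)

/-- The argument `((t, x), (Δψ, ∇ψ, ∂ₜψ, s))` at the point `z = (t, x)`. -/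
def jet {d : ℕ} (ψ : ℝ × E d → ℝ) (z : ℝ × E d) (s : ℝ) : OpArg d :=
  (z, (Laplacian.laplacian (fun y => ψ (z.1, y)) z.2, gradient (fun y => ψ (z.1, y)) z.2,
    deriv (fun τ => ψ (τ, z.2)) z.1, s))

/-- Upper semicontinuous envelope relative to the set `S` (of a locally bounded function). -/
def upperEnvelope {X : Type*} [TopologicalSpace X] (S : Set X) (u : X → ℝ) (x : X) : ℝ :=
  limsup u (𝓝[S] x)

/-- Lower semicontinuous envelope relative to the set `S` (of a locally bounded function). -/
def lowerEnvelope {X : Type*} [TopologicalSpace X] (S : Set X) (u : X → ℝ) (x : X) : ℝ :=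
  liminf u (𝓝[S] x)

namespace Problem

variable {d : ℕ} {A : Type*} [TopologicalSpace A] (𝔭 : Problem d A)

/-- The linear operator `L^α(x, q, p, s)`. -/
def L (α : A) (x : E d) (q : ℝ) (p : E d) (s : ℝ) : ℝ :=
  -(𝔭.a α x * q) - ⟪𝔭.b α x, p⟫ + 𝔭.c α x * s

/-- The Robin operator `L^α_∂Ω(x, p, s)`. -/
def LB (α : A) (x : E d) (p : E d) (s : ℝ) : ℝ :=
  -⟪𝔭.bB α x, p⟫ + 𝔭.cB α x * s

open Classical in
/-- The operator of the Bellman problem, including boundary and final time conditions. -/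
def F : OpArg d → ℝ := fun ((t, x), (q, p, r, s)) =>
  if t < 𝔭.T then
    if x ∈ 𝔭.Ω then -r + ⨆ α, (𝔭.L α x q p s - 𝔭.f α x)
    else if x ∈ 𝔭.bdt then -r + ⨆ α, (𝔭.LB α x p s - 𝔭.gB α x)
    else if x ∈ 𝔭.bdR then ⨆ α, (𝔭.LB α x p s - 𝔭.gB α x)
    else s - 𝔭.g x
  else s - 𝔭.vT x

open Classical in
/-- The operator of the linear problem for a fixed control. -/
def FLin (α : A) : OpArg d → ℝ := fun ((t, x), (q, p, r, s)) =>
  if t < 𝔭.T then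
    if x ∈ 𝔭.Ω then -r + (𝔭.L α x q p s - 𝔭.f α x)
    else if x ∈ 𝔭.bdt then -r + (𝔭.LB α x p s - 𝔭.gB α x)
    else if x ∈ 𝔭.bdR then 𝔭.LB α x p s - 𝔭.gB α x
    else s - 𝔭.g x
  else s - 𝔭.vT x

/-- Upper semicontinuous envelope of `F` on `[0,T] × P × ℝ × ℝᵈ × ℝ × ℝ`. -/
def FUpper (z : OpArg d) : EReal :=
  limsup (fun z' => (𝔭.F z' : EReal)) (𝓝[𝔭.Q ×ˢ univ] z)

/-- Lower semicontinuous envelope of `F` on `[0,T] × P × ℝ × ℝᵈ × ℝ × ℝ`. -/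
def FLower (z : OpArg d) : EReal :=
  liminf (fun z' => (𝔭.F z' : EReal)) (𝓝[𝔭.Q ×ˢ univ] z)

/-- Bounded viscosity subsolutions on `[0,T] × P`. -/
def IsSubsolution (u : ℝ × E d → ℝ) : Prop :=
  (∃ C : ℝ, ∀ z ∈ 𝔭.Q, |u z| ≤ C) ∧
  ∀ ψ : ℝ × E d → ℝ, ContDiff ℝ 2 ψ → ∀ z ∈ 𝔭.Q,
    IsLocalMaxOn (fun z' => upperEnvelope 𝔭.Q u z' - ψ z') 𝔭.Q z →
    𝔭.FLower (jet ψ z (upperEnvelope 𝔭.Q u z)) ≤ 0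

/-- Bounded viscosity supersolutions on `[0,T] × P`. -/
def IsSupersolution (u : ℝ × E d → ℝ) : Prop :=
  (∃ C : ℝ, ∀ z ∈ 𝔭.Q, |u z| ≤ C) ∧
  ∀ ψ : ℝ × E d → ℝ, ContDiff ℝ 2 ψ → ∀ z ∈ 𝔭.Q,
    IsLocalMinOn (fun z' => lowerEnvelope 𝔭.Q u z' - ψ z') 𝔭.Q z →
    0 ≤ 𝔭.FUpper (jet ψ z (lowerEnvelope 𝔭.Q u z))

/-- Viscosity solutions. -/
def IsViscositySolution (u : ℝ × E d → ℝ) : Prop :=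
  𝔭.IsSubsolution u ∧ 𝔭.IsSupersolution u

/-- The comparison principle: upper semicontinuous subsolutions lie below lower semicontinuous
supersolutions. -/
def Comparison : Prop :=
  ∀ u w : ℝ × E d → ℝ, UpperSemicontinuousOn u 𝔭.Q → 𝔭.IsSubsolution u →
    LowerSemicontinuousOn w 𝔭.Q → 𝔭.IsSupersolution w → ∀ z ∈ 𝔭.Q, u z ≤ w z

/-- For some control the linear problem has a strict supersolution of class `C²`. -/
def HasStrictSupersolution : Prop :=
  ∃ α : A, ∃ w : ℝ × E d → ℝ, ContDiff ℝ 2 w ∧ ∃ ε : ℝ, 0 < ε ∧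
    ∀ z ∈ 𝔭.Q, ε ≤ 𝔭.FLin α (jet w z (w z))

end Problem

/-! ### Simplicial meshes and piecewise linear functions -/

/-- Simplicial meshes; their nodes are `Geometry.SimplicialComplex.vertices`. -/
abbrev Mesh (d : ℕ) := Geometry.SimplicialComplex ℝ (E d)

namespace Mesh

variable {d : ℕ} (𝒯 : Mesh d)

/-- The elements, each given by its set of `d + 1` vertices. -/
def elements : Set (Finset (E d)) := {s ∈ 𝒯.faces | s.card = d + 1}

/-- `𝒯` is a (conforming) finite mesh of `P` by `d`-simplices. -/
def IsMeshOf (P : Set (E d)) : Prop :=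
  𝒯.faces.Finite ∧ (∀ s ∈ 𝒯.faces, ∃ t ∈ 𝒯.elements, s ⊆ t) ∧ 𝒯.space = P

/-- The boundary faces of the mesh are subordinate to the generalised faces of the domain. -/
def IsSubordinate (D : Domain d) : Prop :=
  ∀ s ∈ 𝒯.faces, s.card = d → convexHull ℝ (s : Set (E d)) ⊆ frontier D.P →
    ∃ ω ∈ D.genFaces, intrinsicInterior ℝ (convexHull ℝ (s : Set (E d))) ⊆ ω

/-- The mesh size: the largest diameter of an element. -/
def size : ℝ := sSup ((fun s : Finset (E d) => Metric.diam (convexHull ℝ (s : Set (E d)))) ''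
  𝒯.elements)

/-- The space of continuous piecewise linear functions on the mesh (normalised to vanish off the
mesh, where their values play no role). Continuity on the mesh is automatic, because the elements
are closed and the affine pieces agree where elements meet. -/
def P1 : Submodule ℝ (E d → ℝ) where
  carrier := {w | (∀ s ∈ 𝒯.elements, ∃ l : E d →ᵃ[ℝ] ℝ, EqOn w l (convexHull ℝ (s : Set (E d)))) ∧
    ∀ x, x ∉ 𝒯.space → w x = 0}
  add_mem' := by
    rintro u w ⟨hu, hu'⟩ ⟨hw, hw'⟩
    refine ⟨fun s hs => ?_, fun x hx => by simp [hu' x hx, hw' x hx]⟩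
    obtain ⟨l, hl⟩ := hu s hs
    obtain ⟨m, hm⟩ := hw s hs
    exact ⟨l + m, fun x hx => by simp [hl hx, hm hx]⟩
  zero_mem' := ⟨fun s _ => ⟨0, fun x _ => by simp⟩, fun x _ => rfl⟩
  smul_mem' := by
    rintro r u ⟨hu, hu'⟩
    refine ⟨fun s hs => ?_, fun x hx => by simp [hu' x hx]⟩
    obtain ⟨l, hl⟩ := hu s hs
    exact ⟨r • l, fun x hx => by simp [hl hx]⟩

/-- The hat function of the node `y`: its value at `x` is the barycentric coordinate of `x` with
respect to `y` in a face that contains `x` and has `y` as a vertex, and `0` if there is no such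
face. (The set below has at most one element.) -/
def hat (y x : E d) : ℝ :=
  sSup {r : ℝ | ∃ s ∈ 𝒯.faces, y ∈ s ∧ ∃ μ : E d → ℝ, (∀ z ∈ s, 0 ≤ μ z) ∧
    ∑ z ∈ s, μ z = 1 ∧ ∑ z ∈ s, μ z • z = x ∧ r = μ y}

/-- The hat function normalised in `L¹`. -/
def hat1 (y x : E d) : ℝ := 𝒯.hat y x / ∫ z in 𝒯.space, |𝒯.hat y z|

end Mesh

/-- The lower Dini derivative `∂_{-b} w (x)` in direction `-b`. -/
def lowerDini {d : ℕ} (w : E d → ℝ) (x b : E d) : ℝ :=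
  liminf (fun l : ℝ => (w x - w (x + l • b)) / l) (𝓝[>] 0)

/-- The norm of (the restriction to `K` of) a vector field: the Euclidean norm of the vector of
the supremum norms of its components. -/
def vecNormOn {d : ℕ} (K : Set (E d)) (u : E d → E d) : ℝ :=
  √ (∑ j, (sSup ((fun x => |u x j|) '' K)) ^ 2)

/-- Smooth functions on `ℝᵈ`. -/
def smoothFunctions (d : ℕ) : Submodule ℝ (E d → ℝ) where
  carrier := {w | ContDiff ℝ (⊤ : ℕ∞) w}
  add_mem' := by
    intro u w hu hw
    exact ContDiff.add (show ContDiff ℝ (⊤ : ℕ∞) u from hu) (show ContDiff ℝ (⊤ : ℕ∞) w from hw)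
  zero_mem' := show ContDiff ℝ (⊤ : ℕ∞) (fun _ => (0 : ℝ)) from contDiff_const
  smul_mem' := by
    intro r u hu
    exact ContDiff.const_smul r (show ContDiff ℝ (⊤ : ℕ∞) u from hu)

/-- The norm of `W^{1,∞}(Ω)` (for functions that are locally Lipschitz on the open set `Ω`, whose
weak gradient is the pointwise almost everywhere gradient). -/
def w1inftyNorm {d : ℕ} (Ω : Set (E d)) (u : E d → ℝ) : ℝ≥0∞ :=
  eLpNorm u ∞ (volume.restrict Ω) + eLpNorm (gradient u) ∞ (volume.restrict Ω)

/-! ### The numerical scheme -/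

/-- A sequence of meshes and time grids, with a splitting of the coefficients into explicit (`E`)
and implicit (`I`) parts. -/
structure Discretisation {d : ℕ} {A : Type*} [TopologicalSpace A] (𝔭 : Problem d A) where
  mesh : ℕ → Mesh d
  /-- time step size and number of time steps -/
  h : ℕ → ℝ
  N : ℕ → ℕ
  aE : ℕ → A → E d → ℝ
  aI : ℕ → A → E d → ℝ
  bE : ℕ → A → E d → E d
  bI : ℕ → A → E d → E d
  cE : ℕ → A → E d → ℝ
  cI : ℕ → A → E d → ℝ
  f : ℕ → A → E d → ℝ
  /-- split coefficients and data of the Robin operators -/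
  bBE : ℕ → A → E d → E d
  bBI : ℕ → A → E d → E d
  cBE : ℕ → A → E d → ℝ
  cBI : ℕ → A → E d → ℝ
  gB : ℕ → A → E d → ℝ
  isMesh : ∀ i, (mesh i).IsMeshOf 𝔭.P
  subordinate : ∀ i, (mesh i).IsSubordinate 𝔭.toDomain
  /-- shape regularity: the elements contain balls of comparable radius -/
  shapeRegular : ∃ σ : ℝ, ∀ i, ∀ s ∈ (mesh i).elements, ∃ x : E d, ∃ r : ℝ, 0 < r ∧
    Metric.closedBall x r ⊆ convexHull ℝ (s : Set (E d)) ∧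
    Metric.diam (convexHull ℝ (s : Set (E d))) ≤ σ * r
  size_tendsto : Tendsto (fun i => (mesh i).size) atTop (𝓝 0)
  h_pos : ∀ i, 0 < h i
  N_mul_h : ∀ i, N i * h i = 𝔭.T
  h_tendsto : Tendsto h atTop (𝓝 0)
  aE_cont : ∀ i α, ContinuousOn (aE i α) 𝔭.P
  aI_cont : ∀ i α, ContinuousOn (aI i α) 𝔭.P
  bE_cont : ∀ i α, ContinuousOn (bE i α) 𝔭.P
  bI_cont : ∀ i α, ContinuousOn (bI i α) 𝔭.P
  cE_cont : ∀ i α, ContinuousOn (cE i α) 𝔭.P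
  cI_cont : ∀ i α, ContinuousOn (cI i α) 𝔭.P
  f_cont : ∀ i α, ContinuousOn (f i α) 𝔭.P
  bBE_pc : ∀ i α, 𝔭.IsPC (bBE i α)
  bBI_pc : ∀ i α, 𝔭.IsPC (bBI i α)
  cBE_pc : ∀ i α, 𝔭.IsPC (cBE i α)
  cBI_pc : ∀ i α, 𝔭.IsPC (cBI i α)
  gB_pc : ∀ i α, 𝔭.IsPC (gB i α)
  cE_nonneg : ∀ i α, ∀ x ∈ 𝔭.P, 0 ≤ cE i α x
  cI_nonneg : ∀ i α, ∀ x ∈ 𝔭.P, 0 ≤ cI i α x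
  f_nonneg : ∀ i α, ∀ x ∈ 𝔭.P, 0 ≤ f i α x
  cBE_nonneg : ∀ i α, ∀ x ∈ frontier 𝔭.P, 0 ≤ cBE i α x
  cBI_nonneg : ∀ i α, ∀ x ∈ frontier 𝔭.P, 0 ≤ cBI i α x
  gB_nonneg : ∀ i α, ∀ x ∈ frontier 𝔭.P, 0 ≤ gB i α x
  bBE_cone : ∀ i α, ∀ x ∈ frontier 𝔭.P, bBE i α x ∈ tangentCone 𝔭.P x
  bBI_cone : ∀ i α, ∀ x ∈ frontier 𝔭.P, bBI i α x ∈ tangentCone 𝔭.P x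

namespace Discretisation

variable {d : ℕ} {A : Type*} [TopologicalSpace A] {𝔭 : Problem d A} (𝔰 : Discretisation 𝔭)

/-- The discretisation of `-a Δw - b · ∇w + c w` at the interior node `y`. -/
def interiorOp (i : ℕ) (a : E d → ℝ) (b : E d → E d) (c : E d → ℝ) (w : E d → ℝ) (y : E d) : ℝ :=
  a y * (∫ x in 𝔭.Ω, ⟪gradient w x, gradient ((𝔰.mesh i).hat1 y) x⟫) +
    ∫ x in 𝔭.Ω, (-⟪b x, gradient w x⟫ + c x * w x) * (𝔰.mesh i).hat1 y x

/-- The discretisation of `-b · ∇w + c w` at the Robin node `y`. -/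
def robinOp (b : E d → E d) (c : E d → ℝ) (w : E d → ℝ) (y : E d) : ℝ :=
  lowerDini w y (b y) + c y * w y

open Classical in
/-- The entry of the explicit operator at the node `y`. -/
def opE (i : ℕ) (α : A) (w : E d → ℝ) (y : E d) : ℝ :=
  if y ∈ 𝔭.Ω then 𝔰.interiorOp i (𝔰.aE i α) (𝔰.bE i α) (𝔰.cE i α) w y
  else if y ∈ 𝔭.bdt ∪ 𝔭.bdR then robinOp (𝔰.bBE i α) (𝔰.cBE i α) w y
  else 0

open Classical in
/-- The entry of the implicit operator at the node `y`. -/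
def opI (i : ℕ) (α : A) (w : E d → ℝ) (y : E d) : ℝ :=
  if y ∈ 𝔭.Ω then 𝔰.interiorOp i (𝔰.aI i α) (𝔰.bI i α) (𝔰.cI i α) w y
  else if y ∈ 𝔭.bdt ∪ 𝔭.bdR then robinOp (𝔰.bBI i α) (𝔰.cBI i α) w y
  else w y

open Classical in
/-- The entry of the right-hand side at the node `y`. -/
def rhs (i : ℕ) (α : A) (y : E d) : ℝ :=
  if y ∈ 𝔭.Ω then ∫ x in 𝔭.Ω, 𝔰.f i α x * (𝔰.mesh i).hat1 y x
  else if y ∈ 𝔭.bdt ∪ 𝔭.bdR then 𝔰.gB i α y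
  else 𝔭.g y

open Classical in
/-- The discrete time derivative at the node `y`, from the values `w'` at the next time step and
`w` at the current one. -/
def timeDiff (i : ℕ) (w' w : E d → ℝ) (y : E d) : ℝ :=
  if y ∈ 𝔭.Ω ∪ 𝔭.bdt then (w' y - w y) / 𝔰.h i else 0

/-- `v i k` is the numerical solution at refinement level `i` and time `k * h i`. -/
def IsNumericalSolution (v : ℕ → ℕ → E d → ℝ) : Prop :=
  ∀ i, (∀ k ≤ 𝔰.N i, v i k ∈ (𝔰.mesh i).P1) ∧
    (∀ y ∈ (𝔰.mesh i).vertices, v i (𝔰.N i) y = 𝔭.vT y) ∧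
    ∀ k < 𝔰.N i, ∀ y ∈ (𝔰.mesh i).vertices,
      -𝔰.timeDiff i (v i (k + 1)) (v i k) y +
        ⨆ α, (𝔰.opE i α (v i (k + 1)) y + 𝔰.opI i α (v i k) y - 𝔰.rhs i α y) = 0

/-! #### Assumptions on the scheme -/

/-- Consistency of the coefficients; continuous dependence on the control; uniform boundedness of
the split drifts; fully implicit discretisation, with positive zeroth order term, on the Robin
boundary without time derivative. -/
structure IsConsistent : Prop where
  interior_diffusion : ∀ ε : ℝ, 0 < ε → ∀ᶠ i in atTop, ∀ α, ∀ y ∈ (𝔰.mesh i).vertices, y ∉ 𝔭.bdD →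
    ∀ x ∈ tsupport ((𝔰.mesh i).hat y), |𝔭.a α x - (𝔰.aE i α y + 𝔰.aI i α y)| ≤ ε
  interior_lower : ∀ ε : ℝ, 0 < ε → ∀ᶠ i in atTop, ∀ α, ∀ x ∈ 𝔭.P,
    ‖𝔭.b α x - (𝔰.bE i α x + 𝔰.bI i α x)‖ ≤ ε ∧ |𝔭.c α x - (𝔰.cE i α x + 𝔰.cI i α x)| ≤ ε ∧
    |𝔭.f α x - 𝔰.f i α x| ≤ ε
  boundary : ∀ ε : ℝ, 0 < ε → ∀ᶠ i in atTop, ∀ α, ∀ x ∈ frontier 𝔭.P,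
    ‖𝔭.bB α x - (𝔰.bBE i α x + 𝔰.bBI i α x)‖ ≤ ε ∧
    |𝔭.cB α x - (𝔰.cBE i α x + 𝔰.cBI i α x)| ≤ ε ∧ |𝔭.gB α x - 𝔰.gB i α x| ≤ ε
  aE_ctrl : ∀ i, SupNormContinuous 𝔭.P (𝔰.aE i)
  aI_ctrl : ∀ i, SupNormContinuous 𝔭.P (𝔰.aI i)
  bE_ctrl : ∀ i, SupNormContinuous 𝔭.P (𝔰.bE i)
  bI_ctrl : ∀ i, SupNormContinuous 𝔭.P (𝔰.bI i)
  cE_ctrl : ∀ i, SupNormContinuous 𝔭.P (𝔰.cE i)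
  cI_ctrl : ∀ i, SupNormContinuous 𝔭.P (𝔰.cI i)
  f_ctrl : ∀ i, SupNormContinuous 𝔭.P (𝔰.f i)
  bBE_ctrl : ∀ i, SupNormContinuous (frontier 𝔭.P) (𝔰.bBE i)
  bBI_ctrl : ∀ i, SupNormContinuous (frontier 𝔭.P) (𝔰.bBI i)
  cBE_ctrl : ∀ i, SupNormContinuous (frontier 𝔭.P) (𝔰.cBE i)
  cBI_ctrl : ∀ i, SupNormContinuous (frontier 𝔭.P) (𝔰.cBI i)
  gB_ctrl : ∀ i, SupNormContinuous (frontier 𝔭.P) (𝔰.gB i)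
  bounded_interior : ∃ C : ℝ, ∀ i α, ∀ x ∈ 𝔭.P, ‖𝔰.bE i α x‖ ≤ C ∧ ‖𝔰.bI i α x‖ ≤ C
  bounded_boundary : ∃ C : ℝ, ∀ i α, ∀ x ∈ frontier 𝔭.P, ‖𝔰.bBE i α x‖ ≤ C ∧ ‖𝔰.bBI i α x‖ ≤ C
  implicit_bdR : ∀ i α, ∀ x ∈ 𝔭.bdR, 𝔰.bBE i α x = 0 ∧ 𝔰.cBE i α x = 0 ∧ 0 < 𝔰.cBI i α x

/-- Strict acuteness of the `i`-th mesh with constant `θ`. -/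
def IsStrictlyAcute (i : ℕ) (θ : ℝ) : Prop :=
  ∀ y ∈ (𝔰.mesh i).vertices, y ∉ 𝔭.bdD → ∀ z ∈ (𝔰.mesh i).vertices, y ≠ z →
    ∀ s ∈ (𝔰.mesh i).elements, ∀ x ∈ interior (convexHull ℝ (s : Set (E d))),
      ⟪gradient ((𝔰.mesh i).hat y) x, gradient ((𝔰.mesh i).hat z) x⟫ ≤
        -(Real.sin θ * ‖gradient ((𝔰.mesh i).hat y) x‖ * ‖gradient ((𝔰.mesh i).hat z) x‖)

/-- `ν` is an admissible artificial diffusion coefficient at the node `y` for the coefficients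
`b`, `c`. -/
def IsArtificialDiffusion (i : ℕ) (θ : ℝ) (b : E d → E d) (c : E d → ℝ) (y : E d) (ν : ℝ) : Prop :=
  0 ≤ ν ∧ ∀ s ∈ (𝔰.mesh i).elements, y ∈ s →
    vecNormOn (interior (convexHull ℝ (s : Set (E d)))) b +
        Metric.diam (convexHull ℝ (s : Set (E d))) *
          sSup ((fun x => |c x|) '' interior (convexHull ℝ (s : Set (E d)))) ≤
      ν * Real.sin θ *
        vecNormOn (interior (convexHull ℝ (s : Set (E d)))) (gradient ((𝔰.mesh i).hat1 y)) *
        volume.real (convexHull ℝ (s : Set (E d)))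

/-- Strict acuteness and artificial diffusion: the second order coefficients dominate admissible
artificial diffusion coefficients at the interior nodes. -/
def HasArtificialDiffusion : Prop :=
  ∀ i, ∃ θ ∈ Ioo 0 (Real.pi / 2), 𝔰.IsStrictlyAcute i θ ∧
    ∀ α, ∀ y ∈ (𝔰.mesh i).vertices, y ∈ 𝔭.Ω →
      (∃ ν, 𝔰.IsArtificialDiffusion i θ (𝔰.bE i α) (𝔰.cE i α) y ν ∧ ν ≤ 𝔰.aE i α y) ∧
      (∃ ν, 𝔰.IsArtificialDiffusion i θ (𝔰.bI i α) (𝔰.cI i α) y ν ∧ ν ≤ 𝔰.aI i α y)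

/-- Smallness of the time step: the diagonal entries of `h E - Id` that belong to the nodes with
a time derivative are non-positive. -/
def TimeStepRestriction : Prop :=
  ∀ i α, ∀ y ∈ (𝔰.mesh i).vertices, y ∈ 𝔭.Ω ∪ 𝔭.bdt →
    𝔰.h i * 𝔰.opE i α ((𝔰.mesh i).hat y) y ≤ 1

/-- Existence of stable and convergent linear elliptic projections. -/
def HasEllipticProjection : Prop :=
  ∃ Pr : ∀ i, smoothFunctions d →ₗ[ℝ] (𝔰.mesh i).P1,
    (∀ i w, ∀ y ∈ (𝔰.mesh i).vertices, y ∈ 𝔭.Ω →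
      ∫ x in 𝔭.Ω, ⟪gradient (Pr i w : E d → ℝ) x, gradient ((𝔰.mesh i).hat1 y) x⟫ =
        ∫ x in 𝔭.Ω, ⟪gradient (w : E d → ℝ) x, gradient ((𝔰.mesh i).hat1 y) x⟫) ∧
    (∃ C : ℝ≥0, ∀ w i, w1inftyNorm 𝔭.Ω (Pr i w) ≤ C * w1inftyNorm 𝔭.Ω w) ∧
    ∀ w, Tendsto (fun i => w1inftyNorm 𝔭.Ω ((Pr i w : E d → ℝ) - (w : E d → ℝ))) atTop (𝓝 0)

/-! #### Limits of the numerical solutions -/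

/-- The filter on triples `(i, k, y)`, with `y` a node and `k` a time step of the `i`-th
refinement, that describes `i → ∞` and `(k * h i, y) → z`. -/
def nodesTo (z : ℝ × E d) : Filter (ℕ × ℕ × E d) :=
  comap (fun n : ℕ × ℕ × E d => n.1) atTop ⊓
    comap (fun n : ℕ × ℕ × E d => ((n.2.1 : ℝ) * 𝔰.h n.1, n.2.2)) (𝓝 z) ⊓
    𝓟 {n | n.2.1 ≤ 𝔰.N n.1 ∧ n.2.2 ∈ (𝔰.mesh n.1).vertices}

/-- Upper envelope of the numerical solutions: the largest limit of nodal values along nodes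
converging to `z`. -/
def upperLimit (v : ℕ → ℕ → E d → ℝ) (z : ℝ × E d) : EReal :=
  limsup (fun n : ℕ × ℕ × E d => (v n.1 n.2.1 n.2.2 : EReal)) (𝔰.nodesTo z)

/-- Lower envelope of the numerical solutions. -/
def lowerLimit (v : ℕ → ℕ → E d → ℝ) (z : ℝ × E d) : EReal :=
  liminf (fun n : ℕ × ℕ × E d => (v n.1 n.2.1 n.2.2 : EReal)) (𝔰.nodesTo z)

/-- The function on `[0,T] × P` that is affine in time between the time steps and equal to `v i k`
at time `k * h i`. -/
def timeInterpolant (v : ℕ → ℕ → E d → ℝ) (i : ℕ) (z : ℝ × E d) : ℝ :=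
  (1 - Int.fract (z.1 / 𝔰.h i)) * v i ⌊z.1 / 𝔰.h i⌋₊ z.2 +
    Int.fract (z.1 / 𝔰.h i) * v i (⌊z.1 / 𝔰.h i⌋₊ + 1) z.2

end Discretisation

end HJBFEM

end

/-! The argument follows Barles and Souganidis: the upper and lower envelopes of a monotone, stable
and consistent scheme are a viscosity subsolution and supersolution, and the comparison principle
makes them coincide.

Monotonicity (`Discretisation.lin_mono`). Strict acuteness gives the off-diagonal diffusion terms a
definite sign, and the artificial diffusion makes them dominate drift and reaction on each element
(`interiorOp_nonneg`). At Robin nodes the Dini derivative of a piecewise affine function along a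
tangent-cone direction is a difference quotient inside one element. The time step restriction
absorbs the diagonal of the explicit part.

Consistency (`Discretisation.consistency`). Test functions enter the scheme through their elliptic
projections. For a quadratic function `e` the Galerkin identity and one integration by parts give
exactly `-Δe` at every interior node, because `Δe` is constant and the normalised hat function has
mass one. Convergence of the projections in `W^{1,∞}` controls first and zeroth order terms, also at
boundary nodes. Only quadratics are needed: a `C²` test function is dominated, strictly away from
the contact point, by a quadratic in space plus a quadratic in time whose Laplacian exceeds the
original one by a small `κ` (`exists_quad_above`). Semicontinuity of the envelopes of `F` leaves
room for this `κ`. The time-dependent part is constant in space, so the discrete test function is a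
fixed projection plus a constant at each time level.

Touching (`exists_touching`). Strictness of the contact forces the grid functions to touch the
discrete test functions at nodes close to the contact point. Monotonicity and consistency turn this
into inequalities for the linear operators, respectively for `F`, near the jet (`exists_FLin_le`,
`exists_le_F`).

Stability. Numerical solutions are nonnegative by a discrete minimum principle, backwards in time.
If they exceeded the strict supersolution `w` by more than one on infinitely many levels, the
maximum points would accumulate somewhere, and the touching argument there would contradict
strictness. The size of the excess is irrelevant, since adding a positive constant does not decrease
the linear operators.

Conclusion. The envelopes are finite, comparison makes them equal and hence continuous, and
compactness upgrades this to uniform convergence. Uniqueness is comparison with the envelopes. -/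

namespace HJBFEM

/-! ### Barycentric coordinates and piecewise affine functions -/

section Barycentric

variable {d : ℕ}

theorem barycentric_unique {s : Finset (E d)} (hs : AffineIndependent ℝ ((↑) : s → E d))
    {μ ν : E d → ℝ} (h1 : ∑ z ∈ s, μ z = ∑ z ∈ s, ν z)
    (h2 : ∑ z ∈ s, μ z • z = ∑ z ∈ s, ν z • z) : ∀ z ∈ s, μ z = ν z := by
  intro z hz
  have := (affineIndependent_iff.1 hs) Finset.univ (fun z => μ z - ν z) ?_ ?_ ⟨z, hz⟩
    (Finset.mem_univ _)
  · simpa [sub_eq_zero] using this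
  · rw [Finset.sum_coe_sort s (fun z => μ z - ν z), Finset.sum_sub_distrib, h1, sub_self]
  · rw [Finset.sum_coe_sort s (fun z => (μ z - ν z) • z)]
    simp only [sub_smul]
    rw [Finset.sum_sub_distrib, h2, sub_self]

theorem affineMap_combination (l : E d →ᵃ[ℝ] ℝ) {s : Finset (E d)} {μ : E d → ℝ}
    (h1 : ∑ z ∈ s, μ z = 1) : l (∑ z ∈ s, μ z • z) = ∑ z ∈ s, μ z * l z := by
  have key : ∀ x, l x = l.linear x + l 0 := fun x => by simpa using l.map_vadd 0 x
  rw [key, map_sum]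
  simp only [map_smul, smul_eq_mul]
  rw [Finset.sum_congr rfl (fun z _ => by rw [key z, mul_add] :
    ∀ z ∈ s, μ z * l z = μ z * l.linear z + μ z * l 0), Finset.sum_add_distrib, ← Finset.sum_mul,
    h1, one_mul]

theorem exists_inner_eq_affineMap (l : E d →ᵃ[ℝ] ℝ) : ∃ (g : E d) (c : ℝ), ∀ x, l x = ⟪g, x⟫ + c := by
  refine ⟨(InnerProductSpace.toDual ℝ (E d)).symm (LinearMap.toContinuousLinearMap l.linear), l 0,
    fun x => ?_⟩
  rw [InnerProductSpace.toDual_symm_apply]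
  simpa using l.map_vadd 0 x

end Barycentric

namespace Mesh

variable {d : ℕ} {𝒯 : Mesh d} {P : Set (E d)}

theorem affineSpan_element {s : Finset (E d)} (hs : s ∈ 𝒯.elements) :
    affineSpan ℝ (s : Set (E d)) = ⊤ := by
  have := (𝒯.indep hs.1).affineSpan_eq_top_iff_card_eq_finrank_add_one
  simp only [Subtype.range_coe_subtype, Fintype.card_coe, finrank_euclideanSpace, Fintype.card_fin,
    Finset.setOfPred_mem] at this
  exact this.2 hs.2

theorem interior_element_nonempty {s : Finset (E d)} (hs : s ∈ 𝒯.elements) :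
    (interior (convexHull ℝ (s : Set (E d)))).Nonempty :=
  interior_convexHull_nonempty_iff_affineSpan_eq_top.2 (affineSpan_element hs)

theorem closure_interior_element {s : Finset (E d)} (hs : s ∈ 𝒯.elements) :
    closure (interior (convexHull ℝ (s : Set (E d)))) = convexHull ℝ (s : Set (E d)) := by
  rw [(convex_convexHull ℝ _).closure_interior_eq_closure_of_nonempty_interior
    (interior_element_nonempty hs)]
  exact (s.finite_toSet.isCompact_convexHull ℝ).isClosed.closure_eq

theorem exists_coord {s : Finset (E d)} (hs : s ∈ 𝒯.elements) {y : E d} (hy : y ∈ s) :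
    ∃ l : E d →ᵃ[ℝ] ℝ, ∀ z ∈ s, l z = if z = y then 1 else 0 := by
  classical
  let b : AffineBasis s ℝ (E d) := ⟨(↑), 𝒯.indep hs.1, by simpa using affineSpan_element hs⟩
  refine ⟨b.coord ⟨y, hy⟩, fun z hz => ?_⟩
  have := b.coord_apply ⟨y, hy⟩ ⟨z, hz⟩
  have hb : b ⟨z, hz⟩ = z := rfl
  rw [hb] at this
  rw [this]
  simp [eq_comm]

theorem mem_convexHull {s : Finset (E d)} {x : E d} : x ∈ convexHull ℝ (s : Set (E d)) ↔
    ∃ μ : E d → ℝ, (∀ z ∈ s, 0 ≤ μ z) ∧ ∑ z ∈ s, μ z = 1 ∧ ∑ z ∈ s, μ z • z = x :=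
  Finset.mem_convexHull'

/-- Barycentric coordinates on a common face of two faces, extended by zero. -/
theorem exists_common_coords {s t : Finset (E d)} (hs : s ∈ 𝒯.faces) (ht : t ∈ 𝒯.faces) {x : E d}
    (hxs : x ∈ convexHull ℝ (s : Set (E d))) (hxt : x ∈ convexHull ℝ (t : Set (E d))) :
    ∃ κ : E d → ℝ, (∀ z, z ∉ s → κ z = 0) ∧ (∀ z, z ∉ t → κ z = 0) ∧ (∀ z, 0 ≤ κ z) ∧
      ∑ z ∈ s, κ z = 1 ∧ ∑ z ∈ s, κ z • z = x ∧ ∑ z ∈ t, κ z = 1 ∧ ∑ z ∈ t, κ z • z = x := by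
  classical
  have hx := 𝒯.inter_subset_convexHull hs ht ⟨hxs, hxt⟩
  rw [← Finset.coe_inter, mem_convexHull] at hx
  obtain ⟨μ, h0, h1, h2⟩ := hx
  have A : ∀ u : Finset (E d), s ∩ t ⊆ u →
      ∑ z ∈ u, (if z ∈ s ∩ t then μ z else 0) = 1 ∧
      ∑ z ∈ u, (if z ∈ s ∩ t then μ z else 0) • z = x := by
    intro u hu
    constructor
    · rw [← Finset.sum_subset hu, Finset.sum_congr rfl, h1]
      · intro z hz; rw [if_pos hz]
      · intro z _ hz; rw [if_neg hz]
    · rw [← Finset.sum_subset hu, Finset.sum_congr rfl, h2]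
      · intro z hz; rw [if_pos hz]
      · intro z _ hz; rw [if_neg hz, zero_smul]
  refine ⟨fun z => if z ∈ s ∩ t then μ z else 0, ?_, ?_, ?_, (A s Finset.inter_subset_left).1,
    (A s Finset.inter_subset_left).2, (A t Finset.inter_subset_right).1,
    (A t Finset.inter_subset_right).2⟩
  · intro z hz; exact if_neg fun h => hz (Finset.mem_inter.1 h).1
  · intro z hz; exact if_neg fun h => hz (Finset.mem_inter.1 h).2
  · intro z
    by_cases h : z ∈ s ∩ t
    · simpa only [if_pos h] using h0 z h
    · simp only [if_neg h, le_refl]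

/-- The supremum that defines `hat` runs over a single number: representations of the point in two
faces both agree with the one in their common face. -/
theorem hat_eq {s : Finset (E d)} (hs : s ∈ 𝒯.faces) {y : E d} (hy : y ∈ s) {μ : E d → ℝ}
    (h0 : ∀ z ∈ s, 0 ≤ μ z) (h1 : ∑ z ∈ s, μ z = 1) : 𝒯.hat y (∑ z ∈ s, μ z • z) = μ y := by
  have : {r : ℝ | ∃ t ∈ 𝒯.faces, y ∈ t ∧ ∃ ν : E d → ℝ, (∀ z ∈ t, 0 ≤ ν z) ∧
      ∑ z ∈ t, ν z = 1 ∧ ∑ z ∈ t, ν z • z = ∑ z ∈ s, μ z • z ∧ r = ν y} = {μ y} := by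
    apply Subset.antisymm
    · rintro r ⟨t, ht, hyt, ν, hν0, hν1, hν2, rfl⟩
      obtain ⟨κ, -, -, -, hs1, hs2, ht1, ht2⟩ := exists_common_coords hs ht
        (mem_convexHull.2 ⟨μ, h0, h1, rfl⟩) (mem_convexHull.2 ⟨ν, hν0, hν1, hν2⟩)
      rw [mem_singleton_iff, ← barycentric_unique (𝒯.indep hs) (hs1.trans h1.symm) hs2 y hy,
        ← barycentric_unique (𝒯.indep ht) (ht1.trans hν1.symm) (ht2.trans hν2.symm) y hyt]
    · rintro r rfl
      exact ⟨s, hs, hy, μ, h0, h1, rfl, rfl⟩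
  rw [Mesh.hat, this, csSup_singleton]

theorem hat_eq_zero {t : Finset (E d)} (ht : t ∈ 𝒯.faces) {y x : E d} (hy : y ∉ t)
    (hx : x ∈ convexHull ℝ (t : Set (E d))) : 𝒯.hat y x = 0 := by
  have : {r : ℝ | ∃ t ∈ 𝒯.faces, y ∈ t ∧ ∃ ν : E d → ℝ, (∀ z ∈ t, 0 ≤ ν z) ∧
      ∑ z ∈ t, ν z = 1 ∧ ∑ z ∈ t, ν z • z = x ∧ r = ν y} ⊆ {0} := by
    rintro r ⟨s, hs, hys, ν, hν0, hν1, hν2, rfl⟩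
    obtain ⟨κ, -, h0, -, hs1, hs2, -⟩ := exists_common_coords hs ht
      (mem_convexHull.2 ⟨ν, hν0, hν1, hν2⟩) hx
    rw [mem_singleton_iff, ← barycentric_unique (𝒯.indep hs) (hs1.trans hν1.symm)
      (hs2.trans hν2.symm) y hys, h0 y hy]
  rw [Mesh.hat]
  -- The set may be empty, and then the default `sSup ∅ = 0` is the right value.
  rcases subset_singleton_iff_eq.1 this with h | h <;> rw [h] <;> simp

theorem hat_eq_zero_of_notMem {y x : E d} (hx : x ∉ 𝒯.space) : 𝒯.hat y x = 0 := by
  have : {r : ℝ | ∃ t ∈ 𝒯.faces, y ∈ t ∧ ∃ ν : E d → ℝ, (∀ z ∈ t, 0 ≤ ν z) ∧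
      ∑ z ∈ t, ν z = 1 ∧ ∑ z ∈ t, ν z • z = x ∧ r = ν y} = ∅ := by
    rw [eq_empty_iff_forall_notMem]
    rintro r ⟨s, hs, hys, ν, hν0, hν1, hν2, rfl⟩
    exact hx (𝒯.convexHull_subset_space hs (mem_convexHull.2 ⟨ν, hν0, hν1, hν2⟩))
  rw [Mesh.hat, this, Real.sSup_empty]

theorem hat_nonneg (y x : E d) : 0 ≤ 𝒯.hat y x := by
  apply Real.sSup_nonneg
  rintro r ⟨s, hs, hys, ν, hν0, hν1, hν2, rfl⟩
  exact hν0 y hys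

theorem hat_le_one (y x : E d) : 𝒯.hat y x ≤ 1 := by
  apply Real.sSup_le _ zero_le_one
  rintro r ⟨s, hs, hys, ν, hν0, hν1, hν2, rfl⟩
  rw [← hν1]
  exact Finset.single_le_sum hν0 hys

theorem hat_eqOn_coord {s : Finset (E d)} (hs : s ∈ 𝒯.elements) {y : E d} (hy : y ∈ s)
    {l : E d →ᵃ[ℝ] ℝ} (hl : ∀ z ∈ s, l z = if z = y then 1 else 0) :
    EqOn (𝒯.hat y) l (convexHull ℝ (s : Set (E d))) := by
  intro x hx
  obtain ⟨μ, h0, h1, rfl⟩ := mem_convexHull.1 hx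
  rw [hat_eq hs.1 hy h0 h1, affineMap_combination l h1,
    Finset.sum_congr rfl (fun z hz => by rw [hl z hz])]
  simp [hy]

theorem hat_mem_P1 (y : E d) : 𝒯.hat y ∈ 𝒯.P1 := by
  refine ⟨fun s hs => ?_, fun x hx => hat_eq_zero_of_notMem hx⟩
  by_cases hy : y ∈ s
  · obtain ⟨l, hl⟩ := exists_coord hs hy
    exact ⟨l, hat_eqOn_coord hs hy hl⟩
  · exact ⟨0, fun x hx => by simpa using hat_eq_zero hs.1 hy hx⟩

theorem hat_vertex {s : Finset (E d)} (hs : s ∈ 𝒯.faces) {y z : E d} (hz : z ∈ s)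
    [Decidable (z = y)] : 𝒯.hat y z = if z = y then 1 else 0 := by
  classical
  have hzs : ({z} : Finset (E d)) ∈ 𝒯.faces :=
    𝒯.down_closed hs (Finset.singleton_subset_iff.2 hz) (Finset.singleton_nonempty z)
  split_ifs with h
  · subst h
    have := hat_eq (𝒯 := 𝒯) hzs (Finset.mem_singleton_self z) (μ := fun _ => 1) (by simp) (by simp)
    simpa using this
  · exact hat_eq_zero hzs (by simpa using fun h' => h h'.symm) (by simp)

theorem P1_combination {w : E d → ℝ} (hw : w ∈ 𝒯.P1) {s : Finset (E d)} (hs : s ∈ 𝒯.elements)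
    {μ : E d → ℝ} (h0 : ∀ z ∈ s, 0 ≤ μ z) (h1 : ∑ z ∈ s, μ z = 1) :
    w (∑ z ∈ s, μ z • z) = ∑ z ∈ s, μ z * w z := by
  obtain ⟨l, hl⟩ := hw.1 s hs
  rw [hl (mem_convexHull.2 ⟨μ, h0, h1, rfl⟩), affineMap_combination l h1]
  exact Finset.sum_congr rfl fun z hz => by rw [hl (subset_convexHull ℝ _ hz)]

/-- On an element, a piecewise affine function has a constant gradient. -/
theorem exists_grad {w : E d → ℝ} (hw : w ∈ 𝒯.P1) {s : Finset (E d)} (hs : s ∈ 𝒯.elements) :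
    ∃ (g : E d) (c : ℝ), (∀ x ∈ convexHull ℝ (s : Set (E d)), w x = ⟪g, x⟫ + c) ∧
      ∀ x ∈ interior (convexHull ℝ (s : Set (E d))), HasGradientAt w g x := by
  obtain ⟨l, hl⟩ := hw.1 s hs
  obtain ⟨g, c, hg⟩ := exists_inner_eq_affineMap l
  have hgx : ∀ x ∈ convexHull ℝ (s : Set (E d)), w x = ⟪g, x⟫ + c := fun x hx => by
    rw [hl hx, hg]
  refine ⟨g, c, hgx, fun x hx => ?_⟩
  have h1 : HasGradientAt (fun x : E d => ⟪g, x⟫ + c) g x := by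
    rw [hasGradientAt_iff_hasFDerivAt]
    exact ((InnerProductSpace.toDual ℝ (E d)) g).hasFDerivAt.add_const c
  refine h1.congr_of_eventuallyEq ?_
  filter_upwards [isOpen_interior.mem_nhds hx] with z hz using hgx z (interior_subset hz)

/-! ### Integration over the mesh -/

theorem elements_finite (h : 𝒯.IsMeshOf P) : 𝒯.elements.Finite := h.1.subset fun _ hs => hs.1

/-- The finite set of elements. -/
noncomputable def elts (h : 𝒯.IsMeshOf P) : Finset (Finset (E d)) := (elements_finite h).toFinset

theorem mem_elts (h : 𝒯.IsMeshOf P) {s : Finset (E d)} : s ∈ elts h ↔ s ∈ 𝒯.elements := by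
  simp [elts]

theorem element_subset (h : 𝒯.IsMeshOf P) {s : Finset (E d)} (hs : s ∈ 𝒯.elements) :
    convexHull ℝ (s : Set (E d)) ⊆ P := by
  rw [← h.2.2]; exact 𝒯.convexHull_subset_space hs.1

theorem exists_element (h : 𝒯.IsMeshOf P) {x : E d} (hx : x ∈ P) :
    ∃ s ∈ 𝒯.elements, x ∈ convexHull ℝ (s : Set (E d)) := by
  rw [← h.2.2, 𝒯.mem_space_iff] at hx
  obtain ⟨s, hs, hxs⟩ := hx
  obtain ⟨t, ht, hst⟩ := h.2.1 s hs
  exact ⟨t, ht, convexHull_mono (by exact_mod_cast hst) hxs⟩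

theorem eq_iUnion_elements (h : 𝒯.IsMeshOf P) :
    P = ⋃ s ∈ elts h, convexHull ℝ (s : Set (E d)) := by
  apply Subset.antisymm
  · intro x hx
    obtain ⟨s, hs, hxs⟩ := exists_element h hx
    exact mem_biUnion (mem_elts h |>.2 hs) hxs
  · exact iUnion₂_subset fun s hs => element_subset h ((mem_elts h).1 hs)

theorem isCompact_of_isMeshOf (h : 𝒯.IsMeshOf P) : IsCompact P := by
  rw [eq_iUnion_elements h]
  exact (elts h).isCompact_biUnion fun s _ => s.finite_toSet.isCompact_convexHull ℝ

theorem interior_element_subset (h : 𝒯.IsMeshOf P) {s : Finset (E d)} (hs : s ∈ 𝒯.elements) :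
    interior (convexHull ℝ (s : Set (E d))) ⊆ interior P :=
  interior_mono (element_subset h hs)

theorem subset_closure_interior (h : 𝒯.IsMeshOf P) : P ⊆ closure (interior P) := by
  intro x hx
  obtain ⟨s, hs, hxs⟩ := exists_element h hx
  rw [← closure_interior_element hs] at hxs
  exact closure_mono (interior_element_subset h hs) hxs

/-- Distinct elements share at most `d` vertices, and by conformity they meet inside the affine span
of these, which is a proper subspace. -/
theorem volume_inter_elements {s t : Finset (E d)} (hs : s ∈ 𝒯.elements) (ht : t ∈ 𝒯.elements)
    (hst : s ≠ t) : volume (convexHull ℝ (s : Set (E d)) ∩ convexHull ℝ (t : Set (E d))) = 0 := by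
  classical
  have h1 := 𝒯.inter_subset_convexHull hs.1 ht.1
  rw [← Finset.coe_inter] at h1
  refine measure_mono_null (h1.trans (convexHull_subset_affineSpan _)) ?_
  apply Measure.addHaar_affineSubspace
  intro htop
  have hcard : (s ∩ t).card < d + 1 := by
    rw [← hs.2]
    apply Finset.card_lt_card
    refine Finset.ssubset_iff_subset_ne.2 ⟨Finset.inter_subset_left, fun h => hst ?_⟩
    exact Finset.eq_of_subset_of_card_le (Finset.inter_eq_left.1 h) (by rw [hs.2, ht.2])
  have hind : AffineIndependent ℝ ((↑) : (s ∩ t : Finset (E d)) → E d) :=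
    (𝒯.indep hs.1).mono (by exact_mod_cast Finset.inter_subset_left)
  have := hind.affineSpan_eq_top_iff_card_eq_finrank_add_one
  simp only [Subtype.range_coe_subtype, Fintype.card_coe, finrank_euclideanSpace, Fintype.card_fin,
    Finset.setOfPred_mem] at this
  have := this.1 htop
  omega

theorem disjoint_interior_elements {s t : Finset (E d)} (hs : s ∈ 𝒯.elements)
    (ht : t ∈ 𝒯.elements) (hst : s ≠ t) : Disjoint (interior (convexHull ℝ (s : Set (E d))))
      (interior (convexHull ℝ (t : Set (E d)))) := by
  rw [Set.disjoint_iff_inter_eq_empty]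
  by_contra hne
  have h1 := (isOpen_interior.inter isOpen_interior).measure_pos volume
    (nonempty_iff_ne_empty.2 hne)
  exact h1.ne' (measure_mono_null (inter_subset_inter interior_subset interior_subset)
    (volume_inter_elements hs ht hst))

/-- Only frontiers of finitely many convex sets are lost, and these are null sets. Integrals over
the domain can therefore be split into elements, on whose interiors gradients are constant. -/
theorem interior_ae_eq (h : 𝒯.IsMeshOf P) : (interior P : Set (E d)) =ᵐ[volume]
    ⋃ s ∈ elts h, interior (convexHull ℝ (s : Set (E d))) := by
  refine (ae_le_set.2 (measure_mono_null (t := ⋃ s ∈ elts h,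
    frontier (convexHull ℝ (s : Set (E d)))) ?_ ?_)).antisymm
    (LE.le.eventuallyLE (iUnion₂_subset fun s hs =>
      interior_element_subset h ((mem_elts h).1 hs)))
  · rintro x ⟨hx, hx'⟩
    obtain ⟨s, hs, hxs⟩ := exists_element h (interior_subset hx)
    refine mem_biUnion ((mem_elts h).2 hs) ⟨subset_closure hxs, fun hi => hx' ?_⟩
    exact mem_biUnion (Finset.mem_coe.2 ((mem_elts h).2 hs)) hi
  · refine (measure_biUnion_null_iff (elts h).countable_toSet).2 fun s _ => ?_
    exact (convex_convexHull ℝ _).addHaar_frontier volume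

/-- Functions that agree in the interior of each element with a function that is continuous on the
closed element. -/
def IsPiecewiseCont (𝒯 : Mesh d) {V : Type*} [TopologicalSpace V] (f : E d → V) : Prop :=
  ∀ s ∈ 𝒯.elements, ∃ g, ContinuousOn g (convexHull ℝ (s : Set (E d))) ∧
    EqOn f g (interior (convexHull ℝ (s : Set (E d))))

namespace IsPiecewiseCont

theorem add {f f' : E d → ℝ} (hf : 𝒯.IsPiecewiseCont f) (hf' : 𝒯.IsPiecewiseCont f') :
    𝒯.IsPiecewiseCont (fun x => f x + f' x) := fun s hs => by
  obtain ⟨g, hg, he⟩ := hf s hs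
  obtain ⟨g', hg', he'⟩ := hf' s hs
  exact ⟨_, hg.add hg', fun x hx => by simp [he hx, he' hx]⟩

theorem neg {f : E d → ℝ} (hf : 𝒯.IsPiecewiseCont f) :
    𝒯.IsPiecewiseCont (fun x => -f x) := fun s hs => by
  obtain ⟨g, hg, he⟩ := hf s hs
  exact ⟨_, hg.neg, fun x hx => by simp [he hx]⟩

theorem mul {f f' : E d → ℝ} (hf : 𝒯.IsPiecewiseCont f) (hf' : 𝒯.IsPiecewiseCont f') :
    𝒯.IsPiecewiseCont (fun x => f x * f' x) := fun s hs => by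
  obtain ⟨g, hg, he⟩ := hf s hs
  obtain ⟨g', hg', he'⟩ := hf' s hs
  exact ⟨_, hg.mul hg', fun x hx => by simp [he hx, he' hx]⟩

theorem innerProd {f f' : E d → E d} (hf : 𝒯.IsPiecewiseCont f) (hf' : 𝒯.IsPiecewiseCont f') :
    𝒯.IsPiecewiseCont (fun x => ⟪f x, f' x⟫) := fun s hs => by
  obtain ⟨g, hg, he⟩ := hf s hs
  obtain ⟨g', hg', he'⟩ := hf' s hs
  exact ⟨_, hg.inner hg', fun x hx => by simp [he hx, he' hx]⟩

theorem of_continuousOn {V : Type*} [TopologicalSpace V] (h : 𝒯.IsMeshOf P) {f : E d → V}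
    (hf : ContinuousOn f P) : 𝒯.IsPiecewiseCont f :=
  fun _ hs => ⟨f, hf.mono (element_subset h hs), fun _ _ => rfl⟩

theorem of_P1 {w : E d → ℝ} (hw : w ∈ 𝒯.P1) : 𝒯.IsPiecewiseCont w := fun s hs => by
  obtain ⟨g, c, h1, -⟩ := exists_grad hw hs
  exact ⟨fun x => ⟪g, x⟫ + c, by fun_prop, fun x hx => h1 x (interior_subset hx)⟩

theorem grad_P1 {w : E d → ℝ} (hw : w ∈ 𝒯.P1) : 𝒯.IsPiecewiseCont (gradient w) := fun s hs => by
  obtain ⟨g, c, -, h1⟩ := exists_grad hw hs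
  exact ⟨fun x => g, by fun_prop, fun x hx => (h1 x hx).gradient⟩

theorem integrableOn_element {f : E d → ℝ} (hf : 𝒯.IsPiecewiseCont f) {s : Finset (E d)}
    (hs : s ∈ 𝒯.elements) : IntegrableOn f (interior (convexHull ℝ (s : Set (E d)))) := by
  obtain ⟨g, hg, he⟩ := hf s hs
  have := (hg.integrableOn_compact (μ := volume)
    (s.finite_toSet.isCompact_convexHull ℝ)).mono_set interior_subset
  exact this.congr_fun (fun x hx => (he hx).symm) isOpen_interior.measurableSet

theorem integrableOn (h : 𝒯.IsMeshOf P) {f : E d → ℝ} (hf : 𝒯.IsPiecewiseCont f) :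
    IntegrableOn f (interior P) := by
  rw [integrableOn_congr_set_ae (interior_ae_eq h), integrableOn_finset_iUnion]
  exact fun s hs => hf.integrableOn_element ((mem_elts h).1 hs)

theorem integral_eq_sum (h : 𝒯.IsMeshOf P) {f : E d → ℝ} (hf : 𝒯.IsPiecewiseCont f) :
    ∫ x in interior P, f x =
      ∑ s ∈ elts h, ∫ x in interior (convexHull ℝ (s : Set (E d))), f x := by
  rw [setIntegral_congr_set (interior_ae_eq h), integral_biUnion_finset]
  · exact fun s _ => isOpen_interior.measurableSet
  · exact fun s hs t ht hst =>
      disjoint_interior_elements ((mem_elts h).1 hs) ((mem_elts h).1 ht) hst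
  · exact fun s hs => hf.integrableOn_element ((mem_elts h).1 hs)

end IsPiecewiseCont

theorem P1_continuousOn (h : 𝒯.IsMeshOf P) {w : E d → ℝ} (hw : w ∈ 𝒯.P1) : ContinuousOn w P := by
  have hP : P = ⋃ s : elts h, convexHull ℝ ((s : Finset (E d)) : Set (E d)) := by
    conv_lhs => rw [eq_iUnion_elements h]
    rw [iUnion_subtype]
  rw [hP]
  refine (locallyFinite_of_finite _).continuousOn_iUnion
    (fun s => (s.1.finite_toSet.isCompact_convexHull ℝ).isClosed) fun s => ?_
  obtain ⟨g, c, h1, -⟩ := exists_grad hw ((mem_elts h).1 s.2)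
  exact (by fun_prop : ContinuousOn (fun x => ⟪g, x⟫ + c) _).congr h1

end Mesh

end HJBFEM

/-! ### Hat functions of interior nodes: support, Lipschitz continuity, normalisation -/

namespace HJBFEM

/-- A continuous function that is Lipschitz on each of finitely many closed sets covering the space
is Lipschitz. -/
theorem lipschitzWith_of_finite_closed_cover {V : Type*} [NormedAddCommGroup V] [NormedSpace ℝ V]
    {ι : Type*} [Finite ι] {K : ι → Set V} (hK : ∀ j, IsClosed (K j)) (hcov : ∀ x, ∃ j, x ∈ K j)
    {f : V → ℝ} (hf : Continuous f) {C : ℝ≥0}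
    (hC : ∀ j, ∀ x ∈ K j, ∀ y ∈ K j, |f x - f y| ≤ C * ‖x - y‖) : LipschitzWith C f := by
  apply LipschitzWith.of_dist_le_mul
  intro y x
  rw [Real.dist_eq, dist_eq_norm]
  set γ : ℝ → V := fun t => x + t • (y - x) with hγ
  have hγc : Continuous γ := by fun_prop
  set L : ℝ := C * ‖y - x‖ with hL
  -- The growth of `f` along the segment `γ` is controlled by a bound on right slopes. The slack `ε`
  -- provides the strict inequality that the mean value theorem demands.
  have key : ∀ ε : ℝ, 0 < ε → |f y - f x| ≤ L + ε := by
    intro ε hε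
    have h := image_norm_le_of_liminf_right_slope_norm_lt_deriv_boundary (a := 0) (b := 1)
      (f := fun t => f (γ t) - f x) (f' := fun _ => L) (B := fun t => (L + ε) * t)
      (B' := fun _ => L + ε) (by fun_prop) ?_ (by simp [hγ]) (by fun_prop) ?_ ?_
      (right_mem_Icc.2 zero_le_one)
    · simpa [hγ] using h
    · intro t _ r hr
      -- With finitely many sets, one is visited at times arbitrarily close to the right of `t`;
      -- being closed, it also contains `γ t`.
      obtain ⟨j, hj⟩ : ∃ j, ∃ᶠ z in 𝓝[>] t, γ z ∈ K j := by
        by_contra hcon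
        push Not at hcon
        have := Filter.eventually_all.2 hcon
        obtain ⟨z, hz⟩ := this.exists
        obtain ⟨j, hj⟩ := hcov (γ z)
        exact hz j hj
      have hjt : γ t ∈ K j := by
        have : ∃ᶠ z in 𝓝 t, γ z ∈ K j := hj.filter_mono nhdsWithin_le_nhds
        have h2 : ∃ᶠ z in 𝓝 (γ t), z ∈ K j := hγc.continuousAt.tendsto.frequently this
        exact (hK j).closure_subset (mem_closure_iff_frequently.2 h2)
      refine (hj.and_eventually self_mem_nhdsWithin).mono ?_
      rintro z ⟨hz, hzt⟩
      have hzt' : 0 < z - t := sub_pos.2 hzt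
      refine lt_of_le_of_lt ?_ hr
      rw [slope_def_field, div_le_iff₀ hzt']
      have h1 := hC j _ hz _ hjt
      have h2 : γ z - γ t = (z - t) • (y - x) := by simp only [hγ, sub_smul]; abel
      rw [h2, norm_smul, Real.norm_eq_abs, abs_of_pos hzt'] at h1
      have h3 := abs_sub_abs_le_abs_sub (f (γ z) - f x) (f (γ t) - f x)
      rw [sub_sub_sub_cancel_right] at h3
      simp only [Function.comp, Real.norm_eq_abs]
      calc _ ≤ _ := h3
        _ ≤ _ := h1
        _ = _ := by rw [hL]; ring
    · intro t _
      simpa using ((hasDerivAt_id t).const_mul (L + ε)).hasDerivWithinAt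
    · intro t _ _
      linarith
  exact le_of_forall_pos_le_add key

namespace Mesh

variable {d : ℕ} {𝒯 : Mesh d} {P : Set (E d)}

/-- The vertices of an element as an affine basis. -/
noncomputable def elementBasis {s : Finset (E d)} (hs : s ∈ 𝒯.elements) : AffineBasis s ℝ (E d) :=
  ⟨(↑), 𝒯.indep hs.1, by simpa using affineSpan_element hs⟩

theorem hat_eqOn_elementBasis {s : Finset (E d)} (hs : s ∈ 𝒯.elements) {y : E d} (hy : y ∈ s) :
    EqOn (𝒯.hat y) ((elementBasis hs).coord ⟨y, hy⟩) (convexHull ℝ (s : Set (E d))) := by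
  classical
  refine hat_eqOn_coord hs hy fun z hz => ?_
  have := (elementBasis hs).coord_apply ⟨y, hy⟩ ⟨z, hz⟩
  have hb : (elementBasis hs) ⟨z, hz⟩ = z := rfl
  rw [hb] at this
  rw [this]
  simp [eq_comm]

theorem mem_convexHull_iff_elementBasis {s : Finset (E d)} (hs : s ∈ 𝒯.elements) {x : E d} :
    x ∈ convexHull ℝ (s : Set (E d)) ↔ ∀ i, 0 ≤ (elementBasis hs).coord i x := by
  have h := (elementBasis hs).convexHull_eq_nonneg_coord
  have hr : range (elementBasis hs) = (s : Set (E d)) := by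
    change range ((↑) : s → E d) = _
    simp
  rw [hr] at h
  rw [h]
  rfl

theorem vertex_mem_element (h : 𝒯.IsMeshOf P) {y : E d} (hy : y ∈ 𝒯.vertices) :
    ∃ s ∈ 𝒯.elements, y ∈ s := by
  obtain ⟨t, ht, hst⟩ := h.2.1 _ hy
  exact ⟨t, ht, by simpa using hst⟩

theorem mem_vertices_of_mem {s : Finset (E d)} (hs : s ∈ 𝒯.faces) {y : E d} (hy : y ∈ s) :
    y ∈ 𝒯.vertices :=
  𝒯.down_closed hs (Finset.singleton_subset_iff.2 hy) (Finset.singleton_nonempty y)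

theorem hat_self {y : E d} (hy : y ∈ 𝒯.vertices) : 𝒯.hat y y = 1 := by
  classical
  rw [hat_vertex hy (Finset.mem_singleton_self y), if_pos rfl]

theorem vertex_mem (h : 𝒯.IsMeshOf P) {y : E d} (hy : y ∈ 𝒯.vertices) : y ∈ P := by
  rw [← h.2.2]; exact 𝒯.vertices_subset_space hy

/-- Near a vertex, only the elements with that vertex are present. -/
theorem eventually_vertex_mem (h : 𝒯.IsMeshOf P) {y : E d} (hy : y ∈ 𝒯.vertices) :
    ∀ᶠ x in 𝓝 y, ∀ s ∈ 𝒯.elements, x ∈ convexHull ℝ (s : Set (E d)) → y ∈ s := by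
  have := (elements_finite h).eventually_all (l := 𝓝 y)
    (p := fun s x => x ∈ convexHull ℝ (s : Set (E d)) → y ∈ s)
  rw [this]
  intro s hs
  by_cases hys : y ∈ s
  · exact Eventually.of_forall fun _ _ => hys
  · have hc : IsClosed (convexHull ℝ (s : Set (E d))) :=
      (s.finite_toSet.isCompact_convexHull ℝ).isClosed
    have : y ∉ convexHull ℝ (s : Set (E d)) :=
      fun hc => hys ((𝒯.vertex_mem_convexHull_iff hy hs.1).1 hc)
    filter_upwards [hc.isOpen_compl.mem_nhds this] with x hx hx'
    exact absurd hx' hx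

/-- The open star of an interior vertex lies in the interior. -/
theorem mem_interior_of_hat_ne_zero (h : 𝒯.IsMeshOf P) {y : E d} (hy : y ∈ 𝒯.vertices)
    (hyi : y ∈ interior P) {x : E d} (hx : 𝒯.hat y x ≠ 0) : x ∈ interior P := by
  have hxP : x ∈ P := by
    by_contra hxP
    rw [← h.2.2] at hxP
    exact hx (hat_eq_zero_of_notMem hxP)
  obtain ⟨s, hs, hxs⟩ := exists_element h hxP
  have hys : y ∈ s := by
    by_contra hys
    exact hx (hat_eq_zero hs.1 hys hxs)
  -- Contraction towards `y` brings `x` into a neighbourhood of `y` that lies in `P` and meets only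
  -- elements with vertex `y`. A whole neighbourhood of the image is then covered by such elements,
  -- and the contraction is undone inside each of them.
  set φ : ℝ → E d → E d := fun l x' => y + l • (x' - y) with hφ
  have hev : ∀ᶠ p in 𝓝 y, p ∈ P ∧
      ∀ s ∈ 𝒯.elements, p ∈ convexHull ℝ (s : Set (E d)) → y ∈ s :=
    Eventually.and (mem_interior_iff_mem_nhds.1 hyi) (eventually_vertex_mem h hy)
  obtain ⟨l, hlev, hl0, hl1⟩ : ∃ l : ℝ, (∀ᶠ p in 𝓝 (φ l x), p ∈ P ∧
      ∀ s ∈ 𝒯.elements, p ∈ convexHull ℝ (s : Set (E d)) → y ∈ s) ∧ 0 < l ∧ l < 1 := by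
    have hc : Tendsto (fun l => φ l x) (𝓝[>] 0) (𝓝 y) := by
      have : Continuous fun l => φ l x := by fun_prop
      simpa [hφ] using (this.tendsto 0).mono_left nhdsWithin_le_nhds
    exact ((hc.eventually hev.eventually_nhds).and (Ioo_mem_nhdsGT zero_lt_one)).exists
  have hps : φ l x ∈ convexHull ℝ (s : Set (E d)) := by
    have := (convex_convexHull ℝ (s : Set (E d))) (subset_convexHull ℝ _ hys) hxs
      (sub_nonneg.2 hl1.le) hl0.le (by ring)
    convert this using 1
    simp only [hφ]; module
  have hcoord : ∀ (t : Finset (E d)) (ht : t ∈ 𝒯.elements) (i : t) (x' : E d),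
      (elementBasis ht).coord i (φ l x') = (1 - l) * (elementBasis ht).coord i y +
        l * (elementBasis ht).coord i x' := by
    intro t ht i x'
    have : φ l x' = AffineMap.lineMap y x' l := by
      simp [hφ, AffineMap.lineMap_apply, add_comm]
    rw [this, AffineMap.apply_lineMap, AffineMap.lineMap_apply]
    simp; ring
  have hpx : 1 - l < 𝒯.hat y (φ l x) := by
    rw [hat_eqOn_elementBasis hs hys hps, hcoord s hs,
      ← hat_eqOn_elementBasis hs hys (subset_convexHull ℝ _ hys), ← hat_eqOn_elementBasis hs hys hxs,
      hat_self hy]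
    have := lt_of_le_of_ne (hat_nonneg (𝒯 := 𝒯) y x) hx.symm
    nlinarith
  have hcont : ∀ᶠ p in 𝓝 (φ l x), p ∈ P → 1 - l < 𝒯.hat y p := by
    have := (P1_continuousOn h (hat_mem_P1 y)) (φ l x) (hlev.self_of_nhds).1
    have := this.eventually (lt_mem_nhds hpx)
    rwa [eventually_nhdsWithin_iff] at this
  have hφc : Tendsto (fun x' => φ l x') (𝓝 x) (𝓝 (φ l x)) := by
    have : Continuous (fun x' => φ l x') := by fun_prop
    exact this.tendsto x
  rw [mem_interior_iff_mem_nhds]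
  filter_upwards [hφc.eventually (hlev.and hcont)] with x' hx'
  obtain ⟨⟨hpP, hpt⟩, hph⟩ := hx'
  obtain ⟨t, ht, hpt'⟩ := exists_element h hpP
  -- Undoing the contraction divides the barycentric coordinates other than that of `y` by `l`, so
  -- they stay nonnegative. The coordinate of `y` stays positive because the hat function exceeds `1
  -- - l` at the contracted point.
  have hyt := hpt t ht hpt'
  refine element_subset h ht ((mem_convexHull_iff_elementBasis ht).2 fun i => ?_)
  by_cases hi : i = ⟨y, hyt⟩
  · subst hi
    have h1 := hph hpP
    rw [hat_eqOn_elementBasis ht hyt hpt', hcoord t ht,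
      ← hat_eqOn_elementBasis ht hyt (subset_convexHull ℝ _ hyt), hat_self hy] at h1
    have : 0 < l * ((elementBasis ht).coord ⟨y, hyt⟩) x' := by linarith
    exact (pos_of_mul_pos_right this hl0.le).le
  · have h1 := (mem_convexHull_iff_elementBasis ht).1 hpt' i
    have h2 : (elementBasis ht).coord i y = 0 := by
      have := (elementBasis ht).coord_apply_ne (i := i) (j := ⟨y, hyt⟩) hi
      exact this
    rw [hcoord t ht, h2, mul_zero, zero_add] at h1
    exact nonneg_of_mul_nonneg_right h1 hl0

/-- The hat function of an interior vertex vanishes on the boundary, so its extension by zero does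
not jump there. -/
theorem hat_continuous (h : 𝒯.IsMeshOf P) {y : E d} (hy : y ∈ 𝒯.vertices)
    (hyi : y ∈ interior P) : Continuous (𝒯.hat y) := by
  have hcl : IsClosed P := (isCompact_of_isMeshOf h).isClosed
  have hoff : ∀ x, x ∉ P → 𝒯.hat y x = 0 := fun x hx =>
    hat_eq_zero_of_notMem (by rwa [h.2.2])
  rw [continuous_iff_continuousAt]
  intro x
  by_cases hxP : x ∈ P
  · have h1 := (P1_continuousOn h (hat_mem_P1 y)) x hxP
    by_cases hxi : x ∈ interior P
    · exact h1.continuousAt (mem_interior_iff_mem_nhds.1 hxi)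
    · have h0 : 𝒯.hat y x = 0 := by
        by_contra hne
        exact hxi (mem_interior_of_hat_ne_zero h hy hyi hne)
      have h2 : ContinuousWithinAt (𝒯.hat y) Pᶜ x :=
        continuousWithinAt_const.congr (fun z hz => hoff z hz) h0
      have := h1.union h2
      rwa [union_compl_self, continuousWithinAt_univ] at this
  · refine (continuousAt_const (y := (0 : ℝ))).congr ?_
    filter_upwards [hcl.isOpen_compl.mem_nhds hxP] with z hz using (hoff z hz).symm

/-- The closed cover consists of the elements, where the function is affine, and the complement of
the interior, where it vanishes. Global Lipschitz continuity is what makes integration by parts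
without boundary terms possible. -/
theorem hat_lipschitz (h : 𝒯.IsMeshOf P) {y : E d} (hy : y ∈ 𝒯.vertices)
    (hyi : y ∈ interior P) : ∃ C, LipschitzWith C (𝒯.hat y) := by
  have hg : ∀ s : elts h, ∃ g : E d, ∃ c, ∀ x ∈ convexHull ℝ ((s : Finset (E d)) : Set (E d)),
      𝒯.hat y x = ⟪g, x⟫ + c := fun s => by
    obtain ⟨g, c, hgc, -⟩ := exists_grad (hat_mem_P1 (𝒯 := 𝒯) y) ((mem_elts h).1 s.2)
    exact ⟨g, c, hgc⟩
  choose g c hgc using hg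
  refine ⟨∑ s, ‖g s‖₊, lipschitzWith_of_finite_closed_cover (ι := Option (elts h))
    (K := fun o => o.elim (interior P)ᶜ fun s => convexHull ℝ ((s : Finset (E d)) : Set (E d)))
    ?_ ?_ (hat_continuous h hy hyi) ?_⟩
  · rintro (_ | s)
    · exact isOpen_interior.isClosed_compl
    · exact (s.1.finite_toSet.isCompact_convexHull ℝ).isClosed
  · intro x
    by_cases hx : x ∈ interior P
    · obtain ⟨s, hs, hxs⟩ := exists_element h (interior_subset hx)
      exact ⟨some ⟨s, (mem_elts h).2 hs⟩, hxs⟩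
    · exact ⟨none, hx⟩
  · rintro (_ | s) x hx z hz
    · have : ∀ x, x ∉ interior P → 𝒯.hat y x = 0 := fun x hx => by
        by_contra hne
        exact hx (mem_interior_of_hat_ne_zero h hy hyi hne)
      rw [this x hx, this z hz]
      simp only [sub_self, abs_zero]
      positivity
    · simp only [Option.elim] at hx hz
      rw [hgc s x hx, hgc s z hz, add_sub_add_right_eq_sub, ← inner_sub_right]
      refine (abs_real_inner_le_norm _ _).trans ?_
      gcongr
      rw [← coe_nnnorm]
      exact_mod_cast Finset.single_le_sum (f := fun s => ‖g s‖₊) (fun _ _ => zero_le)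
        (Finset.mem_univ s)

theorem hat_hasCompactSupport (h : 𝒯.IsMeshOf P) (y : E d) : HasCompactSupport (𝒯.hat y) := by
  refine HasCompactSupport.intro (isCompact_of_isMeshOf h) fun x hx => hat_eq_zero_of_notMem ?_
  rwa [h.2.2]

theorem volume_diff_interior (h : 𝒯.IsMeshOf P) : volume (P \ interior P) = 0 := by
  refine measure_mono_null (t := ⋃ s ∈ elts h, frontier (convexHull ℝ (s : Set (E d)))) ?_ ?_
  · rintro x ⟨hx, hx'⟩
    obtain ⟨s, hs, hxs⟩ := exists_element h hx
    exact mem_biUnion ((mem_elts h).2 hs) ⟨subset_closure hxs, fun hi => hx'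
      (interior_element_subset h hs hi)⟩
  · refine (measure_biUnion_null_iff (elts h).countable_toSet).2 fun s _ => ?_
    exact (convex_convexHull ℝ _).addHaar_frontier volume

theorem ae_eq_interior (h : 𝒯.IsMeshOf P) : (P : Set (E d)) =ᵐ[volume] interior P :=
  (ae_le_set.2 (volume_diff_interior h)).antisymm (LE.le.eventuallyLE interior_subset)

/-- The hat function equals one at its node and is affine on an adjacent element, hence positive on
a nonempty open part of it. The normalisation in `hat1` is thus not a division by zero. -/
theorem integral_hat_pos (h : 𝒯.IsMeshOf P) {y : E d} (hy : y ∈ 𝒯.vertices) :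
    0 < ∫ x in interior P, 𝒯.hat y x := by
  rw [setIntegral_pos_iff_support_of_nonneg_ae (ae_of_all _ fun x => hat_nonneg y x)
    ((IsPiecewiseCont.of_P1 (hat_mem_P1 y)).integrableOn h)]
  obtain ⟨s, hs, hys⟩ := vertex_mem_element h hy
  obtain ⟨g, c, hgc, -⟩ := exists_grad (hat_mem_P1 (𝒯 := 𝒯) y) hs
  have hopen : IsOpen ({x | 0 < ⟪g, x⟫ + c} ∩ interior (convexHull ℝ (s : Set (E d)))) :=
    (isOpen_lt continuous_const (by fun_prop)).inter isOpen_interior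
  have hne : ({x | 0 < ⟪g, x⟫ + c} ∩ interior (convexHull ℝ (s : Set (E d)))).Nonempty := by
    have hyc : y ∈ closure (interior (convexHull ℝ (s : Set (E d)))) := by
      rw [closure_interior_element hs]; exact subset_convexHull ℝ _ hys
    refine mem_closure_iff.1 hyc _ (isOpen_lt continuous_const (by fun_prop)) ?_
    rw [mem_ofPred_eq, ← hgc y (subset_convexHull ℝ _ hys), hat_self hy]
    exact zero_lt_one
  refine (hopen.measure_pos volume hne).trans_le (measure_mono ?_)
  rintro x ⟨hx, hxs⟩
  refine ⟨?_, interior_element_subset h hs hxs⟩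
  rw [Function.mem_support, hgc x (interior_subset hxs)]
  exact ne_of_gt hx

theorem hat1_eq (h : 𝒯.IsMeshOf P) (y : E d) :
    𝒯.hat1 y = (∫ x in interior P, 𝒯.hat y x)⁻¹ • 𝒯.hat y := by
  funext x
  have : ∫ z in 𝒯.space, |𝒯.hat y z| = ∫ x in interior P, 𝒯.hat y x := by
    rw [h.2.2, setIntegral_congr_set (ae_eq_interior h)]
    exact integral_congr_ae (ae_of_all _ fun x => abs_of_nonneg (hat_nonneg y x))
  rw [Mesh.hat1, this, Pi.smul_apply, smul_eq_mul, div_eq_inv_mul]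

theorem hat1_mem_P1 (h : 𝒯.IsMeshOf P) (y : E d) : 𝒯.hat1 y ∈ 𝒯.P1 := by
  rw [hat1_eq h]
  exact 𝒯.P1.smul_mem _ (hat_mem_P1 y)

theorem hat1_nonneg (y x : E d) : 0 ≤ 𝒯.hat1 y x :=
  div_nonneg (hat_nonneg y x) (integral_nonneg fun _ => abs_nonneg _)

theorem integral_hat1 (h : 𝒯.IsMeshOf P) {y : E d} (hy : y ∈ 𝒯.vertices) :
    ∫ x in interior P, 𝒯.hat1 y x = 1 := by
  rw [hat1_eq h]
  simp only [Pi.smul_apply]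
  rw [integral_smul, smul_eq_mul, inv_mul_cancel₀ (integral_hat_pos h hy).ne']

end Mesh

/-! ### Quadratic functions and integration by parts -/

/-- Quadratic functions on `ℝᵈ`. -/
structure Quad (d : ℕ) where
  /-- value at the base point -/
  c : ℝ
  /-- gradient at the base point -/
  p : E d
  /-- base point -/
  x₀ : E d
  /-- Hessian -/
  S : E d →L[ℝ] E d
  symm : ∀ u v, ⟪S u, v⟫ = ⟪u, S v⟫

namespace Quad

variable {d : ℕ} (e : Quad d)

/-- The function described by a `Quad`. -/
noncomputable def fn (x : E d) : ℝ := e.c + ⟪e.p, x - e.x₀⟫ + 1 / 2 * ⟪e.S (x - e.x₀), x - e.x₀⟫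

/-- Its gradient. -/
def grad (x : E d) : E d := e.p + e.S (x - e.x₀)

/-- Its Laplacian. -/
noncomputable def lap : ℝ := ∑ i, ⟪e.S (EuclideanSpace.single i 1), EuclideanSpace.single i (1 : ℝ)⟫

/-- The negative of a quadratic function. -/
def neg : Quad d := ⟨-e.c, -e.p, e.x₀, -e.S, fun u v => by simp [e.symm]⟩

@[simp] theorem neg_fn (x : E d) : e.neg.fn x = -e.fn x := by
  simp only [fn, neg, neg_apply, inner_neg_left]; ring

@[simp] theorem neg_grad (x : E d) : e.neg.grad x = -e.grad x := by simp [grad, neg]; abel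

@[simp] theorem neg_lap : e.neg.lap = -e.lap := by simp [lap, neg]

theorem contDiff {n : WithTop ℕ∞} : ContDiff ℝ n e.fn := by
  have h : ContDiff ℝ n fun x => x - e.x₀ := contDiff_id.sub contDiff_const
  exact (contDiff_const.add (contDiff_const.inner ℝ h)).add
    (contDiff_const.mul ((e.S.contDiff.comp h).inner ℝ h))

theorem continuous_fn : Continuous e.fn := (e.contDiff (n := 0)).continuous

theorem continuous_grad : Continuous e.grad := by unfold grad; fun_prop

theorem hasGradientAt (x : E d) : HasGradientAt e.fn (e.grad x) x := by
  rw [hasGradientAt_iff_hasFDerivAt]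
  have h1 : HasFDerivAt (fun x => x - e.x₀) (ContinuousLinearMap.id ℝ (E d)) x :=
    (hasFDerivAt_id x).sub_const _
  have h2 : HasFDerivAt (fun x => e.S (x - e.x₀)) e.S x := by
    have := (e.S.hasFDerivAt (x := x - e.x₀)).comp x h1
    rwa [ContinuousLinearMap.comp_id] at this
  have h3 := (((hasFDerivAt_const e.p x).inner ℝ h1).const_add e.c).add
    ((h2.inner ℝ h1).const_mul (1 / 2))
  refine h3.congr_fderiv ?_
  ext v
  simp [grad, inner_sub_left, inner_sub_right, e.symm v, real_inner_comm]
  ring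

/-- The function as an element of the space of smooth functions. -/
noncomputable def smooth : smoothFunctions d := ⟨e.fn, show ContDiff ℝ (⊤ : ℕ∞) e.fn from e.contDiff⟩

theorem neg_smooth : e.neg.smooth = -e.smooth := by
  ext x; exact e.neg_fn x

/-- The components of `e.grad` are affine, hence Lipschitz, and can be integrated by parts against
the compactly supported `φ` one coordinate at a time. Rademacher's theorem identifies the gradient
of `φ` with its partial derivatives almost everywhere. -/
theorem integral_inner_gradient {φ : E d → ℝ} {C : ℝ≥0} (hφ : LipschitzWith C φ)
    (hc : HasCompactSupport φ) : ∫ x, ⟪e.grad x, gradient φ x⟫ = -(e.lap * ∫ x, φ x) := by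
  have h1 : ∀ i : Fin d, ∫ x, lineDeriv ℝ φ x (EuclideanSpace.single i 1) * e.grad x i =
      -(⟪e.S (EuclideanSpace.single i 1), EuclideanSpace.single i (1 : ℝ)⟫ * ∫ x, φ x) := by
    intro i
    set f : E d → ℝ := fun x => ⟪e.grad x, EuclideanSpace.single i (1 : ℝ)⟫ with hf
    have hfi : ∀ x, e.grad x i = f x := fun x => by
      simp [hf, EuclideanSpace.inner_single_right]
    have hfd : ∀ x v, lineDeriv ℝ f x v = ⟪e.S v, EuclideanSpace.single i (1 : ℝ)⟫ := by
      intro x v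
      have h1 : HasFDerivAt (fun x => x - e.x₀) (ContinuousLinearMap.id ℝ (E d)) x :=
        (hasFDerivAt_id x).sub_const _
      have h2 : HasFDerivAt (fun x => e.p + e.S (x - e.x₀)) e.S x := by
        simpa using ((e.S.hasFDerivAt (x := x - e.x₀)).comp x h1).const_add e.p
      have h3 := h2.inner ℝ (hasFDerivAt_const (EuclideanSpace.single i (1 : ℝ)) x)
      change lineDeriv ℝ (fun t => ⟪e.p + e.S (t - e.x₀), EuclideanSpace.single i (1 : ℝ)⟫) x v = _
      rw [h3.differentiableAt.lineDeriv_eq_fderiv, h3.fderiv]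
      simp
    have hfl : LipschitzWith ‖e.S‖₊ f := by
      apply LipschitzWith.of_dist_le_mul
      intro x y
      rw [Real.dist_eq, dist_eq_norm, hf]
      simp only
      rw [← inner_sub_left]
      refine (abs_real_inner_le_norm _ _).trans ?_
      have : e.grad x - e.grad y = e.S (x - y) := by
        simp only [grad, map_sub]; abel
      rw [this]
      simpa using e.S.le_opNorm (x - y)
    -- The integration by parts formula reverses the direction for the second factor; starting with
    -- `-eᵢ` leaves `eᵢ` on `φ`.
    have := hfl.integral_lineDeriv_mul_eq (μ := volume) hφ hc (-EuclideanSpace.single i (1 : ℝ))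
    simp only [hfd, neg_neg] at this
    simp only [hfi]
    rw [← this, integral_const_mul]
    simp
  have h2 : ∀ᵐ x, ⟪e.grad x, gradient φ x⟫ =
      ∑ i, lineDeriv ℝ φ x (EuclideanSpace.single i 1) * e.grad x i := by
    filter_upwards [hφ.ae_differentiableAt] with x hx
    rw [real_inner_comm, inner_gradient_left]
    conv_lhs => rw [← (EuclideanSpace.basisFun (Fin d) ℝ).sum_repr (e.grad x)]
    rw [map_sum]
    refine Finset.sum_congr rfl fun i _ => ?_
    rw [map_smul, hx.lineDeriv_eq_fderiv]
    simp [mul_comm]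
  rw [integral_congr_ae h2, integral_finsetSum]
  · simp only [h1]
    rw [Finset.sum_neg_distrib, ← Finset.sum_mul, lap]
  · intro i _
    have hcs : HasCompactSupport fun x => lineDeriv ℝ φ x (EuclideanSpace.single i 1) := by
      refine HasCompactSupport.intro hc fun x hx => ?_
      have : φ =ᶠ[𝓝 x] fun _ => 0 := notMem_tsupport_iff_eventuallyEq.1 hx
      rw [this.lineDeriv_eq]
      simp [lineDeriv]
    have hb : Integrable (fun x => lineDeriv ℝ φ x (EuclideanSpace.single i 1)) := by
      have h := (hφ.locallyIntegrable_lineDeriv (μ := volume) (EuclideanSpace.single i 1))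
      rw [← integrableOn_iff_integrable_of_support_subset (subset_tsupport _)]
      exact h.integrableOn_isCompact hcs
    have hci : Continuous fun x => e.grad x i := by
      have := e.continuous_grad
      fun_prop
    have h := (hφ.locallyIntegrable_lineDeriv (μ := volume) (EuclideanSpace.single i 1))
    rw [← integrableOn_iff_integrable_of_support_subset
      ((Function.support_mul_subset_left _ _).trans (subset_tsupport _))]
    exact (h.integrableOn_isCompact hcs).mul_continuousOn hci.continuousOn hcs

end Quad

/-- The Laplacian of a quadratic is constant and `hat1` has mass one, so there is no discretisation
error at all. This is why quadratics serve as test functions. -/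
theorem Mesh.integral_quad_grad_hat1 {d : ℕ} {𝒯 : Mesh d} {P : Set (E d)} (h : 𝒯.IsMeshOf P)
    {y : E d} (hy : y ∈ 𝒯.vertices) (hyi : y ∈ interior P) (e : Quad d) :
    ∫ x in interior P, ⟪gradient e.fn x, gradient (𝒯.hat1 y) x⟫ = -e.lap := by
  obtain ⟨C, hC⟩ := hat_lipschitz h hy hyi
  have hL : LipschitzWith (‖(∫ x in interior P, 𝒯.hat y x)⁻¹‖₊ * C) (𝒯.hat1 y) := by
    rw [hat1_eq h]; exact (lipschitzWith_smul _).comp hC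
  have hcs : HasCompactSupport (𝒯.hat1 y) := by
    rw [hat1_eq h]; exact (hat_hasCompactSupport h y).smul_left (f := fun _ => _)
  have hcl : IsClosed P := (isCompact_of_isMeshOf h).isClosed
  have hoff : ∀ x, x ∉ P → 𝒯.hat1 y x = 0 := fun x hx => by
    rw [Mesh.hat1, hat_eq_zero_of_notMem (by rwa [h.2.2]), zero_div]
  have h1 := e.integral_inner_gradient hL hcs
  simp only [(e.hasGradientAt _).gradient]
  rw [← setIntegral_congr_set (ae_eq_interior h)]
  have h2 : ∫ x, 𝒯.hat1 y x = 1 := by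
    rw [← integral_hat1 h hy, ← setIntegral_congr_set (ae_eq_interior h)]
    exact (setIntegral_eq_integral_of_forall_compl_eq_zero hoff).symm
  rw [setIntegral_eq_integral_of_forall_compl_eq_zero, h1, h2, mul_one]
  intro x hx
  have : 𝒯.hat1 y =ᶠ[𝓝 x] fun _ => 0 := by
    filter_upwards [hcl.isOpen_compl.mem_nhds hx] with z hz using hoff z hz
  rw [this.gradient_eq, gradient_fun_const, inner_zero_right]

end HJBFEM

/-! ### Monotonicity and linearity of the discrete operators -/

namespace HJBFEM

theorem norm_le_vecNormOn {d : ℕ} {K K' : Set (E d)} (hK : IsCompact K) (hK' : K' ⊆ K)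
    {b : E d → E d} (hb : ContinuousOn b K) {x : E d} (hx : x ∈ K') : ‖b x‖ ≤ vecNormOn K' b := by
  rw [EuclideanSpace.norm_eq, vecNormOn]
  refine Real.sqrt_le_sqrt (Finset.sum_le_sum fun j _ => ?_)
  rw [Real.norm_eq_abs]
  have h1 : ContinuousOn (fun x => |b x j|) K := by fun_prop
  have h2 : |b x j| ≤ sSup ((fun x => |b x j|) '' K') := le_csSup
    ((hK.bddAbove_image h1).mono (image_mono hK')) (mem_image_of_mem (fun x => |b x j|) hx)
  exact pow_le_pow_left₀ (abs_nonneg (b x j)) h2 2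

theorem vecNormOn_const {d : ℕ} {K : Set (E d)} (hK : K.Nonempty) {b : E d → E d} {g : E d}
    (hb : ∀ x ∈ K, b x = g) : vecNormOn K b = ‖g‖ := by
  rw [EuclideanSpace.norm_eq, vecNormOn]
  congr 1
  refine Finset.sum_congr rfl fun j _ => ?_
  have : (fun x => |b x j|) '' K = {|g j|} := by
    rw [← hK.image_const]
    exact image_congr fun x hx => by rw [hb x hx]
  rw [this, csSup_singleton, Real.norm_eq_abs]

theorem vecNormOn_nonneg {d : ℕ} (K : Set (E d)) (b : E d → E d) : 0 ≤ vecNormOn K b :=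
  Real.sqrt_nonneg _

namespace Mesh

variable {d : ℕ} {𝒯 : Mesh d} {P : Set (E d)}

theorem P1_eq_sum_hat {u : E d → ℝ} (hu : u ∈ 𝒯.P1) {s : Finset (E d)} (hs : s ∈ 𝒯.elements)
    {x : E d} (hx : x ∈ convexHull ℝ (s : Set (E d))) : u x = ∑ z ∈ s, u z * 𝒯.hat z x := by
  obtain ⟨μ, h0, h1, rfl⟩ := mem_convexHull.1 hx
  rw [P1_combination hu hs h0 h1]
  exact Finset.sum_congr rfl fun z hz => by rw [hat_eq hs.1 hz h0 h1, mul_comm]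

theorem P1_gradient_eq_sum {u : E d → ℝ} (hu : u ∈ 𝒯.P1) {s : Finset (E d)} (hs : s ∈ 𝒯.elements)
    {x : E d} (hx : x ∈ interior (convexHull ℝ (s : Set (E d)))) :
    gradient u x = ∑ z ∈ s, u z • gradient (𝒯.hat z) x := by
  have h1 : HasFDerivAt (fun x => ∑ z ∈ s, u z * 𝒯.hat z x)
      (∑ z ∈ s, u z • (InnerProductSpace.toDual ℝ (E d)) (gradient (𝒯.hat z) x)) x := by
    refine HasFDerivAt.fun_sum fun z _ => ?_
    obtain ⟨g, c, -, hg⟩ := exists_grad (hat_mem_P1 (𝒯 := 𝒯) z) hs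
    rw [(hg x hx).gradient]
    exact (hasGradientAt_iff_hasFDerivAt.1 (hg x hx)).const_mul _
  have h2 : HasGradientAt u (∑ z ∈ s, u z • gradient (𝒯.hat z) x) x := by
    rw [hasGradientAt_iff_hasFDerivAt, map_sum]
    simp only [map_smul]
    refine h1.congr_of_eventuallyEq ?_
    filter_upwards [isOpen_interior.mem_nhds hx] with z hz
    exact P1_eq_sum_hat hu hs (interior_subset hz)
  exact h2.gradient

theorem P1_nonpos {u : E d → ℝ} (hu : u ∈ 𝒯.P1) {s : Finset (E d)} (hs : s ∈ 𝒯.elements)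
    (h0 : ∀ z ∈ s, u z ≤ 0) {x : E d} (hx : x ∈ convexHull ℝ (s : Set (E d))) : u x ≤ 0 := by
  rw [P1_eq_sum_hat hu hs hx]
  exact Finset.sum_nonpos fun z hz => mul_nonpos_of_nonpos_of_nonneg (h0 z hz) (hat_nonneg _ _)

/-- The hat function rises from `0` at `y` to `1` at `z`, over a distance of at most the diameter.
Zeroth order terms can so be measured against gradients, which explains the factor `diam K` in the
artificial diffusion condition. -/
theorem one_le_norm_gradient_hat_mul_diam {s : Finset (E d)} (hs : s ∈ 𝒯.elements) {y z : E d}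
    (hy : y ∈ s) (hz : z ∈ s) (hyz : y ≠ z) {x : E d}
    (hx : x ∈ interior (convexHull ℝ (s : Set (E d)))) :
    1 ≤ ‖gradient (𝒯.hat z) x‖ * Metric.diam (convexHull ℝ (s : Set (E d))) := by
  classical
  obtain ⟨g, c, hgc, hg⟩ := exists_grad (hat_mem_P1 (𝒯 := 𝒯) z) hs
  have hzs := subset_convexHull ℝ (s : Set (E d)) hz
  have hys := subset_convexHull ℝ (s : Set (E d)) hy
  have h1 : ⟪g, z - y⟫ = 1 := by
    have h1 := hgc z hzs
    have h2 := hgc y hys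
    rw [hat_vertex hs.1 hz, if_pos rfl] at h1
    rw [hat_vertex hs.1 hy, if_neg hyz] at h2
    rw [inner_sub_right]; linarith
  rw [(hg x hx).gradient, ← h1]
  refine (real_inner_le_norm _ _).trans ?_
  gcongr
  rw [← dist_eq_norm]
  exact Metric.dist_le_diam_of_mem (s.finite_toSet.isCompact_convexHull ℝ).isBounded hzs hys

theorem gradient_hat1 (h : 𝒯.IsMeshOf P) {s : Finset (E d)} (hs : s ∈ 𝒯.elements) (y : E d)
    {x : E d} (hx : x ∈ interior (convexHull ℝ (s : Set (E d)))) : gradient (𝒯.hat1 y) x =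
      (∫ x in interior P, 𝒯.hat y x)⁻¹ • gradient (𝒯.hat y) x := by
  obtain ⟨g, c, -, hg⟩ := exists_grad (hat_mem_P1 (𝒯 := 𝒯) y) hs
  rw [hat1_eq h, (hg x hx).gradient]
  have := (hasGradientAt_iff_hasFDerivAt.1 (hg x hx)).const_smul (∫ x in interior P, 𝒯.hat y x)⁻¹
  rw [← map_smul] at this
  exact (hasGradientAt_iff_hasFDerivAt.2 this).gradient

theorem hat1_eqOn_zero {s : Finset (E d)} (hs : s ∈ 𝒯.elements) {y : E d} (hy : y ∉ s) {x : E d}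
    (hx : x ∈ convexHull ℝ (s : Set (E d))) : 𝒯.hat1 y x = 0 := by
  rw [Mesh.hat1, hat_eq_zero hs.1 hy hx, zero_div]

theorem gradient_hat1_eq_zero {s : Finset (E d)} (hs : s ∈ 𝒯.elements) {y : E d} (hy : y ∉ s)
    {x : E d} (hx : x ∈ interior (convexHull ℝ (s : Set (E d)))) : gradient (𝒯.hat1 y) x = 0 := by
  have : 𝒯.hat1 y =ᶠ[𝓝 x] fun _ => 0 := by
    filter_upwards [isOpen_interior.mem_nhds hx] with z hz
      using hat1_eqOn_zero hs hy (interior_subset hz)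
  rw [this.gradient_eq, gradient_fun_const]

theorem setIntegral_hat1_le_one (h : 𝒯.IsMeshOf P) {s : Finset (E d)} (hs : s ∈ 𝒯.elements)
    {y : E d} (hy : y ∈ 𝒯.vertices) :
    ∫ x in interior (convexHull ℝ (s : Set (E d))), 𝒯.hat1 y x ≤ 1 := by
  rw [← integral_hat1 h hy]
  exact setIntegral_mono_set ((IsPiecewiseCont.of_P1 (hat1_mem_P1 h y)).integrableOn h)
    (ae_of_all _ fun x => hat1_nonneg y x) (LE.le.eventuallyLE (interior_element_subset h hs))

/-- An initial part of a segment that points into the domain lies in a single element, so that Dini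
derivatives of piecewise affine functions are difference quotients. -/
theorem exists_lowerDini_eq (h : 𝒯.IsMeshOf P) {x b : E d} (hb : b ∈ tangentCone P x) :
    ∃ s ∈ 𝒯.elements, ∃ r : ℝ, 0 < r ∧ x ∈ convexHull ℝ (s : Set (E d)) ∧
      x + r • b ∈ convexHull ℝ (s : Set (E d)) ∧
      ∀ w ∈ 𝒯.P1, lowerDini w x b = (w x - w (x + r • b)) / r := by
  obtain ⟨Λ, hΛ, hl⟩ := hb
  -- The finitely many elements cover the initial part of the ray, so one of them contains points of
  -- it with arbitrarily small parameter. By closedness and convexity it then contains an initial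
  -- segment.
  obtain ⟨s, hs, hfr⟩ : ∃ s ∈ 𝒯.elements,
      ∃ᶠ l : ℝ in 𝓝[>] 0, x + l • b ∈ convexHull ℝ (s : Set (E d)) := by
    by_contra hcon
    push Not at hcon
    have h1 := ((elements_finite h).eventually_all (l := 𝓝[>] (0 : ℝ))).2 hcon
    obtain ⟨l, hl1, hl2⟩ := (h1.and (Ioc_mem_nhdsGT hΛ)).exists
    obtain ⟨s, hs, hxs⟩ := exists_element h (hl l (Ioc_subset_Icc_self hl2))
    exact hl1 s hs hxs
  have hcl : IsClosed (convexHull ℝ (s : Set (E d))) :=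
    (s.finite_toSet.isCompact_convexHull ℝ).isClosed
  have hxs : x ∈ convexHull ℝ (s : Set (E d)) := by
    have hc : Tendsto (fun l : ℝ => x + l • b) (𝓝 0) (𝓝 x) := by
      have : Continuous fun l : ℝ => x + l • b := by fun_prop
      simpa using this.tendsto 0
    exact hcl.closure_subset (mem_closure_iff_frequently.2
      (hc.frequently (hfr.filter_mono nhdsWithin_le_nhds)))
  obtain ⟨r, hrs, hr⟩ := (hfr.and_eventually self_mem_nhdsWithin).exists
  have hr0 : (0 : ℝ) < r := hr
  refine ⟨s, hs, r, hr0, hxs, hrs, fun w hw => ?_⟩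
  obtain ⟨g, c, hgc, -⟩ := exists_grad hw hs
  have hseg : ∀ l ∈ Ioc 0 r, x + l • b ∈ convexHull ℝ (s : Set (E d)) := by
    intro l hl
    have := (convex_convexHull ℝ (s : Set (E d))).add_smul_mem hxs hrs
      (t := l / r) ⟨by have := hl.1; positivity, (div_le_one hr0).2 hl.2⟩
    rwa [smul_smul, div_mul_cancel₀ _ hr0.ne'] at this
  have hq : ∀ l ∈ Ioc 0 r, (w x - w (x + l • b)) / l = -⟪g, b⟫ := by
    intro l hl'
    rw [hgc x hxs, hgc _ (hseg l hl'), inner_add_right, real_inner_smul_right]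
    have : l ≠ 0 := hl'.1.ne'
    field_simp
    ring
  rw [lowerDini, hq r ⟨hr0, le_rfl⟩]
  rw [Filter.liminf_congr (v := fun _ => -⟪g, b⟫), liminf_const]
  filter_upwards [Ioc_mem_nhdsGT hr0] with l hl' using hq l hl'

theorem indicator_one_mem_P1 (h : 𝒯.IsMeshOf P) : P.indicator (fun _ => (1 : ℝ)) ∈ 𝒯.P1 := by
  refine ⟨fun s hs => ⟨AffineMap.const ℝ _ 1, fun x hx => ?_⟩, fun x hx => ?_⟩
  · simp [element_subset h hs hx]
  · rw [h.2.2] at hx; simp [hx]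

end Mesh

variable {d : ℕ} {A : Type*} [TopologicalSpace A] {𝔭 : Problem d A}

namespace Problem

theorem notMem_interior_of_frontier {x : E d} (hx : x ∈ frontier 𝔭.P) : x ∉ 𝔭.Ω := hx.2

theorem bdt_subset : 𝔭.bdt ⊆ frontier 𝔭.P := by
  rw [← 𝔭.union_bd]; exact subset_union_right

theorem bdR_subset : 𝔭.bdR ⊆ frontier 𝔭.P := by
  rw [← 𝔭.union_bd]; exact subset_union_right.trans subset_union_left

theorem bdD_subset : 𝔭.bdD ⊆ frontier 𝔭.P := by
  rw [← 𝔭.union_bd]; exact subset_union_left.trans subset_union_left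

end Problem

namespace Discretisation

variable (𝔰 : Discretisation 𝔭) {i : ℕ}

/-- The integrand of the lower order terms. -/
theorem isPiecewiseCont_lower {b : E d → E d} {c : E d → ℝ} (hb : ContinuousOn b 𝔭.P)
    (hc : ContinuousOn c 𝔭.P) {w : E d → ℝ} (hw : w ∈ (𝔰.mesh i).P1) (y : E d) :
    (𝔰.mesh i).IsPiecewiseCont
      (fun x => (-⟪b x, gradient w x⟫ + c x * w x) * (𝔰.mesh i).hat1 y x) := by
  have h := 𝔰.isMesh i
  exact ((((Mesh.IsPiecewiseCont.of_continuousOn h hb).innerProd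
    (Mesh.IsPiecewiseCont.grad_P1 hw)).neg).add
      ((Mesh.IsPiecewiseCont.of_continuousOn h hc).mul (Mesh.IsPiecewiseCont.of_P1 hw))).mul
    (Mesh.IsPiecewiseCont.of_P1 (Mesh.hat1_mem_P1 h y))

theorem isPiecewiseCont_grad {w : E d → ℝ} (hw : w ∈ (𝔰.mesh i).P1) (y : E d) :
    (𝔰.mesh i).IsPiecewiseCont
      (fun x => ⟪gradient w x, gradient ((𝔰.mesh i).hat1 y) x⟫) :=
  (Mesh.IsPiecewiseCont.grad_P1 hw).innerProd
    (Mesh.IsPiecewiseCont.grad_P1 (Mesh.hat1_mem_P1 (𝔰.isMesh i) y))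

/-- The gradient of piecewise affine functions is additive almost everywhere. -/
theorem ae_gradient_add_smul {u w : E d → ℝ} (hu : u ∈ (𝔰.mesh i).P1) (hw : w ∈ (𝔰.mesh i).P1)
    (r : ℝ) : ∀ᵐ x ∂(volume.restrict 𝔭.Ω), gradient (u + r • w) x =
      gradient u x + r • gradient w x := by
  have h := 𝔰.isMesh i
  change ∀ᵐ x ∂(volume.restrict (interior 𝔭.P)), _
  rw [Measure.restrict_congr_set (Mesh.interior_ae_eq h),
    ae_restrict_iff' ((Mesh.elts h).measurableSet_biUnion
      fun s _ => isOpen_interior.measurableSet)]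
  refine ae_of_all _ fun x hx => ?_
  obtain ⟨s, hs, hxs⟩ := mem_iUnion₂.1 hx
  rw [Mesh.mem_elts] at hs
  obtain ⟨g, -, -, hg⟩ := Mesh.exists_grad hu hs
  obtain ⟨g', -, -, hg'⟩ := Mesh.exists_grad hw hs
  have := (hasGradientAt_iff_hasFDerivAt.1 (hg x hxs)).add
    ((hasGradientAt_iff_hasFDerivAt.1 (hg' x hxs)).const_smul r)
  rw [← map_smul, ← map_add] at this
  rw [(hg x hxs).gradient, (hg' x hxs).gradient]
  exact (hasGradientAt_iff_hasFDerivAt.2 this).gradient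

theorem interiorOp_add_smul {a : E d → ℝ} {b : E d → E d} {c : E d → ℝ} (hb : ContinuousOn b 𝔭.P)
    (hc : ContinuousOn c 𝔭.P) {u w : E d → ℝ} (hu : u ∈ (𝔰.mesh i).P1) (hw : w ∈ (𝔰.mesh i).P1)
    (r : ℝ) (y : E d) : 𝔰.interiorOp i a b c (u + r • w) y =
      𝔰.interiorOp i a b c u y + r * 𝔰.interiorOp i a b c w y := by
  have h := 𝔰.isMesh i
  have hae := 𝔰.ae_gradient_add_smul hu hw r
  have hΩ : 𝔭.Ω = interior 𝔭.P := rfl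
  rw [interiorOp, interiorOp, interiorOp]
  rw [hΩ] at hae ⊢
  have h1 : ∫ x in interior 𝔭.P, ⟪gradient (u + r • w) x, gradient ((𝔰.mesh i).hat1 y) x⟫ =
      (∫ x in interior 𝔭.P, ⟪gradient u x, gradient ((𝔰.mesh i).hat1 y) x⟫) +
        r * ∫ x in interior 𝔭.P, ⟪gradient w x, gradient ((𝔰.mesh i).hat1 y) x⟫ := by
    rw [← integral_const_mul, ← integral_add ((𝔰.isPiecewiseCont_grad hu y).integrableOn h)
      (((𝔰.isPiecewiseCont_grad hw y).integrableOn h).const_mul r)]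
    refine integral_congr_ae ?_
    filter_upwards [hae] with x hx
    rw [hx, inner_add_left, real_inner_smul_left]
  have h2 : ∫ x in interior 𝔭.P, (-⟪b x, gradient (u + r • w) x⟫ + c x * (u + r • w) x) *
      (𝔰.mesh i).hat1 y x =
      (∫ x in interior 𝔭.P, (-⟪b x, gradient u x⟫ + c x * u x) * (𝔰.mesh i).hat1 y x) +
        r * ∫ x in interior 𝔭.P, (-⟪b x, gradient w x⟫ + c x * w x) * (𝔰.mesh i).hat1 y x := by
    rw [← integral_const_mul, ← integral_add ((𝔰.isPiecewiseCont_lower hb hc hu y).integrableOn h)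
      (((𝔰.isPiecewiseCont_lower hb hc hw y).integrableOn h).const_mul r)]
    refine integral_congr_ae ?_
    filter_upwards [hae] with x hx
    rw [hx, inner_add_right, real_inner_smul_right]
    simp only [Pi.add_apply, Pi.smul_apply, smul_eq_mul]
    ring
  rw [h1, h2]
  ring

theorem robinOp_add_smul {b : E d → E d} {c : E d → ℝ} {u w : E d → ℝ} (hu : u ∈ (𝔰.mesh i).P1)
    (hw : w ∈ (𝔰.mesh i).P1) (r : ℝ) {y : E d} (hb : b y ∈ tangentCone 𝔭.P y) :
    robinOp b c (u + r • w) y = robinOp b c u y + r * robinOp b c w y := by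
  obtain ⟨s, hs, l, hl, -, -, h1⟩ := Mesh.exists_lowerDini_eq (𝔰.isMesh i) hb
  rw [robinOp, robinOp, robinOp, h1 _ hu, h1 _ hw,
    h1 _ ((𝔰.mesh i).P1.add_mem hu ((𝔰.mesh i).P1.smul_mem r hw))]
  simp only [Pi.add_apply, Pi.smul_apply, smul_eq_mul]
  ring

/-- Monotonicity at the interior nodes. -/
theorem interiorOp_nonneg {θ : ℝ} (hθ : θ ∈ Ioo 0 (Real.pi / 2)) (hac : 𝔰.IsStrictlyAcute i θ)
    {a : E d → ℝ} {b : E d → E d} {c : E d → ℝ} (hb : ContinuousOn b 𝔭.P)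
    (hc : ContinuousOn c 𝔭.P) {y : E d} (hy : y ∈ (𝔰.mesh i).vertices) (hyi : y ∈ 𝔭.Ω) {ν : ℝ}
    (hν : 𝔰.IsArtificialDiffusion i θ b c y ν) (hνa : ν ≤ a y) {u : E d → ℝ}
    (hu : u ∈ (𝔰.mesh i).P1) (hu0 : u y = 0)
    (hun : ∀ s ∈ (𝔰.mesh i).elements, y ∈ s → ∀ z ∈ s, u z ≤ 0) :
    0 ≤ 𝔰.interiorOp i a b c u y := by
  have h := 𝔰.isMesh i
  have hsin : 0 < Real.sin θ := Real.sin_pos_of_pos_of_lt_pi hθ.1 (by linarith [hθ.2, Real.pi_pos])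
  have hyD : y ∉ 𝔭.bdD := fun hD => Problem.notMem_interior_of_frontier (Problem.bdD_subset hD) hyi
  rw [interiorOp]
  change 0 ≤ a y * (∫ x in interior 𝔭.P, _) + ∫ x in interior 𝔭.P, _
  rw [(𝔰.isPiecewiseCont_grad hu y).integral_eq_sum h,
    (𝔰.isPiecewiseCont_lower hb hc hu y).integral_eq_sum h, Finset.mul_sum,
    ← Finset.sum_add_distrib]
  -- The inequality holds on each element separately, with diffusion and lower order terms taken
  -- together.
  refine Finset.sum_nonneg fun s hs => ?_
  rw [Mesh.mem_elts] at hs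
  set K := interior (convexHull ℝ (s : Set (E d))) with hKdef
  have hKm : MeasurableSet K := isOpen_interior.measurableSet
  by_cases hys : y ∈ s
  swap
  · have e1 : ∫ x in K, ⟪gradient u x, gradient ((𝔰.mesh i).hat1 y) x⟫ = 0 :=
      setIntegral_eq_zero_of_forall_eq_zero fun x hx => by
        rw [Mesh.gradient_hat1_eq_zero hs hys hx, inner_zero_right]
    have e2 : ∫ x in K, (-⟪b x, gradient u x⟫ + c x * u x) * (𝔰.mesh i).hat1 y x = 0 :=
      setIntegral_eq_zero_of_forall_eq_zero fun x hx => by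
        rw [Mesh.hat1_eqOn_zero hs hys (interior_subset hx), mul_zero]
    rw [e1, e2, mul_zero, add_zero]
  obtain ⟨x₀, hx₀⟩ := Mesh.interior_element_nonempty hs
  obtain ⟨gu, cu, hgu, hgu'⟩ := Mesh.exists_grad hu hs
  obtain ⟨gφ, cφ, hgφ, hgφ'⟩ := Mesh.exists_grad (Mesh.hat1_mem_P1 h y) hs
  have hz : ∀ z, ∃ g : E d, ∀ x ∈ K, gradient ((𝔰.mesh i).hat z) x = g := fun z => by
    obtain ⟨g, c, -, hg⟩ := Mesh.exists_grad (Mesh.hat_mem_P1 (𝒯 := 𝔰.mesh i) z) hs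
    exact ⟨g, fun x hx => (hg x hx).gradient⟩
  choose g hg using hz
  have hguz : gu = ∑ z ∈ s, u z • g z := by
    rw [← (hgu' x₀ hx₀).gradient, Mesh.P1_gradient_eq_sum hu hs hx₀]
    exact Finset.sum_congr rfl fun z _ => by rw [hg z x₀ hx₀]
  set B := vecNormOn K b + Metric.diam (convexHull ℝ (s : Set (E d))) *
    sSup ((fun x => |c x|) '' K) with hB
  set V := volume.real (convexHull ℝ (s : Set (E d))) with hV
  have hB0 : 0 ≤ B := add_nonneg (vecNormOn_nonneg _ _) (mul_nonneg Metric.diam_nonneg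
    (Real.sSup_nonneg (by rintro _ ⟨x, -, rfl⟩; exact abs_nonneg _)))
  have hBν : B ≤ a y * Real.sin θ * ‖gφ‖ * V := by
    refine (hν.2 s hs hys).trans ?_
    rw [vecNormOn_const ⟨x₀, hx₀⟩ (fun x hx => (hgφ' x hx).gradient)]
    gcongr
  -- Both the gain from diffusion (`hinner`) and the possible loss from the lower order terms
  -- (`hlow`) are multiples of this weighted sum; the vertex `y` does not contribute, because `u y =
  -- 0`.
  set G := ∑ z ∈ s, (-u z) * ‖g z‖ with hG
  have hG0 : 0 ≤ G := Finset.sum_nonneg fun z hz =>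
    mul_nonneg (by linarith [hun s hs hys z hz]) (norm_nonneg _)
  have ha0 : 0 ≤ a y := hν.1.trans hνa
  have hinner : Real.sin θ * ‖gφ‖ * G ≤ ⟪gu, gφ⟫ := by
    rw [hguz, sum_inner, hG, Finset.mul_sum]
    refine Finset.sum_le_sum fun z hz => ?_
    by_cases hzy : z = y
    · subst hzy; simp [hu0]
    have h1 := hac y hy hyD z (Mesh.mem_vertices_of_mem hs.1 hz) (Ne.symm hzy) s hs x₀ hx₀
    have h2 := Mesh.gradient_hat1 h hs y hx₀
    rw [(hgφ' x₀ hx₀).gradient] at h2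
    have h3 := Mesh.integral_hat_pos h hy
    rw [hg y x₀ hx₀] at h1 h2
    rw [hg z x₀ hx₀] at h1
    set κ := (∫ x in interior 𝔭.P, (𝔰.mesh i).hat y x)⁻¹
    have hκ : 0 < κ := inv_pos.2 h3
    rw [h2, real_inner_smul_left, real_inner_smul_right, norm_smul, Real.norm_eq_abs,
      abs_of_pos hκ, real_inner_comm]
    have h4 : 0 ≤ -u z := by linarith [hun s hs hys z hz]
    have h5 := mul_le_mul_of_nonneg_left h1 (mul_nonneg h4 hκ.le)
    nlinarith
  have hlow : ∀ x ∈ K, -(G * B) ≤ -⟪b x, gradient u x⟫ + c x * u x := by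
    intro x hx
    rw [(hgu' x hx).gradient, hguz, Mesh.P1_eq_sum_hat hu hs (interior_subset hx), inner_sum,
      Finset.mul_sum, ← Finset.sum_neg_distrib, ← Finset.sum_add_distrib, hG, Finset.sum_mul,
      ← Finset.sum_neg_distrib]
    refine Finset.sum_le_sum fun z hz => ?_
    by_cases hzy : z = y
    · subst hzy; simp [hu0]
    have hcs := s.finite_toSet.isCompact_convexHull ℝ
    have h1 : ‖b x‖ ≤ vecNormOn K b := norm_le_vecNormOn hcs interior_subset
      (hb.mono (Mesh.element_subset h hs)) hx
    have h2 : |c x| ≤ sSup ((fun x => |c x|) '' K) := by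
      refine le_csSup ?_ (mem_image_of_mem _ hx)
      exact (hcs.bddAbove_image ((hc.mono (Mesh.element_subset h hs)).abs)).mono
        (image_mono interior_subset)
    have h3 := Mesh.one_le_norm_gradient_hat_mul_diam hs hys hz (Ne.symm hzy) hx
    rw [hg z x hx] at h3
    have h4 : 0 ≤ -u z := by linarith [hun s hs hys z hz]
    have h5 : |⟪b x, g z⟫| ≤ vecNormOn K b * ‖g z‖ :=
      (abs_real_inner_le_norm _ _).trans (by gcongr)
    have h6 : c x * (𝔰.mesh i).hat z x ≤ sSup ((fun x => |c x|) '' K) *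
        (‖g z‖ * Metric.diam (convexHull ℝ (s : Set (E d)))) := by
      calc c x * (𝔰.mesh i).hat z x ≤ |c x| * (𝔰.mesh i).hat z x := by
            gcongr
            · exact Mesh.hat_nonneg _ _
            · exact le_abs_self _
        _ ≤ |c x| * (‖g z‖ * Metric.diam (convexHull ℝ (s : Set (E d)))) := by
            gcongr; exact (Mesh.hat_le_one _ _).trans h3
        _ ≤ _ := by gcongr
    have h7 : -⟪b x, g z⟫ + c x * (𝔰.mesh i).hat z x ≤ ‖g z‖ * B := by
      have := neg_le_abs ⟪b x, g z⟫
      rw [hB]; nlinarith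
    have h8 := mul_le_mul_of_nonneg_left h7 h4
    rw [real_inner_smul_right]
    nlinarith
  have hI1 : ∫ x in K, ⟪gradient u x, gradient ((𝔰.mesh i).hat1 y) x⟫ = V * ⟪gu, gφ⟫ := by
    rw [setIntegral_congr_fun (g := fun _ => ⟪gu, gφ⟫) hKm]
    · have : volume.real K = V := by
        have := (convex_convexHull ℝ (s : Set (E d))).addHaar_frontier (volume : Measure (E d))
        rw [hV, measureReal_def, measureReal_def, hKdef,
          ← measure_congr (interior_ae_eq_of_null_frontier this)]
      rw [setIntegral_const, this, smul_eq_mul]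
    · intro x hx
      simp only
      rw [(hgu' x hx).gradient, (hgφ' x hx).gradient]
  have hI2 : -(G * B) * ∫ x in K, (𝔰.mesh i).hat1 y x ≤
      ∫ x in K, (-⟪b x, gradient u x⟫ + c x * u x) * (𝔰.mesh i).hat1 y x := by
    rw [← integral_const_mul]
    refine setIntegral_mono_on ?_ ?_ hKm fun x hx =>
      mul_le_mul_of_nonneg_right (hlow x hx) (Mesh.hat1_nonneg _ _)
    · exact ((Mesh.IsPiecewiseCont.of_P1 (Mesh.hat1_mem_P1 h y)).integrableOn_element hs).const_mul _
    · exact (𝔰.isPiecewiseCont_lower hb hc hu y).integrableOn_element hs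
  have hI3 := Mesh.setIntegral_hat1_le_one h hs hy
  have hGB : 0 ≤ G * B := mul_nonneg hG0 hB0
  have hV0 : 0 ≤ V := measureReal_nonneg
  rw [hI1]
  -- The diffusive gain is at least `G * B` by the artificial diffusion condition, and the loss is
  -- at most `G * B` times the mass of `hat1` on the element, which does not exceed one.
  have e1 : a y * (V * (Real.sin θ * ‖gφ‖ * G)) ≤ a y * (V * ⟪gu, gφ⟫) := by gcongr
  have e2 : G * B ≤ G * (a y * Real.sin θ * ‖gφ‖ * V) := by gcongr
  have e3 : G * B * ∫ x in K, (𝔰.mesh i).hat1 y x ≤ G * B * 1 := by gcongr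
  linarith

/-- The value `0` at `y` is maximal over the adjacent elements, so difference quotients pointing
from `y` into the domain have the right sign; the zeroth order term vanishes with `u y`. -/
theorem robinOp_nonneg {b : E d → E d} {c : E d → ℝ} {y : E d} (hy : y ∈ (𝔰.mesh i).vertices)
    (hb : b y ∈ tangentCone 𝔭.P y) {u : E d → ℝ} (hu : u ∈ (𝔰.mesh i).P1) (hu0 : u y = 0)
    (hun : ∀ s ∈ (𝔰.mesh i).elements, y ∈ s → ∀ z ∈ s, u z ≤ 0) : 0 ≤ robinOp b c u y := by
  obtain ⟨s, hs, l, hl, hys, hyl, h1⟩ := Mesh.exists_lowerDini_eq (𝔰.isMesh i) hb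
  rw [(𝔰.mesh i).vertex_mem_convexHull_iff hy hs.1] at hys
  rw [robinOp, h1 u hu, hu0, mul_zero, add_zero, zero_sub]
  have := Mesh.P1_nonpos hu hs (hun s hs hys) hyl
  exact div_nonneg (by linarith) hl.le

end Discretisation

end HJBFEM

/-! ### Compactness of the control set and case distinction over node types -/

namespace HJBFEM

namespace SupNormContinuous

variable {A X V : Type*} [TopologicalSpace A] [SeminormedAddCommGroup V] {S : Set X} {u : A → X → V}

theorem continuous_apply {A X V : Type*} [TopologicalSpace A] [UniformSpace V] {S : Set X}
    {u : A → X → V} (hu : SupNormContinuous S u) {x : X} (hx : x ∈ S) :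
    Continuous fun α => u α x :=
  continuous_iff_continuousAt.2 fun α => (hu α).tendsto_at hx

/-- A bound for one control holds, up to one, for all controls nearby, and finitely many such
neighbourhoods cover `A`. Continuity in space is not required, so this covers the piecewise
continuous boundary data. -/
theorem exists_bound_of_bounded [CompactSpace A] (hu : SupNormContinuous S u)
    (hb : ∀ α, ∃ C, ∀ x ∈ S, ‖u α x‖ ≤ C) : ∃ C, 0 ≤ C ∧ ∀ α, ∀ x ∈ S, ‖u α x‖ ≤ C := by
  have h1 : ∀ α₀, ∃ C, ∀ᶠ α in 𝓝 α₀, ∀ x ∈ S, ‖u α x‖ ≤ C := by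
    intro α₀
    obtain ⟨C, hC⟩ := hb α₀
    refine ⟨C + 1, ?_⟩
    filter_upwards [Metric.tendstoUniformlyOn_iff.1 (hu α₀) 1 one_pos] with α hα x hx
    have h2 := hα x hx
    rw [dist_comm, dist_eq_norm] at h2
    have h3 := norm_le_norm_add_norm_sub' (u α x) (u α₀ x)
    linarith [hC x hx]
  choose C hC using h1
  obtain ⟨t, -, ht⟩ := isCompact_univ.elim_nhds_subcover _ fun α _ => hC α
  refine ⟨∑ α ∈ t, |C α|, Finset.sum_nonneg fun _ _ => abs_nonneg _, fun α x hx => ?_⟩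
  obtain ⟨β, hβ, hαβ⟩ := mem_iUnion₂.1 (ht (mem_univ α))
  exact ((hαβ x hx).trans (le_abs_self _)).trans
    (Finset.single_le_sum (f := fun α => |C α|) (fun _ _ => abs_nonneg _) hβ)

theorem exists_bound [TopologicalSpace X] [CompactSpace A] (hu : SupNormContinuous S u) (hS : IsCompact S)
    (hc : ∀ α, ContinuousOn (u α) S) : ∃ C, 0 ≤ C ∧ ∀ α, ∀ x ∈ S, ‖u α x‖ ≤ C :=
  hu.exists_bound_of_bounded fun α => hS.exists_bound_of_continuousOn (hc α)

/-- An `ε / 3` argument transfers the modulus of continuity of one control to its neighbours; a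
finite subcover gives a common one. -/
theorem equicontinuous [PseudoMetricSpace X] [CompactSpace A] (hu : SupNormContinuous S u) (hS : IsCompact S)
    (hc : ∀ α, ContinuousOn (u α) S) {ε : ℝ} (hε : 0 < ε) : ∃ δ > 0, ∀ α, ∀ x ∈ S, ∀ y ∈ S,
      dist x y < δ → dist (u α x) (u α y) < ε := by
  have h1 : ∀ α₀, ∃ δ > 0, ∀ᶠ α in 𝓝 α₀, ∀ x ∈ S, ∀ y ∈ S,
      dist x y < δ → dist (u α x) (u α y) < ε := by
    intro α₀
    obtain ⟨δ, hδ, h⟩ := Metric.uniformContinuousOn_iff.1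
      (hS.uniformContinuousOn_of_continuous (hc α₀)) (ε / 3) (by positivity)
    refine ⟨δ, hδ, ?_⟩
    filter_upwards [Metric.tendstoUniformlyOn_iff.1 (hu α₀) (ε / 3) (by positivity)] with α hα
    intro x hx y hy hxy
    have h2 := hα x hx
    have h3 := hα y hy
    have h4 := h x hx y hy hxy
    rw [dist_comm] at h2
    linarith [dist_triangle4 (u α x) (u α₀ x) (u α₀ y) (u α y)]
  choose δ hδ h using h1
  obtain ⟨t, -, ht⟩ := isCompact_univ.elim_nhds_subcover _ fun α _ => h α
  obtain ⟨r, hr, hrt⟩ : ∃ r > 0, ∀ α ∈ t, r ≤ δ α := by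
    rcases t.eq_empty_or_nonempty with rfl | hne
    · exact ⟨1, one_pos, by simp⟩
    · obtain ⟨α, hα, hm⟩ := t.exists_min_image δ hne
      exact ⟨δ α, hδ α, hm⟩
  refine ⟨r, hr, fun α x hx y hy hxy => ?_⟩
  obtain ⟨β, hβ, hαβ⟩ := mem_iUnion₂.1 (ht (mem_univ α))
  exact hαβ x hx y hy (hxy.trans_le (hrt β hβ))

end SupNormContinuous

theorem Mesh.exists_gradient_bound {d : ℕ} {𝒯 : Mesh d} {P : Set (E d)} (h : 𝒯.IsMeshOf P)
    {w : E d → ℝ} (hw : w ∈ 𝒯.P1) : ∃ G, 0 ≤ G ∧ ∀ s ∈ 𝒯.elements,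
      ∃ g c, (∀ x ∈ convexHull ℝ (s : Set (E d)), w x = ⟪g, x⟫ + c) ∧ ‖g‖ ≤ G := by
  choose g c hgc _ using fun s : 𝒯.elements => exists_grad hw s.2
  have : Finite 𝒯.elements := elements_finite h
  have := Fintype.ofFinite 𝒯.elements
  refine ⟨∑ s, ‖g s‖, Finset.sum_nonneg fun _ _ => norm_nonneg _,
    fun s hs => ⟨g ⟨s, hs⟩, c ⟨s, hs⟩, hgc ⟨s, hs⟩, ?_⟩⟩
  exact Finset.single_le_sum (f := fun s => ‖g s‖) (fun _ _ => norm_nonneg _) (Finset.mem_univ _)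

theorem Mesh.exists_lowerDini_bound {d : ℕ} {𝒯 : Mesh d} {P : Set (E d)} (h : 𝒯.IsMeshOf P)
    {w : E d → ℝ} (hw : w ∈ 𝒯.P1) :
    ∃ G, 0 ≤ G ∧ ∀ x b, b ∈ tangentCone P x → |lowerDini w x b| ≤ G * ‖b‖ := by
  obtain ⟨G, hG0, hG⟩ := exists_gradient_bound h hw
  refine ⟨G, hG0, fun x b hb => ?_⟩
  obtain ⟨s, hs, r, hr, hxs, hrs, hD⟩ := exists_lowerDini_eq h hb
  obtain ⟨g, c, hgc, hgG⟩ := hG s hs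
  have : (w x - w (x + r • b)) / r = -⟪g, b⟫ := by
    rw [hgc x hxs, hgc _ hrs, inner_add_right, real_inner_smul_right]
    field_simp
    ring
  rw [hD w hw, this, abs_neg]
  exact (abs_real_inner_le_norm _ _).trans (by gcongr)

variable {d : ℕ} {A : Type*} [TopologicalSpace A] {𝔭 : Problem d A}

namespace Problem

theorem bdt_notMem {x : E d} (hx : x ∈ 𝔭.bdt) : x ∉ 𝔭.Ω :=
  notMem_interior_of_frontier (bdt_subset hx)

theorem bdR_notMem {x : E d} (hx : x ∈ 𝔭.bdR) : x ∉ 𝔭.Ω :=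
  notMem_interior_of_frontier (bdR_subset hx)

theorem bdD_notMem {x : E d} (hx : x ∈ 𝔭.bdD) : x ∉ 𝔭.Ω :=
  notMem_interior_of_frontier (bdD_subset hx)

theorem robin_subset : 𝔭.bdt ∪ 𝔭.bdR ⊆ frontier 𝔭.P := union_subset bdt_subset bdR_subset

theorem bdD_notMem_robin {x : E d} (hx : x ∈ 𝔭.bdD) : x ∉ 𝔭.bdt ∪ 𝔭.bdR := by
  rintro (h | h)
  · exact 𝔭.disjoint_Dt.le_bot ⟨hx, h⟩
  · exact 𝔭.disjoint_DR.le_bot ⟨hx, h⟩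

theorem bdR_notMem_bdt {x : E d} (hx : x ∈ 𝔭.bdR) : x ∉ 𝔭.bdt :=
  fun h => 𝔭.disjoint_Rt.le_bot ⟨hx, h⟩

theorem isCompact_P : IsCompact 𝔭.P := by
  obtain ⟨-, S, -, hS⟩ := 𝔭.polytopic
  rw [hS]
  exact S.isCompact_biUnion fun s _ => s.finite_toSet.isCompact_convexHull ℝ

theorem mem_cases {x : E d} (hx : x ∈ 𝔭.P) : x ∈ 𝔭.Ω ∨ x ∈ 𝔭.bdt ∨ x ∈ 𝔭.bdR ∨ x ∈ 𝔭.bdD := by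
  by_cases hi : x ∈ 𝔭.Ω
  · exact Or.inl hi
  · have : x ∈ frontier 𝔭.P := ⟨subset_closure hx, hi⟩
    rw [← 𝔭.union_bd] at this
    rcases this with (h | h) | h
    · exact Or.inr (Or.inr (Or.inr h))
    · exact Or.inr (Or.inr (Or.inl h))
    · exact Or.inr (Or.inl h)

end Problem

namespace Discretisation

variable (𝔰 : Discretisation 𝔭) {i : ℕ}

theorem vertex_mem {y : E d} (hy : y ∈ (𝔰.mesh i).vertices) : y ∈ 𝔭.P :=
  Mesh.vertex_mem (𝔰.isMesh i) hy

section Cases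

variable (α : A) (w : E d → ℝ) {y : E d}

theorem opE_interior (hy : y ∈ 𝔭.Ω) :
    𝔰.opE i α w y = 𝔰.interiorOp i (𝔰.aE i α) (𝔰.bE i α) (𝔰.cE i α) w y := if_pos hy

theorem opI_interior (hy : y ∈ 𝔭.Ω) :
    𝔰.opI i α w y = 𝔰.interiorOp i (𝔰.aI i α) (𝔰.bI i α) (𝔰.cI i α) w y := if_pos hy

theorem rhs_interior (hy : y ∈ 𝔭.Ω) :
    𝔰.rhs i α y = ∫ x in 𝔭.Ω, 𝔰.f i α x * (𝔰.mesh i).hat1 y x := if_pos hy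

theorem opE_robin (hy : y ∈ 𝔭.bdt ∪ 𝔭.bdR) :
    𝔰.opE i α w y = robinOp (𝔰.bBE i α) (𝔰.cBE i α) w y := by
  rw [opE, if_neg (Problem.notMem_interior_of_frontier (Problem.robin_subset hy)), if_pos hy]

theorem opI_robin (hy : y ∈ 𝔭.bdt ∪ 𝔭.bdR) :
    𝔰.opI i α w y = robinOp (𝔰.bBI i α) (𝔰.cBI i α) w y := by
  rw [opI, if_neg (Problem.notMem_interior_of_frontier (Problem.robin_subset hy)), if_pos hy]

theorem rhs_robin (hy : y ∈ 𝔭.bdt ∪ 𝔭.bdR) : 𝔰.rhs i α y = 𝔰.gB i α y := by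
  rw [rhs, if_neg (Problem.notMem_interior_of_frontier (Problem.robin_subset hy)), if_pos hy]

theorem opE_dirichlet (hy : y ∈ 𝔭.bdD) : 𝔰.opE i α w y = 0 := by
  rw [opE, if_neg (Problem.bdD_notMem hy), if_neg (Problem.bdD_notMem_robin hy)]

theorem opI_dirichlet (hy : y ∈ 𝔭.bdD) : 𝔰.opI i α w y = w y := by
  rw [opI, if_neg (Problem.bdD_notMem hy), if_neg (Problem.bdD_notMem_robin hy)]

theorem rhs_dirichlet (hy : y ∈ 𝔭.bdD) : 𝔰.rhs i α y = 𝔭.g y := by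
  rw [rhs, if_neg (Problem.bdD_notMem hy), if_neg (Problem.bdD_notMem_robin hy)]

theorem opE_bdR (hcons : 𝔰.IsConsistent) (hy : y ∈ 𝔭.bdR) : 𝔰.opE i α w y = 0 := by
  obtain ⟨h1, h2, -⟩ := hcons.implicit_bdR i α y hy
  rw [opE_robin 𝔰 α w (Or.inr hy), robinOp, h1, h2, lowerDini]
  simp

theorem timeDiff_pos (w' : E d → ℝ) (hy : y ∈ 𝔭.Ω ∪ 𝔭.bdt) :
    𝔰.timeDiff i w' w y = (w' y - w y) / 𝔰.h i := if_pos hy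

theorem timeDiff_bdR (w' : E d → ℝ) (hy : y ∈ 𝔭.bdR) : 𝔰.timeDiff i w' w y = 0 :=
  if_neg fun h => h.elim (Problem.bdR_notMem hy) (Problem.bdR_notMem_bdt hy)

theorem timeDiff_bdD (w' : E d → ℝ) (hy : y ∈ 𝔭.bdD) : 𝔰.timeDiff i w' w y = 0 :=
  if_neg fun h => h.elim (Problem.bdD_notMem hy) fun h => Problem.bdD_notMem_robin hy (Or.inl h)

end Cases

theorem opE_add_smul (α : A) {u w : E d → ℝ} (hu : u ∈ (𝔰.mesh i).P1) (hw : w ∈ (𝔰.mesh i).P1)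
    (r : ℝ) {y : E d} (hy : y ∈ (𝔰.mesh i).vertices) :
    𝔰.opE i α (u + r • w) y = 𝔰.opE i α u y + r * 𝔰.opE i α w y := by
  have hrob : y ∈ 𝔭.bdt ∪ 𝔭.bdR →
      𝔰.opE i α (u + r • w) y = 𝔰.opE i α u y + r * 𝔰.opE i α w y := fun h => by
    simp only [𝔰.opE_robin α _ h]
    exact 𝔰.robinOp_add_smul hu hw r (𝔰.bBE_cone i α y (Problem.robin_subset h))
  rcases Problem.mem_cases (𝔰.vertex_mem hy) with h | h | h | h
  · simp only [𝔰.opE_interior α _ h]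
    exact 𝔰.interiorOp_add_smul (𝔰.bE_cont i α) (𝔰.cE_cont i α) hu hw r y
  · exact hrob (Or.inl h)
  · exact hrob (Or.inr h)
  · simp [𝔰.opE_dirichlet α _ h]

theorem opI_add_smul (α : A) {u w : E d → ℝ} (hu : u ∈ (𝔰.mesh i).P1) (hw : w ∈ (𝔰.mesh i).P1)
    (r : ℝ) {y : E d} (hy : y ∈ (𝔰.mesh i).vertices) :
    𝔰.opI i α (u + r • w) y = 𝔰.opI i α u y + r * 𝔰.opI i α w y := by
  have hrob : y ∈ 𝔭.bdt ∪ 𝔭.bdR →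
      𝔰.opI i α (u + r • w) y = 𝔰.opI i α u y + r * 𝔰.opI i α w y := fun h => by
    simp only [𝔰.opI_robin α _ h]
    exact 𝔰.robinOp_add_smul hu hw r (𝔰.bBI_cone i α y (Problem.robin_subset h))
  rcases Problem.mem_cases (𝔰.vertex_mem hy) with h | h | h | h
  · simp only [𝔰.opI_interior α _ h]
    exact 𝔰.interiorOp_add_smul (𝔰.bI_cont i α) (𝔰.cI_cont i α) hu hw r y
  · exact hrob (Or.inl h)
  · exact hrob (Or.inr h)
  · simp [𝔰.opI_dirichlet α _ h]

/-- This is the sign condition of an M-matrix in functional form: for `u = -hat z` with `z ≠ y` it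
says that the off-diagonal entry is nonpositive. -/
theorem opE_nonneg (hdiff : 𝔰.HasArtificialDiffusion) (α : A) {y : E d}
    (hy : y ∈ (𝔰.mesh i).vertices) {u : E d → ℝ} (hu : u ∈ (𝔰.mesh i).P1) (hu0 : u y = 0)
    (hun : ∀ s ∈ (𝔰.mesh i).elements, y ∈ s → ∀ z ∈ s, u z ≤ 0) : 0 ≤ 𝔰.opE i α u y := by
  obtain ⟨θ, hθ, hac, hν⟩ := hdiff i
  have hrob : y ∈ 𝔭.bdt ∪ 𝔭.bdR → 0 ≤ 𝔰.opE i α u y := fun h => by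
    rw [𝔰.opE_robin α _ h]
    exact 𝔰.robinOp_nonneg hy (𝔰.bBE_cone i α y (Problem.robin_subset h)) hu hu0 hun
  rcases Problem.mem_cases (𝔰.vertex_mem hy) with h | h | h | h
  · rw [𝔰.opE_interior α _ h]
    obtain ⟨⟨ν, h1, h2⟩, -⟩ := hν α y hy h
    exact 𝔰.interiorOp_nonneg hθ hac (𝔰.bE_cont i α) (𝔰.cE_cont i α) hy h h1 h2 hu hu0 hun
  · exact hrob (Or.inl h)
  · exact hrob (Or.inr h)
  · rw [𝔰.opE_dirichlet α _ h]

theorem opI_nonneg (hdiff : 𝔰.HasArtificialDiffusion) (α : A) {y : E d}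
    (hy : y ∈ (𝔰.mesh i).vertices) {u : E d → ℝ} (hu : u ∈ (𝔰.mesh i).P1) (hu0 : u y = 0)
    (hun : ∀ s ∈ (𝔰.mesh i).elements, y ∈ s → ∀ z ∈ s, u z ≤ 0) : 0 ≤ 𝔰.opI i α u y := by
  obtain ⟨θ, hθ, hac, hν⟩ := hdiff i
  have hrob : y ∈ 𝔭.bdt ∪ 𝔭.bdR → 0 ≤ 𝔰.opI i α u y := fun h => by
    rw [𝔰.opI_robin α _ h]
    exact 𝔰.robinOp_nonneg hy (𝔰.bBI_cone i α y (Problem.robin_subset h)) hu hu0 hun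
  rcases Problem.mem_cases (𝔰.vertex_mem hy) with h | h | h | h
  · rw [𝔰.opI_interior α _ h]
    obtain ⟨-, ν, h1, h2⟩ := hν α y hy h
    exact 𝔰.interiorOp_nonneg hθ hac (𝔰.bI_cont i α) (𝔰.cI_cont i α) hy h h1 h2 hu hu0 hun
  · exact hrob (Or.inl h)
  · exact hrob (Or.inr h)
  · rw [𝔰.opI_dirichlet α _ h, hu0]

/-- The constant function one on the closed domain. -/
noncomputable def one (𝔭 : Problem d A) : E d → ℝ := 𝔭.P.indicator fun _ => 1

theorem one_mem : one 𝔭 ∈ (𝔰.mesh i).P1 := Mesh.indicator_one_mem_P1 (𝔰.isMesh i)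

theorem one_apply {x : E d} (hx : x ∈ 𝔭.P) : one 𝔭 x = 1 := indicator_of_mem hx _

theorem gradient_one {x : E d} (hx : x ∈ 𝔭.Ω) : gradient (one 𝔭) x = 0 := by
  have : one 𝔭 =ᶠ[𝓝 x] fun _ => 1 := by
    filter_upwards [isOpen_interior.mem_nhds hx] with z hz using one_apply (interior_subset hz)
  rw [this.gradient_eq, gradient_fun_const]

theorem interiorOp_one (a : E d → ℝ) (b : E d → E d) (c : E d → ℝ) (y : E d) :
    𝔰.interiorOp i a b c (one 𝔭) y = ∫ x in 𝔭.Ω, c x * (𝔰.mesh i).hat1 y x := by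
  have hm : MeasurableSet 𝔭.Ω := isOpen_interior.measurableSet
  rw [interiorOp, setIntegral_eq_zero_of_forall_eq_zero, mul_zero, zero_add]
  · refine setIntegral_congr_fun hm fun x hx => ?_
    rw [gradient_one hx, one_apply (interior_subset hx), inner_zero_right, neg_zero, zero_add,
      mul_one]
  · intro x hx
    rw [gradient_one hx, inner_zero_left]

theorem interiorOp_one_nonneg (a : E d → ℝ) (b : E d → E d) {c : E d → ℝ}
    (hc : ∀ x ∈ 𝔭.P, 0 ≤ c x) (y : E d) : 0 ≤ 𝔰.interiorOp i a b c (one 𝔭) y := by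
  rw [interiorOp_one]
  exact setIntegral_nonneg isOpen_interior.measurableSet fun x hx =>
    mul_nonneg (hc x (interior_subset hx)) (Mesh.hat1_nonneg _ _)

theorem robinOp_one (𝔰 : Discretisation 𝔭) {b : E d → E d} (c : E d → ℝ) {y : E d} (hy : y ∈ 𝔭.P)
    (hb : b y ∈ tangentCone 𝔭.P y) : robinOp b c (one 𝔭) y = c y := by
  -- Any mesh will do, since the indicator of `P` is piecewise affine on all of them.
  obtain ⟨s, hs, r, -, -, hr, h1⟩ := Mesh.exists_lowerDini_eq (𝔰.isMesh 0) hb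
  rw [robinOp, h1 _ 𝔰.one_mem, one_apply hy,
    one_apply (Mesh.element_subset (𝔰.isMesh 0) hs hr), sub_self, zero_div, zero_add, mul_one]

theorem opE_one_nonneg (α : A) {y : E d} (hy : y ∈ (𝔰.mesh i).vertices) :
    0 ≤ 𝔰.opE i α (one 𝔭) y := by
  have hrob : y ∈ 𝔭.bdt ∪ 𝔭.bdR → 0 ≤ 𝔰.opE i α (one 𝔭) y := fun h => by
    have h' := Problem.robin_subset h
    rw [𝔰.opE_robin α _ h, 𝔰.robinOp_one _ (𝔰.vertex_mem hy) (𝔰.bBE_cone i α y h')]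
    exact 𝔰.cBE_nonneg i α y h'
  rcases Problem.mem_cases (𝔰.vertex_mem hy) with h | h | h | h
  · rw [𝔰.opE_interior α _ h]
    exact 𝔰.interiorOp_one_nonneg _ _ (𝔰.cE_nonneg i α) y
  · exact hrob (Or.inl h)
  · exact hrob (Or.inr h)
  · rw [𝔰.opE_dirichlet α _ h]

theorem opI_one_nonneg (α : A) {y : E d} (hy : y ∈ (𝔰.mesh i).vertices) :
    0 ≤ 𝔰.opI i α (one 𝔭) y := by
  have hrob : y ∈ 𝔭.bdt ∪ 𝔭.bdR → 0 ≤ 𝔰.opI i α (one 𝔭) y := fun h => by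
    have h' := Problem.robin_subset h
    rw [𝔰.opI_robin α _ h, 𝔰.robinOp_one _ (𝔰.vertex_mem hy) (𝔰.bBI_cone i α y h')]
    exact 𝔰.cBI_nonneg i α y h'
  rcases Problem.mem_cases (𝔰.vertex_mem hy) with h | h | h | h
  · rw [𝔰.opI_interior α _ h]
    exact 𝔰.interiorOp_one_nonneg _ _ (𝔰.cI_nonneg i α) y
  · exact hrob (Or.inl h)
  · exact hrob (Or.inr h)
  · rw [𝔰.opI_dirichlet α _ h, one_apply (𝔰.vertex_mem hy)]
    exact zero_le_one

theorem rhs_nonneg (α : A) {y : E d} (hy : y ∈ (𝔰.mesh i).vertices) : 0 ≤ 𝔰.rhs i α y := by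
  have hrob : y ∈ 𝔭.bdt ∪ 𝔭.bdR → 0 ≤ 𝔰.rhs i α y := fun h => by
    rw [𝔰.rhs_robin α h]
    exact 𝔰.gB_nonneg i α y (Problem.robin_subset h)
  rcases Problem.mem_cases (𝔰.vertex_mem hy) with h | h | h | h
  · rw [𝔰.rhs_interior α h]
    exact setIntegral_nonneg isOpen_interior.measurableSet fun x hx =>
      mul_nonneg (𝔰.f_nonneg i α x (interior_subset hx)) (Mesh.hat1_nonneg _ _)
  · exact hrob (Or.inl h)
  · exact hrob (Or.inr h)
  · rw [𝔰.rhs_dirichlet α h]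
    exact 𝔭.g_nonneg y (Problem.bdD_subset h)

/-! ### The linear part of the scheme -/

/-- The linear part of the scheme for the control `α` at the node `y`, with the values `w'` at the
next time step and `w` at the current one. -/
noncomputable def lin (i : ℕ) (α : A) (w' w : E d → ℝ) (y : E d) : ℝ :=
  -𝔰.timeDiff i w' w y + (𝔰.opE i α w' y + 𝔰.opI i α w y)

theorem lin_add_smul (α : A) {u' u w' w : E d → ℝ} (hu' : u' ∈ (𝔰.mesh i).P1)
    (hu : u ∈ (𝔰.mesh i).P1) (hw' : w' ∈ (𝔰.mesh i).P1) (hw : w ∈ (𝔰.mesh i).P1)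
    (r : ℝ) {y : E d} (hy : y ∈ (𝔰.mesh i).vertices) :
    𝔰.lin i α (u' + r • w') (u + r • w) y = 𝔰.lin i α u' u y + r * 𝔰.lin i α w' w y := by
  rw [lin, lin, lin, 𝔰.opE_add_smul α hu' hw' r hy, 𝔰.opI_add_smul α hu hw r hy, timeDiff,
    timeDiff, timeDiff]
  split_ifs
  · simp only [Pi.add_apply, Pi.smul_apply, smul_eq_mul]; ring
  · ring

/-- Unlike `u`, the function `u'` need not vanish at `y`. After subtracting `u' y` times the hat
function, `opE_nonneg` applies; the subtracted part contributes at least `u' y / h` by the time step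
restriction, which the time difference cancels. At nodes without time derivative the explicit
operator is zero. -/
theorem lin_nonneg (hcons : 𝔰.IsConsistent) (hdiff : 𝔰.HasArtificialDiffusion)
    (hstep : 𝔰.TimeStepRestriction) (α : A) {y : E d} (hy : y ∈ (𝔰.mesh i).vertices)
    {u' u : E d → ℝ} (hu' : u' ∈ (𝔰.mesh i).P1) (hu : u ∈ (𝔰.mesh i).P1) (hu0 : u y = 0)
    (hun' : ∀ s ∈ (𝔰.mesh i).elements, y ∈ s → ∀ z ∈ s, u' z ≤ 0)
    (hun : ∀ s ∈ (𝔰.mesh i).elements, y ∈ s → ∀ z ∈ s, u z ≤ 0) : 0 ≤ 𝔰.lin i α u' u y := by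
  classical
  have hI := 𝔰.opI_nonneg hdiff α hy hu hu0 hun
  have hpos : y ∈ 𝔭.Ω ∪ 𝔭.bdt → 0 ≤ 𝔰.lin i α u' u y := fun hyt => by
    have hh := 𝔰.h_pos i
    have hφ := Mesh.hat_mem_P1 (𝒯 := 𝔰.mesh i) y
    have h1 := 𝔰.opE_add_smul α hu' hφ (-u' y) hy
    have h2 : 0 ≤ 𝔰.opE i α (u' + (-u' y) • (𝔰.mesh i).hat y) y := by
      refine 𝔰.opE_nonneg hdiff α hy ((𝔰.mesh i).P1.add_mem hu' ((𝔰.mesh i).P1.smul_mem _ hφ))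
        ?_ fun s hs hys z hz => ?_
      · simp [Mesh.hat_self hy]
      · have h3 := hun' s hs hys z hz
        simp only [Pi.add_apply, Pi.smul_apply, smul_eq_mul, Mesh.hat_vertex hs.1 hz]
        split_ifs with hzy
        · subst hzy; simp
        · simpa using h3
    obtain ⟨s, hs, hys⟩ := Mesh.vertex_mem_element (𝔰.isMesh i) hy
    have h3 := hun' s hs hys y hys
    have h4 := hstep i α y hy hyt
    have h5 : 𝔰.opE i α ((𝔰.mesh i).hat y) y ≤ 1 / 𝔰.h i := by
      rw [le_div_iff₀ hh]; linarith
    rw [lin, 𝔰.timeDiff_pos _ _ hyt, hu0, sub_zero, div_eq_mul_one_div]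
    nlinarith
  have h0 : 𝔰.timeDiff i u' u y = 0 → 𝔰.opE i α u' y = 0 → 0 ≤ 𝔰.lin i α u' u y := fun h h' => by
    rw [lin, h, h']; linarith
  rcases Problem.mem_cases (𝔰.vertex_mem hy) with h | h | h | h
  · exact hpos (Or.inl h)
  · exact hpos (Or.inr h)
  · exact h0 (𝔰.timeDiff_bdR _ _ h) (𝔰.opE_bdR α _ hcons h)
  · exact h0 (𝔰.timeDiff_bdD _ _ h) (𝔰.opE_dirichlet α _ h)

/-- Discrete comparison: the linear part of the scheme is monotone. -/
theorem lin_mono (hcons : 𝔰.IsConsistent) (hdiff : 𝔰.HasArtificialDiffusion)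
    (hstep : 𝔰.TimeStepRestriction) (α : A) {y : E d} (hy : y ∈ (𝔰.mesh i).vertices)
    {u' u w' w : E d → ℝ} (hu' : u' ∈ (𝔰.mesh i).P1) (hu : u ∈ (𝔰.mesh i).P1)
    (hw' : w' ∈ (𝔰.mesh i).P1) (hw : w ∈ (𝔰.mesh i).P1) (h0 : u y = w y)
    (hn' : ∀ s ∈ (𝔰.mesh i).elements, y ∈ s → ∀ z ∈ s, u' z ≤ w' z)
    (hn : ∀ s ∈ (𝔰.mesh i).elements, y ∈ s → ∀ z ∈ s, u z ≤ w z) :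
    𝔰.lin i α w' w y ≤ 𝔰.lin i α u' u y := by
  have P1 := (𝔰.mesh i).P1
  have h1 := 𝔰.lin_nonneg hcons hdiff hstep α hy
    ((𝔰.mesh i).P1.add_mem hu' ((𝔰.mesh i).P1.smul_mem (-1) hw'))
    ((𝔰.mesh i).P1.add_mem hu ((𝔰.mesh i).P1.smul_mem (-1) hw)) (by simp [h0])
    (fun s hs hys z hz => by simpa using hn' s hs hys z hz)
    (fun s hs hys z hz => by simpa using hn s hs hys z hz)
  rw [𝔰.lin_add_smul α hu' hu hw' hw (-1) hy] at h1
  linarith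

theorem finite_vertices : (𝔰.mesh i).vertices.Finite := by
  rw [Geometry.SimplicialComplex.vertices_eq]
  exact (𝔰.isMesh i).1.biUnion fun s _ => s.finite_toSet

/-- Almost optimal controls suffice for all later purposes, so attainment of the supremum plays no
role. -/
theorem IsNumericalSolution.exists_lt_lin [Nonempty A] {𝔰 : Discretisation 𝔭} {v : ℕ → ℕ → E d → ℝ}
    (hv : 𝔰.IsNumericalSolution v) {k : ℕ} (hk : k < 𝔰.N i) {y : E d}
    (hy : y ∈ (𝔰.mesh i).vertices) {ε : ℝ} (hε : 0 < ε) :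
    ∃ α, 𝔰.rhs i α y - ε < 𝔰.lin i α (v i (k + 1)) (v i k) y := by
  have h4 := (hv i).2.2 k hk y hy
  obtain ⟨α, hα⟩ := exists_lt_of_lt_ciSup (b := 𝔰.timeDiff i (v i (k + 1)) (v i k) y - ε)
    (f := fun α => 𝔰.opE i α (v i (k + 1)) y + 𝔰.opI i α (v i k) y - 𝔰.rhs i α y) (by linarith)
  refine ⟨α, ?_⟩
  rw [lin]
  linarith

/-! ### Boundedness in the control -/

section Bounded

variable {A : Type*} [TopologicalSpace A] [CompactSpace A] {𝔭 : Problem d A}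
  (𝔰 : Discretisation 𝔭) {i : ℕ}

theorem interiorOp_bounded {a : A → E d → ℝ} {b : A → E d → E d} {c : A → E d → ℝ}
    (ha : SupNormContinuous 𝔭.P a) (hb : ∀ α, ContinuousOn (b α) 𝔭.P)
    (hb' : SupNormContinuous 𝔭.P b)
    (hc : ∀ α, ContinuousOn (c α) 𝔭.P) (hc' : SupNormContinuous 𝔭.P c) {w : E d → ℝ}
    (hw : w ∈ (𝔰.mesh i).P1) {y : E d} (hy : y ∈ (𝔰.mesh i).vertices) :
    ∃ C, ∀ α, |𝔰.interiorOp i (a α) (b α) (c α) w y| ≤ C := by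
  have hM := 𝔰.isMesh i
  obtain ⟨Ca, hCa⟩ := (isCompact_range (ha.continuous_apply (𝔰.vertex_mem hy))).isBounded.exists_norm_le
  obtain ⟨Cb, -, hCb⟩ := hb'.exists_bound Problem.isCompact_P hb
  obtain ⟨Cc, -, hCc⟩ := hc'.exists_bound Problem.isCompact_P hc
  refine ⟨Ca * |∫ x in 𝔭.Ω, ⟪gradient w x, gradient ((𝔰.mesh i).hat1 y) x⟫| +
    ∫ x in 𝔭.Ω, (Cb * ‖gradient w x‖ + Cc * |w x|) * (𝔰.mesh i).hat1 y x, fun α => ?_⟩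
  rw [interiorOp]
  refine (abs_add_le _ _).trans (add_le_add ?_ ?_)
  · rw [abs_mul]
    gcongr
    exact hCa _ (mem_range_self α)
  · have hpw : (𝔰.mesh i).IsPiecewiseCont
        (fun x => (Cb * ‖gradient w x‖ + Cc * |w x|) * (𝔰.mesh i).hat1 y x) := by
      intro s hs
      obtain ⟨g, hg, he⟩ := Mesh.IsPiecewiseCont.grad_P1 hw s hs
      obtain ⟨g2, hg2, he2⟩ := Mesh.IsPiecewiseCont.of_P1 hw s hs
      obtain ⟨g3, hg3, he3⟩ := Mesh.IsPiecewiseCont.of_P1 (Mesh.hat1_mem_P1 hM y) s hs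
      refine ⟨fun x => (Cb * ‖g x‖ + Cc * |g2 x|) * g3 x, by fun_prop, fun x hx => ?_⟩
      simp only
      rw [he hx, he2 hx, he3 hx]
    rw [← Real.norm_eq_abs]
    refine norm_integral_le_of_norm_le (hpw.integrableOn hM) ?_
    refine (ae_restrict_iff' isOpen_interior.measurableSet).2 (ae_of_all _ fun x hx => ?_)
    have hxP := interior_subset hx
    rw [norm_mul, Real.norm_eq_abs, Real.norm_eq_abs, abs_of_nonneg (Mesh.hat1_nonneg y x)]
    refine mul_le_mul_of_nonneg_right ?_ (Mesh.hat1_nonneg y x)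
    refine (abs_add_le _ _).trans (add_le_add ?_ ?_)
    · rw [abs_neg]
      exact (abs_real_inner_le_norm _ _).trans
        (mul_le_mul_of_nonneg_right (hCb α x hxP) (norm_nonneg _))
    · rw [abs_mul]
      exact mul_le_mul_of_nonneg_right (hCc α x hxP) (abs_nonneg _)

theorem robinOp_bounded {b : A → E d → E d} {c : A → E d → ℝ}
    (hb : SupNormContinuous (frontier 𝔭.P) b) (hc : SupNormContinuous (frontier 𝔭.P) c)
    {w : E d → ℝ} (hw : w ∈ (𝔰.mesh i).P1) {y : E d} (hy : y ∈ frontier 𝔭.P)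
    (hcone : ∀ α, b α y ∈ tangentCone 𝔭.P y) : ∃ C, ∀ α, |robinOp (b α) (c α) w y| ≤ C := by
  obtain ⟨Cb, hCb⟩ := (isCompact_range (hb.continuous_apply hy)).isBounded.exists_norm_le
  obtain ⟨Cc, hCc⟩ := (isCompact_range (hc.continuous_apply hy)).isBounded.exists_norm_le
  obtain ⟨G, hG0, hG⟩ := Mesh.exists_lowerDini_bound (𝔰.isMesh i) hw
  refine ⟨G * Cb + Cc * |w y|, fun α => ?_⟩
  refine (abs_add_le _ _).trans (add_le_add ((hG y _ (hcone α)).trans ?_) ?_)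
  · gcongr; exact hCb _ (mem_range_self α)
  · rw [abs_mul]; gcongr; exact hCc _ (mem_range_self α)

theorem opE_bounded (hcons : 𝔰.IsConsistent) {w : E d → ℝ} (hw : w ∈ (𝔰.mesh i).P1) {y : E d}
    (hy : y ∈ (𝔰.mesh i).vertices) : ∃ C, ∀ α, |𝔰.opE i α w y| ≤ C := by
  have hrob : y ∈ 𝔭.bdt ∪ 𝔭.bdR → ∃ C, ∀ α, |𝔰.opE i α w y| ≤ C := fun h => by
    simp only [𝔰.opE_robin _ _ h]
    have h' := Problem.robin_subset h
    exact 𝔰.robinOp_bounded (hcons.bBE_ctrl i) (hcons.cBE_ctrl i) hw h'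
      fun α => 𝔰.bBE_cone i α y h'
  rcases Problem.mem_cases (𝔰.vertex_mem hy) with h | h | h | h
  · simp only [𝔰.opE_interior _ _ h]
    exact 𝔰.interiorOp_bounded (hcons.aE_ctrl i) (𝔰.bE_cont i) (hcons.bE_ctrl i)
      (𝔰.cE_cont i) (hcons.cE_ctrl i) hw hy
  · exact hrob (Or.inl h)
  · exact hrob (Or.inr h)
  · exact ⟨0, fun α => by rw [𝔰.opE_dirichlet α _ h, abs_zero]⟩

theorem opI_bounded (hcons : 𝔰.IsConsistent) {w : E d → ℝ} (hw : w ∈ (𝔰.mesh i).P1) {y : E d}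
    (hy : y ∈ (𝔰.mesh i).vertices) : ∃ C, ∀ α, |𝔰.opI i α w y| ≤ C := by
  have hrob : y ∈ 𝔭.bdt ∪ 𝔭.bdR → ∃ C, ∀ α, |𝔰.opI i α w y| ≤ C := fun h => by
    simp only [𝔰.opI_robin _ _ h]
    have h' := Problem.robin_subset h
    exact 𝔰.robinOp_bounded (hcons.bBI_ctrl i) (hcons.cBI_ctrl i) hw h'
      fun α => 𝔰.bBI_cone i α y h'
  rcases Problem.mem_cases (𝔰.vertex_mem hy) with h | h | h | h
  · simp only [𝔰.opI_interior _ _ h]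
    exact 𝔰.interiorOp_bounded (hcons.aI_ctrl i) (𝔰.bI_cont i) (hcons.bI_ctrl i)
      (𝔰.cI_cont i) (hcons.cI_ctrl i) hw hy
  · exact hrob (Or.inl h)
  · exact hrob (Or.inr h)
  · exact ⟨|w y|, fun α => by rw [𝔰.opI_dirichlet α _ h]⟩

/-- Without boundedness the real supremum in the scheme would take its default value and say nothing
about individual controls. -/
theorem bddAbove_scheme (hcons : 𝔰.IsConsistent) {w' w : E d → ℝ} (hw' : w' ∈ (𝔰.mesh i).P1)
    (hw : w ∈ (𝔰.mesh i).P1) {y : E d} (hy : y ∈ (𝔰.mesh i).vertices) :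
    BddAbove (range fun α => 𝔰.opE i α w' y + 𝔰.opI i α w y - 𝔰.rhs i α y) := by
  obtain ⟨C, hC⟩ := 𝔰.opE_bounded hcons hw' hy
  obtain ⟨C', hC'⟩ := 𝔰.opI_bounded hcons hw hy
  refine ⟨C + C', ?_⟩
  rintro _ ⟨α, rfl⟩
  have h1 := (le_abs_self _).trans (hC α)
  have h2 := (le_abs_self _).trans (hC' α)
  have h3 := 𝔰.rhs_nonneg α hy
  linarith

/-! ### Numerical solutions -/

variable {v : ℕ → ℕ → E d → ℝ}

theorem IsNumericalSolution.lin_le {𝔰 : Discretisation 𝔭} (hv : 𝔰.IsNumericalSolution v)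
    (hcons : 𝔰.IsConsistent) {k : ℕ} (hk : k < 𝔰.N i) {y : E d} (hy : y ∈ (𝔰.mesh i).vertices)
    (α : A) : 𝔰.lin i α (v i (k + 1)) (v i k) y ≤ 𝔰.rhs i α y := by
  obtain ⟨h1, -, h2⟩ := hv i
  have h3 := le_ciSup (𝔰.bddAbove_scheme hcons (h1 (k + 1) hk) (h1 k hk.le) hy) α
  have h4 := h2 k hk y hy
  rw [lin]
  linarith

/-- Numerical solutions are nonnegative. -/
theorem IsNumericalSolution.nonneg [Nonempty A] {𝔰 : Discretisation 𝔭}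
    (hv : 𝔰.IsNumericalSolution v) (hcons : 𝔰.IsConsistent) (hdiff : 𝔰.HasArtificialDiffusion)
    (hstep : 𝔰.TimeStepRestriction) {k : ℕ} (hk : k ≤ 𝔰.N i) :
    ∀ y ∈ (𝔰.mesh i).vertices, 0 ≤ v i k y := by
  induction hk using Nat.decreasingInduction with
  | self =>
    intro y hy
    rw [(hv i).2.1 y hy]
    exact 𝔭.vT_nonneg y (𝔰.vertex_mem hy)
  | of_succ k hk ih =>
    intro z hz
    -- Discrete minimum principle: at a negative minimum the solution is compared with the pair that
    -- is zero at the next time level and constantly `m` at the current one.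
    obtain ⟨y, hy, hmin⟩ := 𝔰.finite_vertices.exists_minimalFor (v i k) _ ⟨z, hz⟩
    have hmin' : ∀ x ∈ (𝔰.mesh i).vertices, v i k y ≤ v i k x := fun x hx => by
      by_contra hcon
      exact hcon (hmin hx (not_le.1 hcon).le)
    refine le_trans ?_ (hmin' z hz)
    by_contra! hneg
    set m := v i k y with hm
    have hP1 := (hv i).1
    have key : ∀ α, 𝔰.lin i α (v i (k + 1)) (v i k) y ≤ m * 𝔰.lin i α 0 (one 𝔭) y := by
      intro α
      have h1 := 𝔰.lin_mono hcons hdiff hstep α hy (𝔰.mesh i).P1.zero_mem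
        ((𝔰.mesh i).P1.add_mem (𝔰.mesh i).P1.zero_mem ((𝔰.mesh i).P1.smul_mem m 𝔰.one_mem))
        (hP1 (k + 1) hk) (hP1 k hk.le) (by simp [one_apply (𝔰.vertex_mem hy), hm])
        (fun s hs hys z hz => ih z (Mesh.mem_vertices_of_mem hs.1 hz))
        (fun s hs hys z hz => by
          have hz' := Mesh.mem_vertices_of_mem hs.1 hz
          simpa [one_apply (𝔰.vertex_mem hz')] using hmin' z hz')
      have h2 := 𝔰.lin_add_smul α (𝔰.mesh i).P1.zero_mem (𝔰.mesh i).P1.zero_mem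
        (𝔰.mesh i).P1.zero_mem 𝔰.one_mem m hy
      have h3 := 𝔰.lin_add_smul α (𝔰.mesh i).P1.zero_mem (𝔰.mesh i).P1.zero_mem
        (𝔰.mesh i).P1.zero_mem (𝔰.mesh i).P1.zero_mem 1 hy
      simp only [smul_zero, add_zero] at h1 h2 h3
      linarith
    -- The lower bound has to be uniform in the control, because the almost optimal control is only
    -- chosen once the tolerance `-m * γ` is known. On `bdR` compactness of `A` is needed for this.
    obtain ⟨γ, hγ, hlin⟩ : ∃ γ > 0, ∀ α, γ ≤ 𝔰.lin i α 0 (one 𝔭) y := by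
      have hE : ∀ α, 𝔰.opE i α 0 y = 0 := fun α => by
        have := 𝔰.opE_add_smul α (𝔰.mesh i).P1.zero_mem (𝔰.mesh i).P1.zero_mem 1 hy
        simp only [smul_zero, add_zero] at this
        linarith
      have hyt : y ∈ 𝔭.Ω ∪ 𝔭.bdt → ∃ γ > 0, ∀ α, γ ≤ 𝔰.lin i α 0 (one 𝔭) y := fun h => by
        refine ⟨1 / 𝔰.h i, one_div_pos.2 (𝔰.h_pos i), fun α => ?_⟩
        rw [lin, hE, 𝔰.timeDiff_pos _ _ h, one_apply (𝔰.vertex_mem hy)]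
        have := 𝔰.opI_one_nonneg α hy
        simp only [Pi.zero_apply, zero_sub, neg_div, neg_neg]
        linarith
      rcases Problem.mem_cases (𝔰.vertex_mem hy) with h | h | h | h
      · exact hyt (Or.inl h)
      · exact hyt (Or.inr h)
      · have h' := Problem.bdR_subset h
        obtain ⟨β, -, hβ⟩ := isCompact_univ.exists_isMinOn univ_nonempty
          ((hcons.cBI_ctrl i).continuous_apply h').continuousOn
        refine ⟨𝔰.cBI i β y, (hcons.implicit_bdR i β y h).2.2, fun α => ?_⟩
        rw [lin, hE, 𝔰.timeDiff_bdR _ _ h, 𝔰.opI_robin _ _ (Or.inr h),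
          𝔰.robinOp_one _ (𝔰.vertex_mem hy) (𝔰.bBI_cone i α y h'), neg_zero, zero_add, zero_add]
        exact hβ (mem_univ α)
      · refine ⟨1, one_pos, fun α => ?_⟩
        rw [lin, hE, 𝔰.timeDiff_bdD _ _ h, 𝔰.opI_dirichlet _ _ h, one_apply (𝔰.vertex_mem hy)]
        simp
    obtain ⟨α, hα⟩ := hv.exists_lt_lin hk hy (ε := -m * γ) (by nlinarith)
    have h1 := key α
    have h2 := hlin α
    have h3 := 𝔰.rhs_nonneg α hy
    nlinarith

end Bounded

end Discretisation

end HJBFEM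

/-! ### Elliptic projections of quadratics as discrete test functions -/

namespace HJBFEM

/-- An almost everywhere bound for a continuous function holds everywhere. -/
theorem le_on_closure_of_ae_le {d : ℕ} {U : Set (E d)} (hU : IsOpen U) {f : E d → ℝ} {C : ℝ}
    (hf : ContinuousOn f (closure U)) (h : ∀ᵐ x ∂(volume.restrict U), f x ≤ C) :
    ∀ x ∈ closure U, f x ≤ C := by
  have h1 : ∀ x ∈ U, f x ≤ C := by
    intro x hx
    by_contra hcon
    have hopen : IsOpen (U ∩ f ⁻¹' Ioi C) := (hf.mono subset_closure).isOpen_inter_preimage hU isOpen_Ioi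
    have hpos := hopen.measure_pos volume ⟨x, hx, not_le.1 hcon⟩
    rw [ae_restrict_iff' hU.measurableSet] at h
    refine hpos.ne' (measure_mono_null ?_ h)
    rintro z ⟨hz, hzC⟩ hz'
    exact not_lt.2 (hz' hz) hzC
  exact fun x hx => le_on_closure h1 hf continuousOn_const hx

variable {d : ℕ} {A : Type*} [TopologicalSpace A] {𝔭 : Problem d A}

theorem Problem.closure_Ω_subset : closure 𝔭.Ω ⊆ 𝔭.P :=
  closure_minimal interior_subset isCompact_P.isClosed

namespace Discretisation

variable (𝔰 : Discretisation 𝔭) {i : ℕ}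

theorem closure_Ω (𝔰 : Discretisation 𝔭) : closure 𝔭.Ω = 𝔭.P :=
  Subset.antisymm Problem.closure_Ω_subset (Mesh.subset_closure_interior (𝔰.isMesh 0))

/-- The properties of the elliptic projections that the convergence proof uses. -/
structure IsProjection (Pr : ∀ i, smoothFunctions d →ₗ[ℝ] (𝔰.mesh i).P1) : Prop where
  galerkin : ∀ i w, ∀ y ∈ (𝔰.mesh i).vertices, y ∈ 𝔭.Ω →
      ∫ x in 𝔭.Ω, ⟪gradient (Pr i w : E d → ℝ) x, gradient ((𝔰.mesh i).hat1 y) x⟫ =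
        ∫ x in 𝔭.Ω, ⟪gradient (w : E d → ℝ) x, gradient ((𝔰.mesh i).hat1 y) x⟫
  tendsto : ∀ w, Tendsto (fun i => w1inftyNorm 𝔭.Ω ((Pr i w : E d → ℝ) - (w : E d → ℝ))) atTop (𝓝 0)

namespace IsProjection

variable {𝔰} {Pr : ∀ i, smoothFunctions d →ₗ[ℝ] (𝔰.mesh i).P1}

/-- The `W^{1,∞}` norm only sees almost every point of the open domain. Continuity up to the
boundary, on the whole domain for values and on each closed element for gradients, makes the bounds
pointwise, so that they can be used at boundary nodes. -/
theorem eventually_close (hPr : 𝔰.IsProjection Pr) (e : Quad d) {ε : ℝ} (hε : 0 < ε) :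
    ∀ᶠ i in atTop, (∀ x ∈ 𝔭.P, |(Pr i e.smooth : E d → ℝ) x - e.fn x| ≤ ε) ∧
      ∀ s ∈ (𝔰.mesh i).elements, ∃ g c,
        (∀ x ∈ convexHull ℝ (s : Set (E d)), (Pr i e.smooth : E d → ℝ) x = ⟪g, x⟫ + c) ∧
        (∀ x ∈ interior (convexHull ℝ (s : Set (E d))),
          gradient (Pr i e.smooth : E d → ℝ) x = g) ∧
        ∀ x ∈ convexHull ℝ (s : Set (E d)), ‖g - e.grad x‖ ≤ ε := by
  have h1 := (hPr.tendsto e.smooth).eventually (gt_mem_nhds (ENNReal.ofReal_pos.2 hε))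
  filter_upwards [h1] with i hi
  have hM := 𝔰.isMesh i
  set w : E d → ℝ := (Pr i e.smooth : E d → ℝ) with hw
  have hwP : w ∈ (𝔰.mesh i).P1 := (Pr i e.smooth).2
  rw [w1inftyNorm, eLpNorm_exponent_top, eLpNorm_exponent_top] at hi
  have hi1 := (le_self_add).trans hi.le
  have hi2 := (le_add_self).trans hi.le
  constructor
  · have hc : ContinuousOn (fun x => |w x - e.fn x|) 𝔭.P :=
      ((Mesh.P1_continuousOn hM hwP).sub e.continuous_fn.continuousOn).abs
    have := le_on_closure_of_ae_le (U := 𝔭.Ω) (C := ε) isOpen_interior (f := fun x => |w x - e.fn x|)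
      (by rwa [𝔰.closure_Ω]) ?_
    · rwa [𝔰.closure_Ω] at this
    · filter_upwards [ae_le_eLpNormEssSup (f := w - (e.smooth : E d → ℝ))
        (μ := volume.restrict 𝔭.Ω)] with x hx
      have := hx.trans hi1
      rw [Pi.sub_apply, ← ofReal_norm, ENNReal.ofReal_le_ofReal_iff hε.le] at this
      exact this
  · intro s hs
    obtain ⟨g, c, hgc, hg⟩ := Mesh.exists_grad hwP hs
    refine ⟨g, c, hgc, fun x hx => (hg x hx).gradient, ?_⟩
    have hc : Continuous (fun x => ‖g - e.grad x‖) := (continuous_const.sub e.continuous_grad).norm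
    have := le_on_closure_of_ae_le (U := interior (convexHull ℝ (s : Set (E d)))) (C := ε)
      isOpen_interior (f := fun x => ‖g - e.grad x‖) hc.continuousOn ?_
    · rwa [Mesh.closure_interior_element hs] at this
    · have h2 := ae_restrict_of_ae_restrict_of_subset (Mesh.interior_element_subset hM hs)
        (ae_le_eLpNormEssSup (f := gradient (w - (e.smooth : E d → ℝ)))
          (μ := volume.restrict 𝔭.Ω))
      filter_upwards [h2, ae_restrict_mem isOpen_interior.measurableSet] with x hx hxs
      have h3 := hx.trans hi2
      rw [← ofReal_norm, ENNReal.ofReal_le_ofReal_iff hε.le] at h3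
      have h4 := (hasGradientAt_iff_hasFDerivAt.1 (hg x hxs)).sub
        (hasGradientAt_iff_hasFDerivAt.1 (e.hasGradientAt x))
      rw [← map_sub] at h4
      change ‖gradient (w - e.fn) x‖ ≤ ε at h3
      rwa [(hasGradientAt_iff_hasFDerivAt.2 h4).gradient] at h3

end IsProjection

section TestFunctions

variable {𝔰} {Pr : ∀ i, smoothFunctions d →ₗ[ℝ] (𝔰.mesh i).P1}

/-- The discrete test function: the elliptic projection of a quadratic function plus a constant. -/
noncomputable def testFn
    (Pr : ∀ i, smoothFunctions d →ₗ[ℝ] (𝔰.mesh i).P1) (e : Quad d) (i : ℕ) (σ : ℝ) : E d → ℝ :=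
  (Pr i e.smooth : E d → ℝ) + σ • one 𝔭

theorem testFn_mem (e : Quad d) (i : ℕ) (σ : ℝ) :
    testFn Pr e i σ ∈ (𝔰.mesh i).P1 :=
  (𝔰.mesh i).P1.add_mem (Pr i e.smooth).2 ((𝔰.mesh i).P1.smul_mem σ 𝔰.one_mem)

theorem testFn_apply (e : Quad d) (i : ℕ) (σ : ℝ) {x : E d}
    (hx : x ∈ 𝔭.P) : testFn Pr e i σ x = (Pr i e.smooth : E d → ℝ) x + σ := by
  simp [testFn, one_apply hx]

theorem testFn_add (e : Quad d) (i : ℕ) (σ m : ℝ) :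
    testFn Pr e i (σ + m) = testFn Pr e i σ + m • one 𝔭 := by
  simp [testFn, add_smul, add_assoc]

end TestFunctions

namespace IsProjection

variable {𝔰} {Pr : ∀ i, smoothFunctions d →ₗ[ℝ] (𝔰.mesh i).P1}

/-- The second order part of the scheme reproduces the Laplacian exactly. -/
theorem integral_testFn (hPr : 𝔰.IsProjection Pr) (e : Quad d) (σ : ℝ) {y : E d}
    (hy : y ∈ (𝔰.mesh i).vertices) (hyi : y ∈ 𝔭.Ω) :
    ∫ x in 𝔭.Ω, ⟪gradient (testFn Pr e i σ) x, gradient ((𝔰.mesh i).hat1 y) x⟫ = -e.lap := by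
  have h1 : ∫ x in 𝔭.Ω, ⟪gradient (testFn Pr e i σ) x, gradient ((𝔰.mesh i).hat1 y) x⟫ =
      ∫ x in 𝔭.Ω, ⟪gradient (Pr i e.smooth : E d → ℝ) x, gradient ((𝔰.mesh i).hat1 y) x⟫ := by
    refine integral_congr_ae ?_
    filter_upwards [𝔰.ae_gradient_add_smul (Pr i e.smooth).2 𝔰.one_mem σ,
      ae_restrict_mem isOpen_interior.measurableSet] with x hx hxΩ
    rw [testFn, hx, gradient_one hxΩ, smul_zero, add_zero]
  rw [h1, hPr.galerkin i e.smooth y hy hyi]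
  exact Mesh.integral_quad_grad_hat1 (𝔰.isMesh i) hy hyi e

end IsProjection

/-! ### Consistency -/

/-- Error budget for one integration point: `bx`, `cx`, `fx`, `gx`, `ex` are values at that point,
while `b`, `c`, `f`, `gy`, `ey` belong to the node; `g` and `p` stem from the projection. The
difference telescopes into products with one factor of size `ε` each, coming from coefficient
consistency, oscillation over an element, projection error or the time increment. -/
theorem interior_estimate {bE bI bx b g gx gy : E d} {cE cI cx c p ex ey σ σ' fi fx f ε Cb Cg Cc Ce M : ℝ}
    (hε : 0 ≤ ε) (hε1 : ε ≤ 1) (hcE : 0 ≤ cE) (hcI : 0 ≤ cI)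
    (h1 : ‖bx - (bE + bI)‖ ≤ ε) (h2 : ‖bx - b‖ ≤ ε) (h3 : ‖g - gx‖ ≤ ε) (h4 : ‖gx - gy‖ ≤ ε)
    (h5 : |cx - (cE + cI)| ≤ ε) (h6 : |cx - c| ≤ ε) (h7 : |p - ex| ≤ ε) (h8 : |ex - ey| ≤ ε)
    (h9 : |σ' - σ| ≤ ε) (h10 : |fx - fi| ≤ ε) (h11 : |fx - f| ≤ ε)
    (hCb : ‖b‖ ≤ Cb) (hCg : ‖gx‖ ≤ Cg) (hCc : |cx| ≤ Cc) (hCc' : |c| ≤ Cc) (hCe : |ex| ≤ Ce)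
    (hM : |σ| ≤ M) :
    |(-⟪bE, g⟫ + cE * (p + σ')) + (-⟪bI, g⟫ + cI * (p + σ)) - fi - (-⟪b, gy⟫ + c * (ey + σ) - f)| ≤
      (2 * (Cg + 1) + 2 * Cb + 2 * (Ce + 1 + M) + 2 * Cc + (Cc + 1) + 2) * ε := by
  have hg : ‖g‖ ≤ Cg + 1 := by
    have := norm_le_norm_add_norm_sub' g gx
    linarith
  have hp : |p + σ| ≤ Ce + 1 + M := by
    have e1 : p + σ = ex + (p - ex) + σ := by ring
    rw [e1]
    refine (abs_add_three _ _ _).trans ?_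
    linarith
  -- Both parts of the split coefficient are nonnegative, so a bound on their sum bounds each of
  -- them.
  have hcE' : |cE| ≤ Cc + 1 := by
    rw [abs_of_nonneg hcE]
    linarith [abs_le.1 h5, abs_le.1 hCc]
  have key : (-⟪bE, g⟫ + cE * (p + σ')) + (-⟪bI, g⟫ + cI * (p + σ)) - fi -
      (-⟪b, gy⟫ + c * (ey + σ) - f) = ⟪bx - (bE + bI), g⟫ - ⟪bx - b, g⟫ - ⟪b, g - gx⟫ -
        ⟪b, gx - gy⟫ - (cx - (cE + cI)) * (p + σ) + (cx - c) * (p + σ) + c * (p - ex) +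
        c * (ex - ey) + cE * (σ' - σ) + (fx - fi) - (fx - f) := by
    simp only [inner_sub_left, inner_sub_right, inner_add_left]
    ring
  rw [key]
  have n1 : |⟪bx - (bE + bI), g⟫| ≤ ε * (Cg + 1) :=
    (abs_real_inner_le_norm _ _).trans (mul_le_mul h1 hg (norm_nonneg _) hε)
  have n2 : |⟪bx - b, g⟫| ≤ ε * (Cg + 1) :=
    (abs_real_inner_le_norm _ _).trans (mul_le_mul h2 hg (norm_nonneg _) hε)
  have n3 : |⟪b, g - gx⟫| ≤ Cb * ε :=
    (abs_real_inner_le_norm _ _).trans (mul_le_mul hCb h3 (norm_nonneg _) ((norm_nonneg _).trans hCb))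
  have n4 : |⟪b, gx - gy⟫| ≤ Cb * ε :=
    (abs_real_inner_le_norm _ _).trans (mul_le_mul hCb h4 (norm_nonneg _) ((norm_nonneg _).trans hCb))
  have n5 : |(cx - (cE + cI)) * (p + σ)| ≤ ε * (Ce + 1 + M) := by
    rw [abs_mul]; exact mul_le_mul h5 hp (abs_nonneg _) hε
  have n6 : |(cx - c) * (p + σ)| ≤ ε * (Ce + 1 + M) := by
    rw [abs_mul]; exact mul_le_mul h6 hp (abs_nonneg _) hε
  have n7 : |c * (p - ex)| ≤ Cc * ε := by
    rw [abs_mul]; exact mul_le_mul hCc' h7 (abs_nonneg _) ((abs_nonneg _).trans hCc)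
  have n8 : |c * (ex - ey)| ≤ Cc * ε := by
    rw [abs_mul]; exact mul_le_mul hCc' h8 (abs_nonneg _) ((abs_nonneg _).trans hCc)
  have n9 : |cE * (σ' - σ)| ≤ (Cc + 1) * ε := by
    rw [abs_mul]; exact mul_le_mul hcE' h9 (abs_nonneg _) ((abs_nonneg _).trans hcE')
  rw [abs_le] at *
  constructor <;> linarith

/-- Explicit and implicit drifts may point into different elements, hence two discrete gradients
`gE` and `gI`. For this reason the split drifts have to be bounded individually and not only in
their sum. -/
theorem robin_estimate {bE bI b gE gI gy : E d} {cE cI c p ey σ σ' gi g ε Cb Cg Cc Ce M : ℝ}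
    (hε : 0 ≤ ε) (hε1 : ε ≤ 1) (hcE : 0 ≤ cE) (hcI : 0 ≤ cI)
    (h1 : ‖b - (bE + bI)‖ ≤ ε) (h3 : ‖gE - gy‖ ≤ ε) (h4 : ‖gI - gy‖ ≤ ε)
    (h5 : |c - (cE + cI)| ≤ ε) (h7 : |p - ey| ≤ ε)
    (h9 : |σ' - σ| ≤ ε) (h10 : |g - gi| ≤ ε) (hCE : ‖bE‖ ≤ Cb) (hCI : ‖bI‖ ≤ Cb)
    (hCg : ‖gy‖ ≤ Cg) (hCc : |c| ≤ Cc) (hCe : |ey| ≤ Ce) (hM : |σ| ≤ M) :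
    |(-⟪gE, bE⟫ + cE * (p + σ')) + (-⟪gI, bI⟫ + cI * (p + σ)) - gi - (-⟪b, gy⟫ + c * (ey + σ) - g)| ≤
      (2 * Cb + Cg + (Ce + 1 + M) + Cc + (Cc + 1) + 1) * ε := by
  have hp : |p + σ| ≤ Ce + 1 + M := by
    have e1 : p + σ = ey + (p - ey) + σ := by ring
    rw [e1]
    refine (abs_add_three _ _ _).trans ?_
    linarith
  have hcE' : |cE| ≤ Cc + 1 := by
    rw [abs_of_nonneg hcE]
    linarith [abs_le.1 h5, abs_le.1 hCc]
  have key : (-⟪gE, bE⟫ + cE * (p + σ')) + (-⟪gI, bI⟫ + cI * (p + σ)) - gi -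
      (-⟪b, gy⟫ + c * (ey + σ) - g) = ⟪b - (bE + bI), gy⟫ - ⟪bE, gE - gy⟫ - ⟪bI, gI - gy⟫
        - (c - (cE + cI)) * (p + σ) + c * (p - ey) + cE * (σ' - σ) + (g - gi) := by
    simp only [inner_sub_left, inner_sub_right, inner_add_left, real_inner_comm]
    ring
  rw [key]
  have n1 : |⟪b - (bE + bI), gy⟫| ≤ ε * Cg :=
    (abs_real_inner_le_norm _ _).trans (mul_le_mul h1 hCg (norm_nonneg _) hε)
  have n3 : |⟪bE, gE - gy⟫| ≤ Cb * ε :=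
    (abs_real_inner_le_norm _ _).trans (mul_le_mul hCE h3 (norm_nonneg _) ((norm_nonneg _).trans hCE))
  have n4 : |⟪bI, gI - gy⟫| ≤ Cb * ε :=
    (abs_real_inner_le_norm _ _).trans (mul_le_mul hCI h4 (norm_nonneg _) ((norm_nonneg _).trans hCI))
  have n5 : |(c - (cE + cI)) * (p + σ)| ≤ ε * (Ce + 1 + M) := by
    rw [abs_mul]; exact mul_le_mul h5 hp (abs_nonneg _) hε
  have n7 : |c * (p - ey)| ≤ Cc * ε := by
    rw [abs_mul]; exact mul_le_mul hCc h7 (abs_nonneg _) ((abs_nonneg _).trans hCc)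
  have n9 : |cE * (σ' - σ)| ≤ (Cc + 1) * ε := by
    rw [abs_mul]; exact mul_le_mul hcE' h9 (abs_nonneg _) ((abs_nonneg _).trans hcE')
  rw [abs_le] at *
  constructor <;> linarith

/-- Points of an element are close to its vertices. -/
theorem dist_le_size {s : Finset (E d)} (hs : s ∈ (𝔰.mesh i).elements) {x y : E d}
    (hx : x ∈ convexHull ℝ (s : Set (E d))) (hy : y ∈ convexHull ℝ (s : Set (E d))) :
    dist x y ≤ (𝔰.mesh i).size := by
  refine (Metric.dist_le_diam_of_mem (s.finite_toSet.isCompact_convexHull ℝ).isBounded hx hy).trans ?_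
  exact le_csSup ((Mesh.elements_finite (𝔰.isMesh i)).image _).bddAbove (mem_image_of_mem _ hs)

theorem ae_mem_element (i : ℕ) : ∀ᵐ x ∂(volume.restrict 𝔭.Ω),
    ∃ s ∈ (𝔰.mesh i).elements, x ∈ interior (convexHull ℝ (s : Set (E d))) := by
  have h := 𝔰.isMesh i
  change ∀ᵐ x ∂(volume.restrict (interior 𝔭.P)), _
  rw [Measure.restrict_congr_set (Mesh.interior_ae_eq h),
    ae_restrict_iff' ((Mesh.elts h).measurableSet_biUnion
      fun s _ => isOpen_interior.measurableSet)]
  refine ae_of_all _ fun x hx => ?_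
  obtain ⟨s, hs, hxs⟩ := mem_iUnion₂.1 hx
  exact ⟨s, (Mesh.mem_elts h).1 hs, hxs⟩

theorem integrableOn_Ω {f : E d → ℝ} (hf : (𝔰.mesh i).IsPiecewiseCont f) :
    IntegrableOn f 𝔭.Ω := hf.integrableOn (𝔰.isMesh i)

theorem testFn_gradient {Pr : ∀ i, smoothFunctions d →ₗ[ℝ] (𝔰.mesh i).P1} (e : Quad d) (σ : ℝ) :
    ∀ᵐ x ∂(volume.restrict 𝔭.Ω),
      gradient (testFn Pr e i σ) x = gradient (Pr i e.smooth : E d → ℝ) x := by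
  filter_upwards [𝔰.ae_gradient_add_smul (Pr i e.smooth).2 𝔰.one_mem σ,
      ae_restrict_mem isOpen_interior.measurableSet] with x hx hxΩ
  rw [testFn, hx, gradient_one hxΩ, smul_zero, add_zero]

/-- The projection reproduces `-e.lap` exactly, so the second order error is only the coefficient
error times the Laplacian. The remaining error is an average with weight `hat1` over elements
adjacent to `y`, where equicontinuity replaces values at `x` by values at `y`. -/
theorem consistency_interior {A : Type*} [TopologicalSpace A] [CompactSpace A] {𝔭 : Problem d A}
    {𝔰 : Discretisation 𝔭} (hcons : 𝔰.IsConsistent)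
    {Pr : ∀ i, smoothFunctions d →ₗ[ℝ] (𝔰.mesh i).P1} (hPr : 𝔰.IsProjection Pr) (e : Quad d)
    (M : ℝ) {ε : ℝ} (hε : 0 < ε) : ∃ η > 0, ∀ᶠ i in atTop, ∀ α, ∀ y ∈ (𝔰.mesh i).vertices,
      y ∈ 𝔭.Ω → ∀ σ σ', |σ| ≤ M → |σ' - σ| ≤ η →
      |𝔰.opE i α (testFn Pr e i σ') y + 𝔰.opI i α (testFn Pr e i σ) y - 𝔰.rhs i α y -
        (𝔭.L α y e.lap (e.grad y) (e.fn y + σ) - 𝔭.f α y)| ≤ ε := by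
  have hPc := Problem.isCompact_P (𝔭 := 𝔭)
  obtain ⟨Cb, hCb0, hCb⟩ := 𝔭.b_ctrl.exists_bound hPc 𝔭.b_cont
  obtain ⟨Cc, hCc0, hCc⟩ := 𝔭.c_ctrl.exists_bound hPc 𝔭.c_cont
  obtain ⟨Cg, hCg⟩ := hPc.exists_bound_of_continuousOn e.continuous_grad.continuousOn
  obtain ⟨Ce, hCe⟩ := hPc.exists_bound_of_continuousOn e.continuous_fn.continuousOn
  set K := 2 * (|Cg| + 1) + 2 * Cb + 2 * (|Ce| + 1 + |M|) + 2 * Cc + (Cc + 1) + 2 with hK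
  have hK0 : 0 < K := by positivity
  -- One tolerance for all error sources: `K` is the constant of `interior_estimate`, and `|e.lap|`
  -- weights the error of the diffusion coefficient.
  set η := min 1 (ε / (K + |e.lap|)) with hη
  have hη0 : 0 < η := lt_min one_pos (by positivity)
  have hη1 : η ≤ 1 := min_le_left _ _
  have hηε : K * η + |e.lap| * η ≤ ε := by
    have : η ≤ ε / (K + |e.lap|) := min_le_right _ _
    rw [le_div_iff₀ (by positivity)] at this
    linarith
  obtain ⟨δ₁, hδ₁, hb⟩ := 𝔭.b_ctrl.equicontinuous hPc 𝔭.b_cont hη0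
  obtain ⟨δ₂, hδ₂, hc⟩ := 𝔭.c_ctrl.equicontinuous hPc 𝔭.c_cont hη0
  obtain ⟨δ₃, hδ₃, hf⟩ := 𝔭.f_ctrl.equicontinuous hPc 𝔭.f_cont hη0
  obtain ⟨δ₄, hδ₄, hgr⟩ := Metric.uniformContinuousOn_iff.1
    (hPc.uniformContinuousOn_of_continuous e.continuous_grad.continuousOn) η hη0
  obtain ⟨δ₅, hδ₅, hfn⟩ := Metric.uniformContinuousOn_iff.1
    (hPc.uniformContinuousOn_of_continuous e.continuous_fn.continuousOn) η hη0
  refine ⟨η, hη0, ?_⟩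
  filter_upwards [hPr.eventually_close e hη0, hcons.interior_lower η hη0,
    hcons.interior_diffusion η hη0, 𝔰.size_tendsto.eventually (gt_mem_nhds hδ₁),
    𝔰.size_tendsto.eventually (gt_mem_nhds hδ₂), 𝔰.size_tendsto.eventually (gt_mem_nhds hδ₃),
    𝔰.size_tendsto.eventually (gt_mem_nhds hδ₄), 𝔰.size_tendsto.eventually (gt_mem_nhds hδ₅)]
    with i ⟨hi1, hi2⟩ hi3 hi4 hs1 hs2 hs3 hs4 hs5
  intro α y hy hyi σ σ' hσ hσ'
  have hM := 𝔰.isMesh i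
  have hyP := 𝔰.vertex_mem hy
  rw [𝔰.opE_interior _ _ hyi, 𝔰.opI_interior _ _ hyi, 𝔰.rhs_interior _ hyi, interiorOp, interiorOp,
    hPr.integral_testFn e σ hy hyi, hPr.integral_testFn e σ' hy hyi, Problem.L]
  set T := -⟪𝔭.b α y, e.grad y⟫ + 𝔭.c α y * (e.fn y + σ) - 𝔭.f α y with hT
  have hdif : |𝔭.a α y - (𝔰.aE i α y + 𝔰.aI i α y)| ≤ η :=
    hi4 α y hy (fun h => Problem.bdD_notMem h hyi) y (subset_tsupport _ (by
      rw [Function.mem_support, Mesh.hat_self hy]; exact one_ne_zero))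
  have iE := 𝔰.integrableOn_Ω (𝔰.isPiecewiseCont_lower (𝔰.bE_cont i α) (𝔰.cE_cont i α)
    (testFn_mem (Pr := Pr) e i σ') y)
  have iI := 𝔰.integrableOn_Ω (𝔰.isPiecewiseCont_lower (𝔰.bI_cont i α) (𝔰.cI_cont i α)
    (testFn_mem (Pr := Pr) e i σ) y)
  have ihat := 𝔰.integrableOn_Ω (Mesh.IsPiecewiseCont.of_P1 (Mesh.hat1_mem_P1 hM y))
  have iF := 𝔰.integrableOn_Ω ((Mesh.IsPiecewiseCont.of_continuousOn hM (𝔰.f_cont i α)).mul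
    (Mesh.IsPiecewiseCont.of_P1 (Mesh.hat1_mem_P1 hM y)))
  have hone : ∫ x in 𝔭.Ω, (𝔰.mesh i).hat1 y x = 1 := Mesh.integral_hat1 hM hy
  -- Since `hat1` has mass one, the target value `T` can be moved under the integral, and `R`
  -- becomes the pointwise error.
  set R : E d → ℝ := fun x =>
    (-⟪𝔰.bE i α x, gradient (testFn Pr e i σ') x⟫ + 𝔰.cE i α x * testFn Pr e i σ' x) *
      (𝔰.mesh i).hat1 y x +
    (-⟪𝔰.bI i α x, gradient (testFn Pr e i σ) x⟫ + 𝔰.cI i α x * testFn Pr e i σ x) *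
      (𝔰.mesh i).hat1 y x - 𝔰.f i α x * (𝔰.mesh i).hat1 y x - T * (𝔰.mesh i).hat1 y x with hR
  have hint : ∫ x in 𝔭.Ω, R x =
      (∫ x in 𝔭.Ω, (-⟪𝔰.bE i α x, gradient (testFn Pr e i σ') x⟫ +
        𝔰.cE i α x * testFn Pr e i σ' x) * (𝔰.mesh i).hat1 y x) +
      (∫ x in 𝔭.Ω, (-⟪𝔰.bI i α x, gradient (testFn Pr e i σ) x⟫ +
        𝔰.cI i α x * testFn Pr e i σ x) * (𝔰.mesh i).hat1 y x) -
      (∫ x in 𝔭.Ω, 𝔰.f i α x * (𝔰.mesh i).hat1 y x) - T := by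
    have a1 := integral_add iE iI
    have a2 := integral_sub (iE.add iI) iF
    have a3 := integral_sub ((iE.add iI).sub iF) (ihat.const_mul T)
    simp only [Pi.add_apply, Pi.sub_apply] at a1 a2 a3
    rw [integral_const_mul, hone, mul_one] at a3
    simp only [hR]
    linarith
  have hbound : |∫ x in 𝔭.Ω, R x| ≤ K * η := by
    have : K * η = ∫ x in 𝔭.Ω, K * η * (𝔰.mesh i).hat1 y x := by
      rw [integral_const_mul, hone, mul_one]
    rw [this, ← Real.norm_eq_abs]
    refine norm_integral_le_of_norm_le (ihat.const_mul _) ?_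
    filter_upwards [𝔰.testFn_gradient (Pr := Pr) (i := i) e σ,
      𝔰.testFn_gradient (Pr := Pr) (i := i) e σ', 𝔰.ae_mem_element i] with x hx1 hx2 hx3
    obtain ⟨s, hs, hxs⟩ := hx3
    have hxs' := interior_subset hxs
    have hxP := Mesh.element_subset hM hs hxs'
    simp only [hR]
    rw [hx1, hx2, testFn_apply e i σ hxP, testFn_apply e i σ' hxP, ← add_mul, ← sub_mul, ← sub_mul,
      norm_mul, Real.norm_eq_abs, Real.norm_eq_abs, abs_of_nonneg (Mesh.hat1_nonneg y x)]
    by_cases hys : y ∈ s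
    swap
    · rw [Mesh.hat1_eqOn_zero hs hys hxs', mul_zero, mul_zero]
    refine mul_le_mul_of_nonneg_right ?_ (Mesh.hat1_nonneg y x)
    obtain ⟨g, c, -, hg1, hg2⟩ := hi2 s hs
    have hd := 𝔰.dist_le_size hs hxs' (subset_convexHull ℝ _ hys)
    obtain ⟨h31, h32, h33⟩ := hi3 α x hxP
    rw [hg1 x hxs]
    refine interior_estimate (bx := 𝔭.b α x) (gx := e.grad x) (cx := 𝔭.c α x) (ex := e.fn x)
      (fx := 𝔭.f α x) hη0.le hη1 (𝔰.cE_nonneg i α x hxP) (𝔰.cI_nonneg i α x hxP) h31 ?_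
      (hg2 x hxs') ?_ h32 ?_ (hi1 x hxP) ?_ hσ' h33 ?_ (hCb α y hyP)
      ((hCg x hxP).trans (le_abs_self _)) (hCc α x hxP) (hCc α y hyP)
      ((hCe x hxP).trans (le_abs_self _)) (hσ.trans (le_abs_self _))
    · rw [← dist_eq_norm]; exact (hb α x hxP y hyP (hd.trans_lt hs1)).le
    · rw [← dist_eq_norm]; exact (hgr x hxP y hyP (hd.trans_lt hs4)).le
    · rw [← Real.dist_eq]; exact (hc α x hxP y hyP (hd.trans_lt hs2)).le
    · rw [← Real.dist_eq]; exact (hfn x hxP y hyP (hd.trans_lt hs5)).le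
    · rw [← Real.dist_eq]; exact (hf α x hxP y hyP (hd.trans_lt hs3)).le
  have hfin : |(𝔭.a α y - (𝔰.aE i α y + 𝔰.aI i α y)) * e.lap| ≤ |e.lap| * η := by
    rw [abs_mul, mul_comm]; gcongr
  have hsum : |(𝔭.a α y - (𝔰.aE i α y + 𝔰.aI i α y)) * e.lap + ∫ x in 𝔭.Ω, R x| ≤ ε :=
    (abs_add_le _ _).trans ((add_le_add hfin hbound).trans (by linarith))
  refine le_trans (le_of_eq ?_) hsum
  rw [hint, hT]
  congr 1
  ring

/-- The constant `σ` cancels in the difference quotient, whose two points lie in one element, where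
the projection has constant gradient. -/
theorem lowerDini_testFn {𝔰 : Discretisation 𝔭}
    {Pr : ∀ i, smoothFunctions d →ₗ[ℝ] (𝔰.mesh i).P1} (e : Quad d) {η : ℝ}
    (hi2 : ∀ s ∈ (𝔰.mesh i).elements, ∃ g c,
        (∀ x ∈ convexHull ℝ (s : Set (E d)), (Pr i e.smooth : E d → ℝ) x = ⟪g, x⟫ + c) ∧
        (∀ x ∈ interior (convexHull ℝ (s : Set (E d))),
          gradient (Pr i e.smooth : E d → ℝ) x = g) ∧
        ∀ x ∈ convexHull ℝ (s : Set (E d)), ‖g - e.grad x‖ ≤ η) {y b : E d}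
    (hb : b ∈ tangentCone 𝔭.P y) (σ : ℝ) :
    ∃ g, ‖g - e.grad y‖ ≤ η ∧ lowerDini (testFn Pr e i σ) y b = -⟪g, b⟫ := by
  have hM := 𝔰.isMesh i
  obtain ⟨s, hs, r, hr, hys, hrs, hD⟩ := Mesh.exists_lowerDini_eq hM hb
  obtain ⟨g, c, hg, -, hg2⟩ := hi2 s hs
  refine ⟨g, hg2 y hys, ?_⟩
  rw [hD _ (testFn_mem e i σ), testFn_apply e i σ (Mesh.element_subset hM hs hys),
    testFn_apply e i σ (Mesh.element_subset hM hs hrs), hg y hys, hg _ hrs, inner_add_right,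
    real_inner_smul_right]
  field_simp
  ring

theorem consistency_robin {A : Type*} [TopologicalSpace A] [CompactSpace A] {𝔭 : Problem d A}
    {𝔰 : Discretisation 𝔭} (hcons : 𝔰.IsConsistent)
    {Pr : ∀ i, smoothFunctions d →ₗ[ℝ] (𝔰.mesh i).P1} (hPr : 𝔰.IsProjection Pr) (e : Quad d)
    (M : ℝ) {ε : ℝ} (hε : 0 < ε) : ∃ η > 0, ∀ᶠ i in atTop, ∀ α, ∀ y ∈ (𝔰.mesh i).vertices,
      y ∈ 𝔭.bdt ∪ 𝔭.bdR → ∀ σ σ', |σ| ≤ M → |σ' - σ| ≤ η →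
      |𝔰.opE i α (testFn Pr e i σ') y + 𝔰.opI i α (testFn Pr e i σ) y - 𝔰.rhs i α y -
        (𝔭.LB α y (e.grad y) (e.fn y + σ) - 𝔭.gB α y)| ≤ ε := by
  have hPc := Problem.isCompact_P (𝔭 := 𝔭)
  obtain ⟨Cb, hCb⟩ := hcons.bounded_boundary
  obtain ⟨Cc, hCc0, hCc⟩ := 𝔭.cB_ctrl.exists_bound_of_bounded fun α => (𝔭.cB_pc α).1
  obtain ⟨Cg, hCg⟩ := hPc.exists_bound_of_continuousOn e.continuous_grad.continuousOn
  obtain ⟨Ce, hCe⟩ := hPc.exists_bound_of_continuousOn e.continuous_fn.continuousOn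
  set K := 2 * |Cb| + |Cg| + (|Ce| + 1 + |M|) + Cc + (Cc + 1) + 1 with hK
  have hK0 : 0 < K := by positivity
  set η := min 1 (ε / K) with hη
  have hη0 : 0 < η := lt_min one_pos (by positivity)
  have hη1 : η ≤ 1 := min_le_left _ _
  have hηε : K * η ≤ ε := by
    have : η ≤ ε / K := min_le_right _ _
    rw [le_div_iff₀ (by positivity)] at this
    linarith
  refine ⟨η, hη0, ?_⟩
  filter_upwards [hPr.eventually_close e hη0, hcons.boundary η hη0] with i ⟨hi1, hi2⟩ hi3
  intro α y hy hyr σ σ' hσ hσ'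
  have hyP := 𝔰.vertex_mem hy
  have hyF := Problem.robin_subset hyr
  obtain ⟨gE, hgE, hE⟩ := lowerDini_testFn e hi2 (𝔰.bBE_cone i α y hyF) σ'
  obtain ⟨gI, hgI, hI⟩ := lowerDini_testFn e hi2 (𝔰.bBI_cone i α y hyF) σ
  obtain ⟨h31, h32, h33⟩ := hi3 α y hyF
  obtain ⟨hC1, hC2⟩ := hCb i α y hyF
  rw [𝔰.opE_robin _ _ hyr, 𝔰.opI_robin _ _ hyr, 𝔰.rhs_robin _ hyr, robinOp, robinOp, hE, hI,
    testFn_apply e i σ hyP, testFn_apply e i σ' hyP, Problem.LB]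
  exact (robin_estimate hη0.le hη1 (𝔰.cBE_nonneg i α y hyF) (𝔰.cBI_nonneg i α y hyF) h31 hgE hgI h32
    (hi1 y hyP) hσ' h33 (hC1.trans (le_abs_self _)) (hC2.trans (le_abs_self _))
    ((hCg y hyP).trans (le_abs_self _)) (hCc α y hyF) ((hCe y hyP).trans (le_abs_self _))
    (hσ.trans (le_abs_self _))).trans hηε

/-- Consistency of the scheme. -/
theorem consistency {A : Type*} [TopologicalSpace A] [CompactSpace A] {𝔭 : Problem d A}
    {𝔰 : Discretisation 𝔭} (hcons : 𝔰.IsConsistent)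
    {Pr : ∀ i, smoothFunctions d →ₗ[ℝ] (𝔰.mesh i).P1} (hPr : 𝔰.IsProjection Pr) (e : Quad d)
    (M : ℝ) {ε : ℝ} (hε : 0 < ε) : ∃ η > 0, ∀ᶠ i in atTop, ∀ α, ∀ y ∈ (𝔰.mesh i).vertices,
      ∀ σ σ', |σ| ≤ M → |σ' - σ| ≤ η → ∀ t < 𝔭.T,
      |𝔰.lin i α (testFn Pr e i σ') (testFn Pr e i σ) y - 𝔰.rhs i α y -
        𝔭.FLin α ((t, y), (e.lap, e.grad y, (σ' - σ) / 𝔰.h i, e.fn y + σ))| ≤ ε := by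
  obtain ⟨η₁, hη₁, h1⟩ := consistency_interior hcons hPr e M hε
  obtain ⟨η₂, hη₂, h2⟩ := consistency_robin hcons hPr e M hε
  refine ⟨min η₁ η₂, lt_min hη₁ hη₂, ?_⟩
  filter_upwards [h1, h2, hPr.eventually_close e hε] with i hi1 hi2 ⟨hi3, _⟩
  intro α y hy σ σ' hσ hσ' t ht
  have hyP := 𝔰.vertex_mem hy
  have hσ1 := hσ'.trans (min_le_left _ _)
  have hσ2 := hσ'.trans (min_le_right _ _)
  have htd : y ∈ 𝔭.Ω ∪ 𝔭.bdt →
      𝔰.timeDiff i (testFn Pr e i σ') (testFn Pr e i σ) y = (σ' - σ) / 𝔰.h i := fun h => by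
    rw [𝔰.timeDiff_pos _ _ h, testFn_apply e i σ hyP, testFn_apply e i σ' hyP, add_sub_add_left_eq_sub]
  rcases Problem.mem_cases hyP with h | h | h | h
  · have := hi1 α y hy h σ σ' hσ hσ1
    simp only [Problem.FLin, if_pos ht, if_pos h]
    rw [lin, htd (Or.inl h)]
    convert this using 2
    ring
  · have := hi2 α y hy (Or.inl h) σ σ' hσ hσ2
    simp only [Problem.FLin, if_pos ht, if_neg (Problem.bdt_notMem h), if_pos h]
    rw [lin, htd (Or.inr h)]
    convert this using 2
    ring
  · have := hi2 α y hy (Or.inr h) σ σ' hσ hσ2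
    simp only [Problem.FLin, if_pos ht, if_neg (Problem.bdR_notMem h),
      if_neg (Problem.bdR_notMem_bdt h), if_pos h]
    rw [lin, 𝔰.timeDiff_bdR _ _ h]
    convert this using 2
    ring
  · have h' := Problem.bdD_notMem_robin h
    simp only [Problem.FLin, if_pos ht, if_neg (Problem.bdD_notMem h),
      if_neg (fun h1 => h' (Or.inl h1)), if_neg (fun h1 => h' (Or.inr h1))]
    rw [lin, 𝔰.timeDiff_bdD _ _ h, 𝔰.opE_dirichlet _ _ h, 𝔰.opI_dirichlet _ _ h,
      𝔰.rhs_dirichlet _ h, testFn_apply e i σ hyP]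
    convert hi3 y hyP using 2
    ring

end Discretisation

end HJBFEM

/-! ### Touching numerical solutions by discrete test functions -/

namespace HJBFEM

variable {d : ℕ} {A : Type*} [TopologicalSpace A] {𝔭 : Problem d A}

namespace Problem

/-- Coefficients at a fixed point depend continuously on the control, so compactness of `A` bounds
the family whose supremum appears in `F`. -/
theorem FLin_le_F [CompactSpace A] {t : ℝ} {x : E d} (hx : x ∈ 𝔭.P) (α : A)
    (q : ℝ × E d × ℝ × ℝ) : 𝔭.FLin α ((t, x), q) ≤ 𝔭.F ((t, x), q) := by
  obtain ⟨q, p, r, s⟩ := q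
  have hLB : x ∈ frontier 𝔭.P →
      𝔭.LB α x p s - 𝔭.gB α x ≤ ⨆ α, (𝔭.LB α x p s - 𝔭.gB α x) := fun hxF => by
    have h1 := 𝔭.bB_ctrl.continuous_apply hxF
    have h2 := 𝔭.cB_ctrl.continuous_apply hxF
    have h3 := 𝔭.gB_ctrl.continuous_apply hxF
    have : Continuous fun α => 𝔭.LB α x p s - 𝔭.gB α x := by
      unfold LB
      fun_prop
    exact le_ciSup (isCompact_range this).bddAbove α
  have hL : 𝔭.L α x q p s - 𝔭.f α x ≤ ⨆ α, (𝔭.L α x q p s - 𝔭.f α x) := by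
    have h1 := 𝔭.a_ctrl.continuous_apply hx
    have h2 := 𝔭.b_ctrl.continuous_apply hx
    have h3 := 𝔭.c_ctrl.continuous_apply hx
    have h4 := 𝔭.f_ctrl.continuous_apply hx
    have : Continuous fun α => 𝔭.L α x q p s - 𝔭.f α x := by
      unfold L
      fun_prop
    exact le_ciSup (isCompact_range this).bddAbove α
  simp only [FLin, F]
  split_ifs with _ _ h h
  · linarith
  · linarith [hLB (bdt_subset h)]
  · exact hLB (bdR_subset h)
  · exact le_rfl
  · exact le_rfl

theorem F_le [Nonempty A] {z : OpArg d} {B : ℝ} (h : ∀ α, 𝔭.FLin α z ≤ B) : 𝔭.F z ≤ B := by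
  obtain ⟨⟨t, x⟩, q, p, r, s⟩ := z
  simp only [FLin, F] at h ⊢
  split_ifs at h ⊢
  · have : ⨆ α, (𝔭.L α x q p s - 𝔭.f α x) ≤ B + r := ciSup_le fun α => by linarith [h α]
    linarith
  · have : ⨆ α, (𝔭.LB α x p s - 𝔭.gB α x) ≤ B + r := ciSup_le fun α => by linarith [h α]
    linarith
  · exact ciSup_le h
  · exact h (Classical.arbitrary A)
  · exact h (Classical.arbitrary A)

end Problem

namespace Discretisation

variable {𝔰 : Discretisation 𝔭} {i : ℕ} {Pr : ∀ i, smoothFunctions d →ₗ[ℝ] (𝔰.mesh i).P1}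
  {v : ℕ → ℕ → E d → ℝ}

theorem mul_h_lt {k : ℕ} (hk : k < 𝔰.N i) : k * 𝔰.h i < 𝔭.T := by
  rw [← 𝔰.N_mul_h i]
  have := 𝔰.h_pos i
  gcongr

theorem mul_h_le {k : ℕ} (hk : k ≤ 𝔰.N i) : k * 𝔰.h i ≤ 𝔭.T := by
  rw [← 𝔰.N_mul_h i]
  have := 𝔰.h_pos i
  gcongr

theorem mem_Q {k : ℕ} (hk : k ≤ 𝔰.N i) {x : E d} (hx : x ∈ 𝔭.P) : (k * 𝔰.h i, x) ∈ 𝔭.Q :=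
  ⟨⟨by have := 𝔰.h_pos i; positivity, mul_h_le hk⟩, hx⟩

/-- The time difference of a constant is zero and the zeroth order coefficients are nonnegative, so
raising both time levels by a positive constant never lowers `lin`. -/
theorem lin_one_nonneg (α : A) {y : E d} (hy : y ∈ (𝔰.mesh i).vertices) :
    0 ≤ 𝔰.lin i α (one 𝔭) (one 𝔭) y := by
  have h1 := 𝔰.opE_one_nonneg α hy
  have h2 := 𝔰.opI_one_nonneg α hy
  rw [lin, timeDiff]
  simp only [sub_self, zero_div, ite_self, neg_zero, zero_add]
  positivity

/-- The linear operators at a node where a discrete test function touches the numerical solution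
from above. -/
theorem touch_above [CompactSpace A] (hcons : 𝔰.IsConsistent) (hdiff : 𝔰.HasArtificialDiffusion)
    (hstep : 𝔰.TimeStepRestriction) (hPr : 𝔰.IsProjection Pr) (hv : 𝔰.IsNumericalSolution v)
    (e : Quad d) (M : ℝ) {ε : ℝ} (hε : 0 < ε) : ∃ η > 0, ∀ᶠ i in atTop, ∀ k ≤ 𝔰.N i,
      ∀ y ∈ (𝔰.mesh i).vertices, ∀ σ σ' m, |σ| ≤ M → |σ' - σ| ≤ η → 0 ≤ m →
      v i k y = testFn Pr e i (σ + m) y →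
      (∀ s ∈ (𝔰.mesh i).elements, y ∈ s → ∀ z ∈ s, v i k z ≤ testFn Pr e i (σ + m) z) →
      (k < 𝔰.N i → ∀ s ∈ (𝔰.mesh i).elements, y ∈ s → ∀ z ∈ s,
        v i (k + 1) z ≤ testFn Pr e i (σ' + m) z) →
      ∀ α, 𝔭.FLin α ((k * 𝔰.h i, y), (e.lap, e.grad y, (σ' - σ) / 𝔰.h i, e.fn y + σ)) ≤ ε := by
  obtain ⟨η, hη, h1⟩ := consistency hcons hPr e M hε
  refine ⟨η, hη, ?_⟩
  filter_upwards [h1, hPr.eventually_close e hε] with i hi ⟨hi3, _⟩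
  intro k hk y hy σ σ' m hσ hσ' hm h0 hn hn' α
  rcases hk.lt_or_eq with hk | rfl
  · have h2 := hi α y hy σ σ' hσ hσ' _ (mul_h_lt hk)
    have h3 := 𝔰.lin_mono hcons hdiff hstep α hy ((hv i).1 (k + 1) hk) ((hv i).1 k hk.le)
      (testFn_mem e i (σ' + m)) (testFn_mem e i (σ + m)) h0 (hn' hk) hn
    -- The constant `m ≥ 0` has a favourable sign and is discarded, so that consistency is only
    -- needed for the bounded parameter `σ`.
    rw [testFn_add, testFn_add, 𝔰.lin_add_smul α (testFn_mem e i σ') (testFn_mem e i σ) 𝔰.one_mem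
      𝔰.one_mem m hy] at h3
    have h4 := hv.lin_le hcons hk hy α
    have h5 := mul_nonneg hm (𝔰.lin_one_nonneg α hy)
    linarith [(abs_le.1 h2).1]
  -- At the final time the operator compares with `vT`, which the numerical solution attains at
  -- nodes; the projection error is all that remains.
  · rw [(hv i).2.1 y hy, testFn_apply e i _ (𝔰.vertex_mem hy)] at h0
    simp only [Problem.FLin, 𝔰.N_mul_h i, lt_irrefl, if_false]
    linarith [(abs_le.1 (hi3 y (𝔰.vertex_mem hy))).1]

/-- The nonlinear operator at a node where a discrete test function touches the numerical solution
from below. -/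
theorem touch_below [CompactSpace A] [Nonempty A] (hcons : 𝔰.IsConsistent)
    (hdiff : 𝔰.HasArtificialDiffusion)
    (hstep : 𝔰.TimeStepRestriction) (hPr : 𝔰.IsProjection Pr) (hv : 𝔰.IsNumericalSolution v)
    (e : Quad d) (M : ℝ) {ε : ℝ} (hε : 0 < ε) : ∃ η > 0, ∀ᶠ i in atTop, ∀ k ≤ 𝔰.N i,
      ∀ y ∈ (𝔰.mesh i).vertices, ∀ σ σ', |σ| ≤ M → |σ' - σ| ≤ η →
      v i k y = testFn Pr e i σ y →
      (∀ s ∈ (𝔰.mesh i).elements, y ∈ s → ∀ z ∈ s, testFn Pr e i σ z ≤ v i k z) →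
      (k < 𝔰.N i → ∀ s ∈ (𝔰.mesh i).elements, y ∈ s → ∀ z ∈ s,
        testFn Pr e i σ' z ≤ v i (k + 1) z) →
      -ε ≤ 𝔭.F ((k * 𝔰.h i, y), (e.lap, e.grad y, (σ' - σ) / 𝔰.h i, e.fn y + σ)) := by
  -- One half of `ε` pays for consistency, the other for the choice of an almost optimal control.
  obtain ⟨η, hη, h1⟩ := consistency hcons hPr e M (half_pos hε)
  refine ⟨η, hη, ?_⟩
  filter_upwards [h1, hPr.eventually_close e hε] with i hi ⟨hi3, _⟩
  intro k hk y hy σ σ' hσ hσ' h0 hn hn'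
  rcases hk.lt_or_eq with hk | rfl
  · obtain ⟨α, h4⟩ := hv.exists_lt_lin hk hy (half_pos hε)
    have h2 := hi α y hy σ σ' hσ hσ' _ (mul_h_lt hk)
    have h3 := 𝔰.lin_mono hcons hdiff hstep α hy (testFn_mem e i σ') (testFn_mem e i σ)
      ((hv i).1 (k + 1) hk) ((hv i).1 k hk.le) h0.symm (hn' hk) hn
    refine le_trans ?_ (Problem.FLin_le_F (𝔰.vertex_mem hy) α _)
    linarith [(abs_le.1 h2).2]
  · rw [(hv i).2.1 y hy, testFn_apply e i _ (𝔰.vertex_mem hy)] at h0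
    simp only [Problem.F, 𝔰.N_mul_h i, lt_irrefl, if_false]
    linarith [(abs_le.1 (hi3 y (𝔰.vertex_mem hy))).2]

/-- Selection of nodes where discrete test functions touch a grid function from above, close to a
strict approximate maximum point. -/
theorem exists_touching (hPr : 𝔰.IsProjection Pr) (e : Quad d) (τ : ℝ → ℝ) (z : ℝ × E d)
    {ρ δ r : ℝ} (hρ : 0 < ρ) (hδ : 0 < δ) (hr : 0 < r) : ∃ η > 0, ∀ᶠ i in atTop,
      ∀ (w : ℕ → E d → ℝ) (μ : ℝ),
      (∀ k ≤ 𝔰.N i, ∀ y ∈ (𝔰.mesh i).vertices, dist ((k : ℝ) * 𝔰.h i, y) z ≤ ρ →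
        w k y ≤ e.fn y + τ (k * 𝔰.h i) + (μ + η - δ * dist ((k : ℝ) * 𝔰.h i, y) z ^ 2)) →
      (∃ k ≤ 𝔰.N i, ∃ y ∈ (𝔰.mesh i).vertices, dist ((k : ℝ) * 𝔰.h i, y) z ≤ ρ ∧
        e.fn y + τ (k * 𝔰.h i) + (μ - η) ≤ w k y) →
      ∃ k ≤ 𝔰.N i, ∃ y ∈ (𝔰.mesh i).vertices, ∃ m, dist ((k : ℝ) * 𝔰.h i, y) z < r ∧ |m - μ| ≤ r ∧
        w k y = testFn Pr e i (τ (k * 𝔰.h i) + m) y ∧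
        (∀ s ∈ (𝔰.mesh i).elements, y ∈ s → ∀ z ∈ s,
          w k z ≤ testFn Pr e i (τ (k * 𝔰.h i) + m) z) ∧
        (k < 𝔰.N i → ∀ s ∈ (𝔰.mesh i).elements, y ∈ s → ∀ z ∈ s,
          w (k + 1) z ≤ testFn Pr e i (τ ((k + 1 : ℕ) * 𝔰.h i) + m) z) := by
  -- This keeps the neighbours of the selected node, in space and at the next time level, inside the
  -- ball of radius `ρ` over which the maximum is taken.
  wlog hrρ : r ≤ ρ / 2 generalizing r
  · obtain ⟨η, hη, h⟩ := this (lt_min hr (half_pos hρ)) (min_le_right r (ρ / 2))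
    refine ⟨η, hη, h.mono fun i hi w μ h1 h2 => ?_⟩
    obtain ⟨k, hk, y, hy, m, h3, h4, h5⟩ := hi w μ h1 h2
    exact ⟨k, hk, y, hy, m, h3.trans_le (min_le_left _ _), h4.trans (min_le_left _ _), h5⟩
  -- The maximum `m` lies between `μ - 2η` and `μ + 2η - δ * dist²`: one `η` comes from the
  -- hypotheses, the other from the projection error. Hence `|m - μ| ≤ 2η ≤ r` and `δ * dist² ≤ 4η <
  -- δ * r²`.
  set η := min (r / 2) (δ * r ^ 2 / 8) with hη
  have hη0 : 0 < η := lt_min (by positivity) (by positivity)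
  have hη1 : η ≤ r / 2 := min_le_left _ _
  have hη2 : η ≤ δ * r ^ 2 / 8 := min_le_right _ _
  refine ⟨η, hη0, ?_⟩
  filter_upwards [hPr.eventually_close e hη0, 𝔰.size_tendsto.eventually (gt_mem_nhds (half_pos hρ)),
    𝔰.h_tendsto.eventually (gt_mem_nhds (half_pos hρ))] with i ⟨hi, _⟩ hs hh
  rintro w μ hA ⟨k₀, hk₀, y₀, hy₀, hd₀, hB⟩
  have hfin : {n : ℕ × E d | n.1 ≤ 𝔰.N i ∧ n.2 ∈ (𝔰.mesh i).vertices ∧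
      dist ((n.1 : ℝ) * 𝔰.h i, n.2) z ≤ ρ}.Finite :=
    ((finite_Iic (𝔰.N i)).prod 𝔰.finite_vertices).subset fun n hn => ⟨hn.1, hn.2.1⟩
  obtain ⟨p, hp⟩ : ∃ p : E d → ℝ, p = (Pr i e.smooth : E d → ℝ) := ⟨_, rfl⟩
  have htest : ∀ σ, ∀ x ∈ 𝔭.P, testFn Pr e i σ x = p x + σ := fun σ x hx => by
    rw [testFn_apply e i σ hx, hp]
  rw [← hp] at hi
  obtain ⟨⟨k, y⟩, ⟨hk, hy, hd⟩, hmax⟩ := exists_max_image _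
    (fun n : ℕ × E d => w n.1 n.2 - p n.2 - τ (n.1 * 𝔰.h i)) hfin ⟨(k₀, y₀), hk₀, hy₀, hd₀⟩
  have hmax' : ∀ k' ≤ 𝔰.N i, ∀ y' ∈ (𝔰.mesh i).vertices, dist ((k' : ℝ) * 𝔰.h i, y') z ≤ ρ →
      w k' y' - p y' - τ (k' * 𝔰.h i) ≤ w k y - p y - τ (k * 𝔰.h i) :=
    fun k' hk' y' hy' hd' => hmax (k', y') ⟨hk', hy', hd'⟩
  set m := w k y - p y - τ (k * 𝔰.h i) with hm
  have h1 := hmax' k₀ hk₀ y₀ hy₀ hd₀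
  have h2 := hA k hk y hy hd
  have h3 := abs_le.1 (hi y (𝔰.vertex_mem hy))
  have h4 := abs_le.1 (hi y₀ (𝔰.vertex_mem hy₀))
  have h5 : 0 ≤ δ * dist ((k : ℝ) * 𝔰.h i, y) z ^ 2 := by positivity
  have hdr : dist ((k : ℝ) * 𝔰.h i, y) z < r := by
    by_contra hcon
    have h6 : r ^ 2 ≤ dist ((k : ℝ) * 𝔰.h i, y) z ^ 2 := by
      have := not_lt.1 hcon
      gcongr
    have h7 : δ * r ^ 2 ≤ δ * dist ((k : ℝ) * 𝔰.h i, y) z ^ 2 := by gcongr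
    have h8 : 0 < δ * r ^ 2 := by positivity
    linarith
  have hnear : ∀ s ∈ (𝔰.mesh i).elements, y ∈ s → ∀ y' ∈ s, ∀ t, |t - k * 𝔰.h i| ≤ ρ / 2 →
      dist (t, y') z ≤ ρ := fun s hs' hys y' hy' t ht => by
    have h6 : dist (t, y') ((k : ℝ) * 𝔰.h i, y) ≤ ρ / 2 := by
      rw [Prod.dist_eq]
      exact max_le ht ((𝔰.dist_le_size hs' (subset_convexHull ℝ _ hy')
        (subset_convexHull ℝ _ hys)).trans hs.le)
    linarith [dist_triangle (t, y') ((k : ℝ) * 𝔰.h i, y) z]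
  refine ⟨k, hk, y, hy, m, hdr, ?_, ?_, fun s hs' hys y' hy' => ?_, fun hkN s hs' hys y' hy' => ?_⟩
  · rw [abs_le]
    constructor <;> linarith
  · rw [htest _ _ (𝔰.vertex_mem hy)]
    linarith
  · have hv' := Mesh.mem_vertices_of_mem hs'.1 hy'
    have := hmax' k hk y' hv' (hnear s hs' hys y' hy' _ (by simpa using (half_pos hρ).le))
    rw [htest _ _ (𝔰.vertex_mem hv')]
    linarith
  · have hv' := Mesh.mem_vertices_of_mem hs'.1 hy'
    have := hmax' (k + 1) hkN y' hv' (hnear s hs' hys y' hy' _ (by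
      push_cast
      rw [add_mul, one_mul, add_sub_cancel_left, abs_of_pos (𝔰.h_pos i)]
      exact hh.le))
    rw [htest _ _ (𝔰.vertex_mem hv')]
    linarith

end Discretisation

end HJBFEM

/-! ### Jets and replacement of `C²` test functions by quadratics -/

namespace HJBFEM

/-- Taylor's formula of second order. -/
theorem taylor_two {V : Type*} [NormedAddCommGroup V] [NormedSpace ℝ V] {ψ : V → ℝ}
    (hψ : ContDiff ℝ 2 ψ) (z : V) {ε : ℝ} (hε : 0 < ε) : ∃ ρ > 0, ∀ v, ‖v‖ ≤ ρ →
      |ψ (z + v) - (ψ z + fderiv ℝ ψ z v + 1 / 2 * fderiv ℝ (fderiv ℝ ψ) z v v)| ≤ ε * ‖v‖ ^ 2 := by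
  have hd : Differentiable ℝ ψ := hψ.differentiable (by norm_num)
  have hd2 : Differentiable ℝ (fderiv ℝ ψ) :=
    (hψ.fderiv_right (m := 1) (by norm_num)).differentiable (by norm_num)
  have hsymm : ∀ u v, fderiv ℝ (fderiv ℝ ψ) z u v = fderiv ℝ (fderiv ℝ ψ) z v u :=
    hψ.contDiffAt.isSymmSndFDerivAt (by simp)
  have ho := (hasFDerivAt_iff_isLittleO_nhds_zero.1 (hd2 z).hasFDerivAt).def hε
  obtain ⟨ρ, hρ, hball⟩ := Metric.eventually_nhds_iff_ball.1 ho
  refine ⟨ρ / 2, half_pos hρ, fun v hv => ?_⟩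
  have h1 : ∀ u, HasFDerivAt
      (fun u => ψ (z + u) - (ψ z + fderiv ℝ ψ z u + 1 / 2 * fderiv ℝ (fderiv ℝ ψ) z u u))
      (fderiv ℝ ψ (z + u) - fderiv ℝ ψ z - fderiv ℝ (fderiv ℝ ψ) z u) u := by
    intro u
    have a1 : HasFDerivAt (fun u => ψ (z + u)) (fderiv ℝ ψ (z + u)) u :=
      by
      have := (hd (z + u)).hasFDerivAt.comp u ((hasFDerivAt_id (𝕜 := ℝ) u).const_add z)
      simpa using! this
    have a2 := (fderiv ℝ ψ z).hasFDerivAt (x := u)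
    have a3 := (fderiv ℝ (fderiv ℝ ψ) z).hasFDerivAt (x := u)
    have a4 := a3.clm_apply (hasFDerivAt_id (𝕜 := ℝ) u)
    have a5 := a1.sub ((a2.const_add (ψ z)).add (a4.const_mul (1 / 2)))
    refine a5.congr_fderiv ?_
    ext w
    simp [hsymm w u]
    ring
  -- The remainder vanishes at `0`, and its derivative is at most `ε * ‖v‖` on the ball of radius
  -- `‖v‖`, so the mean value inequality gives `ε * ‖v‖ ^ 2`.
  have h2 := (convex_closedBall (0 : V) ‖v‖).norm_image_sub_le_of_norm_hasFDerivWithin_le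
    (C := ε * ‖v‖) (fun u _ => (h1 u).hasFDerivWithinAt) (fun u hu => ?_)
    (x := 0) (y := v) (by simp) (by simp)
  · simp only [add_zero, map_zero, sub_self, mul_zero, sub_zero, Real.norm_eq_abs] at h2
    refine h2.trans (le_of_eq (by ring))
  · rw [mem_closedBall_zero_iff] at hu
    exact (hball u (by rw [mem_ball_zero_iff]; linarith)).trans (by gcongr)

variable {d : ℕ}

theorem hasFDerivAt_slice {ψ : ℝ × E d → ℝ} (hψ : ContDiff ℝ 2 ψ)
    (t : ℝ) (x : E d) : HasFDerivAt (fun y => ψ (t, y))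
    ((fderiv ℝ ψ (t, x)).comp (ContinuousLinearMap.inr ℝ ℝ (E d))) x :=
  ((hψ.differentiable (by norm_num)) (t, x)).hasFDerivAt.comp x (hasFDerivAt_prodMk_right t x)

/-- Rewriting derivatives of slices through the full derivatives of `ψ` makes continuity and sign
rules of jets immediate. -/
theorem jet_eq {ψ : ℝ × E d → ℝ} (hψ : ContDiff ℝ 2 ψ) (z : ℝ × E d) (s : ℝ) : jet ψ z s =
    (z, (∑ i, fderiv ℝ (fderiv ℝ ψ) z (0, EuclideanSpace.single i 1) (0, EuclideanSpace.single i 1),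
      (InnerProductSpace.toDual ℝ (E d)).symm
        ((fderiv ℝ ψ z).comp (ContinuousLinearMap.inr ℝ ℝ (E d))), fderiv ℝ ψ z (1, 0), s)) := by
  obtain ⟨t, x⟩ := z
  have hd2 : Differentiable ℝ (fderiv ℝ ψ) :=
    (hψ.fderiv_right (m := 1) (by norm_num)).differentiable (by norm_num)
  have h1 : fderiv ℝ (fun y => ψ (t, y)) =
      fun x => (fderiv ℝ ψ (t, x)).comp (ContinuousLinearMap.inr ℝ ℝ (E d)) :=
    funext fun x => (hasFDerivAt_slice hψ t x).fderiv
  have h2 : ∀ u v, fderiv ℝ (fderiv ℝ (fun y => ψ (t, y))) x u v =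
      fderiv ℝ (fderiv ℝ ψ) (t, x) (0, u) (0, v) := fun u v => by
    have a1 := ((hd2 (t, x)).hasFDerivAt.comp x (hasFDerivAt_prodMk_right t x)).clm_comp
      (hasFDerivAt_const (ContinuousLinearMap.inr ℝ ℝ (E d)) x)
    rw [h1]
    refine (congrArg (fun L => L u v) (HasFDerivAt.fderiv a1)).trans ?_
    simp
  have h3 : HasDerivAt (fun τ => ψ (τ, x)) (fderiv ℝ ψ (t, x) (1, 0)) t := by
    have hd := hψ.differentiable (by norm_num)
    exact (hd (t, x)).hasFDerivAt.comp_hasDerivAt t ((hasDerivAt_id t).prodMk (hasDerivAt_const t x))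
  rw [jet]
  simp only
  rw [h3.deriv, InnerProductSpace.laplacian_eq_iteratedFDeriv_orthonormalBasis _
    (EuclideanSpace.basisFun (Fin d) ℝ), gradient, h1]
  simp [iteratedFDeriv_two_apply, h2]

theorem continuous_jet {ψ : ℝ × E d → ℝ} (hψ : ContDiff ℝ 2 ψ) : Continuous fun z => jet ψ z (ψ z) := by
  have h0 := hψ.continuous
  have h1 : Continuous (fderiv ℝ ψ) := hψ.continuous_fderiv (by norm_num)
  have h2 : Continuous (fderiv ℝ (fderiv ℝ ψ)) :=
    (hψ.fderiv_right (m := 1) (by norm_num)).continuous_fderiv (by norm_num)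
  simp only [jet_eq hψ]
  have h3 : Continuous fun z => (fderiv ℝ ψ z).comp (ContinuousLinearMap.inr ℝ ℝ (E d)) := by
    fun_prop
  have h4 := (InnerProductSpace.toDual ℝ (E d)).symm.continuous.comp h3
  refine continuous_id.prodMk (Continuous.prodMk ?_ (h4.prodMk (Continuous.prodMk ?_ h0)))
  · fun_prop
  · fun_prop

theorem jet_neg {ψ : ℝ × E d → ℝ} (hψ : ContDiff ℝ 2 ψ) (z : ℝ × E d) (s : ℝ) :
    jet (-ψ) z (-s) = ((jet ψ z s).1, -(jet ψ z s).2) := by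
  have h1 : fderiv ℝ (-ψ) = -fderiv ℝ ψ := funext fun x => fderiv_neg
  have h2 : ContDiff ℝ 2 (-ψ) := hψ.neg
  rw [jet_eq hψ, jet_eq h2, h1, fderiv_neg]
  ext1
  · rfl
  · simp [ContinuousLinearMap.neg_comp]

/-- A function of class `C²` lies, strictly away from the base point, below a sum of a quadratic
function of space and a quadratic function of time with almost the same derivatives. -/
theorem exists_quad_above (hd : 0 < d) {ψ : ℝ × E d → ℝ} (hψ : ContDiff ℝ 2 ψ) (z : ℝ × E d)
    {κ : ℝ} (hκ : 0 < κ) : ∃ (e : Quad d) (B ρ δ : ℝ), 0 < ρ ∧ 0 < δ ∧ e.fn z.2 = ψ z ∧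
      e.lap = (jet ψ z (ψ z)).2.1 + κ ∧ e.grad z.2 = (jet ψ z (ψ z)).2.2.1 ∧
      ∀ z', dist z' z ≤ ρ → ψ z' + δ * dist z' z ^ 2 ≤
        e.fn z'.2 + ((jet ψ z (ψ z)).2.2.2.1 * (z'.1 - z.1) + B * (z'.1 - z.1) ^ 2) := by
  -- Adding `κ'` times the identity to the Hessian raises its trace, the Laplacian, by `d * κ'`.
  obtain ⟨κ', hκ', hκκ⟩ : ∃ κ' : ℝ, 0 < κ' ∧ κ = d * κ' :=
    ⟨κ / d, by positivity, by field_simp⟩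
  obtain ⟨ρ, hρ, hT⟩ := taylor_two hψ z (ε := κ' / 8) (by positivity)
  have hsymm : ∀ u v, fderiv ℝ (fderiv ℝ ψ) z u v = fderiv ℝ (fderiv ℝ ψ) z v u :=
    hψ.contDiffAt.isSymmSndFDerivAt (by simp)
  set D := fderiv ℝ ψ z with hD
  set D2 := fderiv ℝ (fderiv ℝ ψ) z with hD2
  set J := ContinuousLinearMap.inr ℝ ℝ (E d) with hJ
  set R := (InnerProductSpace.toDual ℝ (E d)).symm with hR
  have hRi : ∀ (l : E d →L[ℝ] ℝ) v, ⟪R l, v⟫ = l v := fun l v => by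
    rw [hR, ← InnerProductSpace.toDual_apply_apply (𝕜 := ℝ), LinearIsometryEquiv.apply_symm_apply]
  have hJ' : ∀ v, J v = (0, v) := fun v => rfl
  let S₀ : E d →ₗ[ℝ] E d :=
    { toFun := fun v => R ((D2 (J v)).comp J)
      map_add' := fun u v => by simp [ContinuousLinearMap.add_comp]
      map_smul' := fun r v => by simp [ContinuousLinearMap.smul_comp] }
  let S : E d →L[ℝ] E d := LinearMap.toContinuousLinearMap S₀ + κ' • ContinuousLinearMap.id ℝ (E d)
  have hS : ∀ u v, ⟪S u, v⟫ = D2 (0, u) (0, v) + κ' * ⟪u, v⟫ := fun u v => by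
    simp only [S, S₀, add_apply, LinearMap.coe_toContinuousLinearMap', LinearMap.coe_mk,
      AddHom.coe_mk, inner_add_left, hRi, smul_apply, ContinuousLinearMap.id_apply,
      real_inner_smul_left, ContinuousLinearMap.comp_apply, hJ']
  -- The spatial surplus `κ' / 2 * ‖ξ‖²` pays `κ' / 4` for the mixed derivative by Young's
  -- inequality, `κ' / 8` for the Taylor remainder and `κ' / 8` for strictness. In `B` the summands
  -- pay for the second time derivative, for the other side of Young's inequality, and twice `κ' /
  -- 8` for remainder and strictness.
  refine ⟨⟨ψ z, R (D.comp J), z.2, S, fun u v => ?_⟩, ‖D2‖ / 2 + ‖D2‖ ^ 2 / κ' + κ' / 4, ρ, κ' / 8,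
    hρ, by positivity, by simp [Quad.fn], ?_, ?_, fun z' hz' => ?_⟩
  · rw [hS, real_inner_comm (S v), hS, hsymm, real_inner_comm]
  · simp only [jet_eq hψ, Quad.lap, hS, Finset.sum_add_distrib, ← hD2]
    simp [hκκ]
  · simp only [jet_eq hψ, Quad.grad, sub_self, map_zero, add_zero, ← hD, hR, hJ]
  · obtain ⟨t, x⟩ := z'
    obtain ⟨t₀, x₀⟩ := z
    have h1 := hT ((t, x) - (t₀, x₀)) (by rwa [← dist_eq_norm])
    rw [add_sub_cancel, ← dist_eq_norm] at h1
    simp only [jet_eq hψ, Quad.fn, hRi, hS, ← hD, ContinuousLinearMap.comp_apply, hJ',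
      real_inner_self_eq_norm_sq]
    set τ := t - t₀
    set ξ := x - x₀
    have h2 : ((t, x) - (t₀, x₀) : ℝ × E d) = τ • (1, 0) + (0, ξ) := by simp [τ, ξ]
    have h3 : dist (t, x) (t₀, x₀) ^ 2 ≤ τ ^ 2 + ‖ξ‖ ^ 2 := by
      rw [dist_eq_norm, h2, Prod.norm_def]
      rcases max_cases ‖(τ • ((1 : ℝ), (0 : E d)) + (0, ξ)).1‖ ‖(τ • ((1 : ℝ), (0 : E d)) + (0, ξ)).2‖
        with ⟨h, -⟩ | ⟨h, -⟩ <;> (rw [h]; simp [sq_nonneg])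
    have n1 : ‖((1 : ℝ), (0 : E d))‖ = 1 := by simp [Prod.norm_def]
    have n2 : ‖((0 : ℝ), ξ)‖ = ‖ξ‖ := by simp [Prod.norm_def]
    have h4 : D2 (1, 0) (1, 0) ≤ ‖D2‖ := by
      have := (le_abs_self _).trans (D2.le_opNorm₂ (1, 0) (1, 0))
      rwa [n1, mul_one, mul_one] at this
    have h5 : |D2 (1, 0) (0, ξ)| ≤ ‖D2‖ * ‖ξ‖ := by
      have := D2.le_opNorm₂ (1, 0) (0, ξ)
      rwa [n1, mul_one, n2] at this
    rw [h2] at h1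
    simp only [map_add, map_smul, add_apply, smul_apply, smul_eq_mul, hsymm (0, ξ) (1, 0)] at h1
    have h6 := (abs_le.1 h1).2
    have h7 : τ * D2 (1, 0) (0, ξ) ≤ κ' / 4 * ‖ξ‖ ^ 2 + ‖D2‖ ^ 2 / κ' * τ ^ 2 := by
      have a1 : τ * D2 (1, 0) (0, ξ) ≤ |τ| * (‖D2‖ * ‖ξ‖) := by
        refine (le_abs_self _).trans ?_
        rw [abs_mul]
        gcongr
      have a2 : 0 ≤ (κ' / 2 * ‖ξ‖ - ‖D2‖ * |τ|) ^ 2 / κ' := by positivity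
      have a3 : (κ' / 2 * ‖ξ‖ - ‖D2‖ * |τ|) ^ 2 / κ' =
          κ' / 4 * ‖ξ‖ ^ 2 + ‖D2‖ ^ 2 / κ' * τ ^ 2 - |τ| * (‖D2‖ * ‖ξ‖) := by
        rw [← sq_abs τ]
        field_simp
        ring
      linarith
    have h8 : τ ^ 2 * D2 (1, 0) (1, 0) ≤ τ ^ 2 * ‖D2‖ := by gcongr
    have h9 : κ' / 8 * dist (t, x) (t₀, x₀) ^ 2 ≤ κ' / 8 * (τ ^ 2 + ‖ξ‖ ^ 2) := by gcongr
    linarith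

end HJBFEM

/-! ### From touching to inequalities for the operators near a jet -/

namespace HJBFEM

/-- The quadratic function of time with derivative `a` and second derivative `2 * B` at `t₀`. -/
def timeQuad (a B t₀ t : ℝ) : ℝ := a * (t - t₀) + B * (t - t₀) ^ 2

variable {d : ℕ} {A : Type*} [TopologicalSpace A] {𝔭 : Problem d A}

namespace Discretisation

variable {𝔰 : Discretisation 𝔭} {i : ℕ} {Pr : ∀ i, smoothFunctions d →ₗ[ℝ] (𝔰.mesh i).P1}
  {v : ℕ → ℕ → E d → ℝ}

theorem testFn_neg (e : Quad d) (i : ℕ) (σ : ℝ) : testFn Pr e.neg i (-σ) = -testFn Pr e i σ := by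
  simp [testFn, Quad.neg_smooth, add_comm]

/-- The difference quotient of `timeQuad` over one step `h` equals `a + B * (2 * (t - t₀) + h)`. The
whole argument of the operator is thus a continuous function of the node, `m` and `h`. -/
theorem eventually_arg_mem (𝔰 : Discretisation 𝔭) (e : Quad d) (a B c : ℝ) (z : ℝ × E d)
    {U : Set (OpArg d)} (hU : U ∈ 𝓝 (z, (e.lap, e.grad z.2, a, e.fn z.2 + c))) : ∃ r > 0,
      ∀ᶠ i in atTop, ∀ (k : ℕ) y m, dist ((k : ℝ) * 𝔰.h i, y) z < r → |m| ≤ r →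
      (((k : ℝ) * 𝔰.h i, y), (e.lap, e.grad y, (timeQuad a B z.1 ((k + 1 : ℕ) * 𝔰.h i) + c + m -
        (timeQuad a B z.1 (k * 𝔰.h i) + c + m)) / 𝔰.h i,
        e.fn y + (timeQuad a B z.1 (k * 𝔰.h i) + c + m))) ∈ U := by
  let Φ : (ℝ × E d) × ℝ × ℝ → OpArg d := fun n => (n.1, (e.lap, e.grad n.1.2,
    a + B * (2 * (n.1.1 - z.1) + n.2.2), e.fn n.1.2 + (timeQuad a B z.1 n.1.1 + c + n.2.1)))
  have hΦ : Continuous Φ := by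
    have h1 := e.continuous_fn
    have h2 := e.continuous_grad
    unfold Φ timeQuad
    fun_prop
  have h0 : Φ (z, 0, 0) = (z, (e.lap, e.grad z.2, a, e.fn z.2 + c)) := by simp [Φ, timeQuad]
  rw [← h0] at hU
  obtain ⟨r, hr, hball⟩ := Metric.mem_nhds_iff.1 (hΦ.continuousAt hU)
  refine ⟨r / 2, half_pos hr, ?_⟩
  filter_upwards [𝔰.h_tendsto.eventually (gt_mem_nhds hr)] with i hi k y m hd hm
  have hh := 𝔰.h_pos i
  have h1 : ((((k : ℝ) * 𝔰.h i, y), m, 𝔰.h i) : (ℝ × E d) × ℝ × ℝ) ∈ Metric.ball (z, 0, 0) r := by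
    refine Metric.mem_ball.2 (max_lt (hd.trans (half_lt_self hr)) (max_lt ?_ ?_))
    · rw [Real.dist_eq, sub_zero]
      linarith
    · rwa [Real.dist_eq, sub_zero, abs_of_pos hh]
  have h2 := hball h1
  simp only [mem_preimage, Φ] at h2
  convert h2 using 5
  simp only [timeQuad]
  push_cast
  field_simp
  ring

/-- If a quadratic function touches the numerical solutions from above, then the linear operators
are almost non-positive somewhere near its jet. -/
theorem exists_FLin_le [CompactSpace A] (hcons : 𝔰.IsConsistent) (hdiff : 𝔰.HasArtificialDiffusion)
    (hstep : 𝔰.TimeStepRestriction) (hPr : 𝔰.IsProjection Pr) (hv : 𝔰.IsNumericalSolution v)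
    (e : Quad d) (a B c : ℝ) (z : ℝ × E d) {ρ δ ε : ℝ} (hρ : 0 < ρ) (hδ : 0 < δ) (hε : 0 < ε)
    {U : Set (OpArg d)} (hU : U ∈ 𝓝 (z, (e.lap, e.grad z.2, a, e.fn z.2 + c))) : ∃ η > 0,
      ∀ᶠ i in atTop, ∀ μ, 0 ≤ μ →
      (∀ k ≤ 𝔰.N i, ∀ y ∈ (𝔰.mesh i).vertices, dist ((k : ℝ) * 𝔰.h i, y) z ≤ ρ →
        v i k y ≤ e.fn y + timeQuad a B z.1 (k * 𝔰.h i) +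
          (c + μ + η - δ * dist ((k : ℝ) * 𝔰.h i, y) z ^ 2)) →
      (∃ k ≤ 𝔰.N i, ∃ y ∈ (𝔰.mesh i).vertices, dist ((k : ℝ) * 𝔰.h i, y) z ≤ ρ ∧
        e.fn y + timeQuad a B z.1 (k * 𝔰.h i) + (c + μ - η) ≤ v i k y) →
      ∃ ζ ∈ U, ζ.1 ∈ 𝔭.Q ∧ ∀ α, 𝔭.FLin α ζ ≤ ε := by
  obtain ⟨r, hr, h1⟩ := 𝔰.eventually_arg_mem e a B c z hU
  have hτc : Continuous (timeQuad a B z.1) := by unfold timeQuad; fun_prop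
  obtain ⟨C, hC⟩ := (isCompact_Icc (a := 0) (b := 𝔭.T)).exists_bound_of_continuousOn hτc.continuousOn
  have huc := Metric.uniformContinuousOn_iff.1
    ((isCompact_Icc (a := 0) (b := 𝔭.T)).uniformContinuousOn_of_continuous hτc.continuousOn)
  obtain ⟨η₁, hη₁, h2⟩ := touch_above hcons hdiff hstep hPr hv e (C + |c| + r) hε
  obtain ⟨h₀, hh₀, huc⟩ := huc η₁ hη₁
  obtain ⟨η, hη, h3⟩ := exists_touching hPr e (timeQuad a B z.1) z hρ hδ hr
  refine ⟨η, hη, ?_⟩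
  filter_upwards [h1, h2, h3, 𝔰.h_tendsto.eventually (gt_mem_nhds hh₀)] with i h1 h2 h3 hh μ hμ hA hB
  obtain ⟨k, hk, y, hy, m, hd, hm, he, hn, hn'⟩ := h3 (v i) (c + μ) hA hB
  have hm' := abs_le.1 hm
  -- As `μ ≥ 0` has no upper bound, neither has `m`. Its excess over `c` is split: the negative part
  -- is at most `r` in modulus and enters `σ`, the positive part goes into the constant that
  -- `touch_above` discards.
  set m₁ := min (m - c) 0 with hm₁
  set m₂ := max (m - c) 0 with hm₂
  have hsum : m₁ + m₂ = m - c := by rw [hm₁, hm₂, min_add_max, add_zero]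
  have hm₁' : |m₁| ≤ r := by
    rw [abs_of_nonpos (min_le_right _ _), hm₁, neg_le]
    exact le_min (by linarith) (by linarith)
  set σ := timeQuad a B z.1 (k * 𝔰.h i) + c + m₁ with hσ
  set σ' := timeQuad a B z.1 ((k + 1 : ℕ) * 𝔰.h i) + c + m₁ with hσ'
  have e1 : timeQuad a B z.1 (k * 𝔰.h i) + m = σ + m₂ := by linarith
  have e2 : timeQuad a B z.1 ((k + 1 : ℕ) * 𝔰.h i) + m = σ' + m₂ := by linarith
  rw [e1] at he hn
  rw [e2] at hn'
  have hσC : |σ| ≤ C + |c| + r := by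
    refine (abs_add_three _ _ _).trans ?_
    have := hC _ (mem_Q hk (𝔰.vertex_mem hy)).1
    rw [Real.norm_eq_abs] at this
    linarith
  refine ⟨_, h1 k y m₁ hd hm₁', mem_Q hk (𝔰.vertex_mem hy), ?_⟩
  rcases hk.lt_or_eq with hk' | rfl
  · refine h2 k hk y hy σ σ' m₂ hσC ?_ (le_max_right _ _) he hn hn'
    have h5 := (huc ((k + 1 : ℕ) * 𝔰.h i) (mem_Q (show k + 1 ≤ 𝔰.N i from hk') (𝔰.vertex_mem hy)).1
      (k * 𝔰.h i) (mem_Q hk (𝔰.vertex_mem hy)).1 (by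
        rw [Real.dist_eq]
        push_cast
        rw [add_mul, one_mul, add_sub_cancel_left, abs_of_pos (𝔰.h_pos i)]
        exact hh)).le
    rw [Real.dist_eq] at h5
    rwa [hσ, hσ', add_assoc, add_assoc, add_sub_add_right_eq_sub]
  -- There is no next level at the final time; `σ` takes the place of `σ'`, and the operator ignores
  -- the time derivative there.
  · intro α
    have := h2 (𝔰.N i) le_rfl y hy σ σ m₂ hσC (by simpa using hη₁.le) (le_max_right _ _) he hn
      (fun h => absurd h (lt_irrefl _)) α
    rw [hσ] at this
    simpa only [Problem.FLin, 𝔰.N_mul_h i, lt_irrefl, if_false] using this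

/-- If a quadratic function touches the numerical solutions from below, then the nonlinear operator
is almost nonnegative somewhere near its jet. -/
theorem exists_le_F [CompactSpace A] [Nonempty A] (hcons : 𝔰.IsConsistent)
    (hdiff : 𝔰.HasArtificialDiffusion)
    (hstep : 𝔰.TimeStepRestriction) (hPr : 𝔰.IsProjection Pr) (hv : 𝔰.IsNumericalSolution v)
    (e : Quad d) (a B c : ℝ) (z : ℝ × E d) {ρ δ ε : ℝ} (hρ : 0 < ρ) (hδ : 0 < δ) (hε : 0 < ε)
    {U : Set (OpArg d)} (hU : U ∈ 𝓝 (z, -(e.lap, e.grad z.2, a, e.fn z.2 + c))) : ∃ η > 0,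
      ∀ᶠ i in atTop,
      (∀ k ≤ 𝔰.N i, ∀ y ∈ (𝔰.mesh i).vertices, dist ((k : ℝ) * 𝔰.h i, y) z ≤ ρ →
        -v i k y ≤ e.fn y + timeQuad a B z.1 (k * 𝔰.h i) +
          (c + η - δ * dist ((k : ℝ) * 𝔰.h i, y) z ^ 2)) →
      (∃ k ≤ 𝔰.N i, ∃ y ∈ (𝔰.mesh i).vertices, dist ((k : ℝ) * 𝔰.h i, y) z ≤ ρ ∧
        e.fn y + timeQuad a B z.1 (k * 𝔰.h i) + (c - η) ≤ -v i k y) →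
      ∃ ζ ∈ U, ζ.1 ∈ 𝔭.Q ∧ -ε ≤ 𝔭.F ζ := by
  have hcont : Continuous fun ζ : OpArg d => ((ζ.1, -ζ.2) : OpArg d) := by fun_prop
  obtain ⟨r, hr, h1⟩ := 𝔰.eventually_arg_mem e a B c z (U := (fun ζ => (ζ.1, -ζ.2)) ⁻¹' U)
    (hcont.continuousAt hU)
  have hτc : Continuous (timeQuad a B z.1) := by unfold timeQuad; fun_prop
  obtain ⟨C, hC⟩ := (isCompact_Icc (a := 0) (b := 𝔭.T)).exists_bound_of_continuousOn hτc.continuousOn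
  have huc := Metric.uniformContinuousOn_iff.1
    ((isCompact_Icc (a := 0) (b := 𝔭.T)).uniformContinuousOn_of_continuous hτc.continuousOn)
  -- Nodes are selected by touching `-v` from above with `e`; negating everything touches `v` from
  -- below with `e.neg`, which explains the sign of the jet.
  obtain ⟨η₁, hη₁, h2⟩ := touch_below hcons hdiff hstep hPr hv e.neg (C + |c| + r) hε
  obtain ⟨h₀, hh₀, huc⟩ := huc η₁ hη₁
  obtain ⟨η, hη, h3⟩ := exists_touching hPr e (timeQuad a B z.1) z hρ hδ hr
  refine ⟨η, hη, ?_⟩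
  filter_upwards [h1, h2, h3, 𝔰.h_tendsto.eventually (gt_mem_nhds hh₀)] with i h1 h2 h3 hh hA hB
  obtain ⟨k, hk, y, hy, m, hd, hm, he, hn, hn'⟩ := h3 (fun k => -v i k) c hA hB
  set σ := timeQuad a B z.1 (k * 𝔰.h i) + c + (m - c) with hσ
  set σ' := timeQuad a B z.1 ((k + 1 : ℕ) * 𝔰.h i) + c + (m - c) with hσ'
  have e1 : timeQuad a B z.1 (k * 𝔰.h i) + m = σ := by linarith
  have e2 : timeQuad a B z.1 ((k + 1 : ℕ) * 𝔰.h i) + m = σ' := by linarith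
  rw [e1] at he hn
  rw [e2] at hn'
  have hσC : |-σ| ≤ C + |c| + r := by
    rw [abs_neg]
    refine (abs_add_three _ _ _).trans ?_
    have := hC _ (mem_Q hk (𝔰.vertex_mem hy)).1
    rw [Real.norm_eq_abs] at this
    linarith
  have he' : v i k y = testFn Pr e.neg i (-σ) y := by
    rw [testFn_neg, Pi.neg_apply, ← he, Pi.neg_apply, neg_neg]
  have hle : ∀ k' σ z', (-v i k') z' ≤ testFn Pr e i σ z' → testFn Pr e.neg i (-σ) z' ≤ v i k' z' :=
    fun k' σ z' h => by
      rw [testFn_neg, Pi.neg_apply]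
      rw [Pi.neg_apply] at h
      linarith
  refine ⟨_, h1 k y (m - c) hd hm, mem_Q hk (𝔰.vertex_mem hy), ?_⟩
  have hn2 : ∀ s ∈ (𝔰.mesh i).elements, y ∈ s → ∀ z ∈ s, testFn Pr e.neg i (-σ) z ≤ v i k z :=
    fun s hs hys z' hz' => hle _ _ _ (hn s hs hys z' hz')
  rcases hk.lt_or_eq with hk' | rfl
  · have := h2 k hk y hy (-σ) (-σ') hσC ?_ he' hn2
      fun hkN s hs hys z' hz' => hle _ _ _ (hn' hkN s hs hys z' hz')
    · have e3 : (-σ' - -σ) / 𝔰.h i = -((σ' - σ) / 𝔰.h i) := by ring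
      have e4 : e.neg.fn y + -σ = -(e.fn y + σ) := by rw [Quad.neg_fn]; ring
      rw [e3, e4, Quad.neg_lap, Quad.neg_grad] at this
      exact this
    have h5 := (huc ((k + 1 : ℕ) * 𝔰.h i) (mem_Q (show k + 1 ≤ 𝔰.N i from hk') (𝔰.vertex_mem hy)).1
      (k * 𝔰.h i) (mem_Q hk (𝔰.vertex_mem hy)).1 (by
        rw [Real.dist_eq]
        push_cast
        rw [add_mul, one_mul, add_sub_cancel_left, abs_of_pos (𝔰.h_pos i)]
        exact hh)).le
    rw [Real.dist_eq] at h5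
    rwa [neg_sub_neg, abs_sub_comm, hσ, hσ', add_assoc, add_assoc, add_sub_add_right_eq_sub]
  · have := h2 (𝔰.N i) le_rfl y hy (-σ) (-σ) hσC (by simpa using hη₁.le) he' hn2
      (fun h => absurd h (lt_irrefl _))
    rw [hσ] at this
    simp only [Problem.F, 𝔰.N_mul_h i, lt_irrefl, if_false, Quad.neg_fn] at this ⊢
    linarith

end Discretisation

end HJBFEM

/-! ### Uniform bounds through the strict supersolution -/

namespace HJBFEM

variable {d : ℕ} {A : Type*} [TopologicalSpace A] {𝔭 : Problem d A}

namespace Problem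

theorem isCompact_Q : IsCompact 𝔭.Q := isCompact_Icc.prod isCompact_P

/-- The linear operators are Lipschitz continuous in the derivatives. -/
theorem FLin_lipschitz (α : A) : ∃ K, 0 ≤ K ∧ ∀ z ∈ 𝔭.Q, ∀ q q' : ℝ × E d × ℝ × ℝ,
    |𝔭.FLin α (z, q) - 𝔭.FLin α (z, q')| ≤ K * ‖q - q'‖ := by
  have hPc := isCompact_P (𝔭 := 𝔭)
  obtain ⟨Ca, hCa⟩ := hPc.exists_bound_of_continuousOn (𝔭.a_cont α)
  obtain ⟨Cb, hCb⟩ := hPc.exists_bound_of_continuousOn (𝔭.b_cont α)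
  obtain ⟨Cc, hCc⟩ := hPc.exists_bound_of_continuousOn (𝔭.c_cont α)
  obtain ⟨Db, hDb⟩ := (𝔭.bB_pc α).1
  obtain ⟨Dc, hDc⟩ := (𝔭.cB_pc α).1
  refine ⟨|Ca| + |Cb| + |Cc| + |Db| + |Dc| + 1, by positivity, ?_⟩
  rintro ⟨t, x⟩ ⟨-, hx⟩ ⟨q, p, r, s⟩ ⟨q', p', r', s'⟩
  set n := ‖(q, p, r, s) - (q', p', r', s')‖ with hn
  have h1 : |q - q'| ≤ n := norm_fst_le ((q, p, r, s) - (q', p', r', s'))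
  have h2' := norm_snd_le ((q, p, r, s) - (q', p', r', s'))
  have h2 : ‖p - p'‖ ≤ n := (norm_fst_le ((p, r, s) - (p', r', s'))).trans h2'
  have h3' := (norm_snd_le ((p, r, s) - (p', r', s'))).trans h2'
  have h3 : |r - r'| ≤ n := (norm_fst_le ((r, s) - (r', s'))).trans h3'
  have h4 : |s - s'| ≤ n := (norm_snd_le ((r, s) - (r', s'))).trans h3'
  have hn0 : 0 ≤ n := norm_nonneg _
  have m1 : |Ca| * n ≥ 0 := by positivity
  have m2 : |Cb| * n ≥ 0 := by positivity
  have m3 : |Cc| * n ≥ 0 := by positivity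
  have m4 : |Db| * n ≥ 0 := by positivity
  have m5 : |Dc| * n ≥ 0 := by positivity
  have ka : |𝔭.a α x * (q - q')| ≤ |Ca| * n := by
    rw [abs_mul]
    exact mul_le_mul ((hCa x hx).trans (le_abs_self _)) h1 (abs_nonneg _) (abs_nonneg _)
  have kb : |⟪𝔭.b α x, p - p'⟫| ≤ |Cb| * n := (abs_real_inner_le_norm _ _).trans
    (mul_le_mul ((hCb x hx).trans (le_abs_self _)) h2 (norm_nonneg _) (abs_nonneg _))
  have kc : |𝔭.c α x * (s - s')| ≤ |Cc| * n := by
    rw [abs_mul]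
    exact mul_le_mul ((hCc x hx).trans (le_abs_self _)) h4 (abs_nonneg _) (abs_nonneg _)
  have lb : x ∈ frontier 𝔭.P → |⟪𝔭.bB α x, p - p'⟫| ≤ |Db| * n := fun hx =>
    (abs_real_inner_le_norm _ _).trans
    (mul_le_mul ((hDb x hx).trans (le_abs_self _)) h2 (norm_nonneg _) (abs_nonneg _))
  have lc : x ∈ frontier 𝔭.P → |𝔭.cB α x * (s - s')| ≤ |Dc| * n := fun hx => by
    rw [abs_mul]
    exact mul_le_mul ((hDc x hx).trans (le_abs_self _)) h4 (abs_nonneg _) (abs_nonneg _)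
  rw [inner_sub_right] at kb lb
  rw [mul_sub] at ka kc lc
  rw [abs_le] at ka kb kc h3 h4
  simp only [FLin, L, LB]
  rw [abs_le]
  split_ifs with _ _ h h
  · constructor <;> linarith
  · have lb := abs_le.1 (lb (bdt_subset h))
    have lc := abs_le.1 (lc (bdt_subset h))
    constructor <;> linarith
  · have lb := abs_le.1 (lb (bdR_subset h))
    have lc := abs_le.1 (lc (bdR_subset h))
    constructor <;> linarith
  · constructor <;> linarith
  · constructor <;> linarith

end Problem

namespace Discretisation

variable {𝔰 : Discretisation 𝔭} {i : ℕ} {Pr : ∀ i, smoothFunctions d →ₗ[ℝ] (𝔰.mesh i).P1}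
  {v : ℕ → ℕ → E d → ℝ}

theorem vertices_nonempty (𝔰 : Discretisation 𝔭) (i : ℕ) : (𝔰.mesh i).vertices.Nonempty := by
  obtain ⟨x, hx⟩ := 𝔭.polytopic.1.nonempty
  obtain ⟨s, hs, -⟩ := Mesh.exists_element (𝔰.isMesh i) hx
  obtain ⟨y, hy⟩ := (𝔰.mesh i).nonempty_of_mem_faces hs.1
  exact ⟨y, Mesh.mem_vertices_of_mem hs.1 hy⟩

/-- Numerical solutions lie below strict supersolutions up to a constant. -/
theorem eventually_le_supersolution [CompactSpace A] (hd : 0 < d) (hcons : 𝔰.IsConsistent)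
    (hdiff : 𝔰.HasArtificialDiffusion) (hstep : 𝔰.TimeStepRestriction) (hPr : 𝔰.IsProjection Pr)
    (hv : 𝔰.IsNumericalSolution v) {α : A} {w : ℝ × E d → ℝ} (hw : ContDiff ℝ 2 w) {ε : ℝ}
    (hε : 0 < ε) (hsuper : ∀ z ∈ 𝔭.Q, ε ≤ 𝔭.FLin α (jet w z (w z))) :
    ∀ᶠ i in atTop, ∀ k ≤ 𝔰.N i, ∀ y ∈ (𝔰.mesh i).vertices, v i k y ≤ w (k * 𝔰.h i, y) + 1 := by
  by_contra hcon
  have hmax : ∀ i, ∃ n : ℕ × E d, (n.1 ≤ 𝔰.N i ∧ n.2 ∈ (𝔰.mesh i).vertices) ∧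
      ∀ k ≤ 𝔰.N i, ∀ y ∈ (𝔰.mesh i).vertices,
        v i k y - w (k * 𝔰.h i, y) ≤ v i n.1 n.2 - w (n.1 * 𝔰.h i, n.2) := fun i => by
    obtain ⟨y₀, hy₀⟩ := 𝔰.vertices_nonempty i
    obtain ⟨n, hn, hn'⟩ := exists_max_image _ (fun n : ℕ × E d => v i n.1 n.2 - w (n.1 * 𝔰.h i, n.2))
      ((finite_Iic (𝔰.N i)).prod 𝔰.finite_vertices) ⟨(0, y₀), Nat.zero_le _, hy₀⟩
    exact ⟨n, hn, fun k hk y hy => hn' (k, y) ⟨hk, hy⟩⟩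
  choose n hnN hn using hmax
  set ζ : ℕ → ℝ × E d := fun i => ((n i).1 * 𝔰.h i, (n i).2) with hζ
  -- On infinitely many levels the largest excess over `w` is more than one; the maximum points of
  -- these levels accumulate at some `z` by compactness.
  set bad : Set ℕ := {i | 1 < v i (n i).1 (n i).2 - w (ζ i)} with hbad
  have hfreq : ∃ᶠ i in atTop, i ∈ bad := by
    refine fun h => hcon (h.mono fun i hi k hk y hy => ?_)
    have h1 := hn i k hk y hy
    simp only [hbad, mem_ofPred_eq, not_lt] at hi
    linarith
  have : (atTop ⊓ 𝓟 bad : Filter ℕ).NeBot := frequently_mem_iff_neBot.1 hfreq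
  obtain ⟨z, hzQ, hz⟩ := Problem.isCompact_Q (𝔭 := 𝔭).exists_mapClusterPt
    (f := atTop ⊓ 𝓟 bad) (u := ζ) (by
      rw [le_principal_iff]
      exact Filter.mem_map.2 (univ_mem' fun i => mem_Q (hnN i).1 (𝔰.vertex_mem (hnN i).2)))
  obtain ⟨K, hK, hLip⟩ := 𝔭.FLin_lipschitz α
  obtain ⟨κ, hκ, hκε⟩ : ∃ κ > 0, K * (2 * κ) ≤ ε / 2 := by
    refine ⟨ε / (4 * (K + 1)), by positivity, ?_⟩
    rw [mul_div_assoc', mul_div_assoc', div_le_div_iff₀ (by positivity) (by positivity)]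
    nlinarith
  obtain ⟨e, B, ρ, δ, hρ, hδ, he, hj, hj', hle⟩ := exists_quad_above hd hw z hκ
  set a := (jet w z (w z)).2.2.2.1 with ha
  have hjc := continuous_jet hw
  -- The linear operator is discontinuous in `(t, x)` across boundary parts. The neighbourhood
  -- therefore compares derivatives with those of `w` at the same base point, where strictness of
  -- the supersolution and the Lipschitz bound both apply.
  have hU : {ξ : OpArg d | ‖ξ.2 - (jet w ξ.1 (w ξ.1)).2‖ < 2 * κ} ∈
      𝓝 (z, (e.lap, e.grad z.2, a, e.fn z.2 + 0)) := by
    refine (isOpen_lt ?_ continuous_const).mem_nhds ?_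
    · exact (continuous_snd.sub (continuous_snd.comp (hjc.comp continuous_fst))).norm
    · have : ((e.lap, e.grad z.2, a, e.fn z.2 + 0) - (jet w z (w z)).2 : ℝ × E d × ℝ × ℝ) =
          (κ, 0, 0, 0) := by
        rw [hj, hj', he, add_zero]
        simp [ha, jet]
        rfl
      rw [mem_ofPred_eq, this]
      simp [Prod.norm_def, abs_of_pos hκ, hκ.le, hκ]
  obtain ⟨η, hη, hev⟩ := exists_FLin_le hcons hdiff hstep hPr hv e a B 0 z hρ hδ
    (show 0 < ε / 4 by positivity) hU
  have hnear : ∀ᶠ z' in 𝓝 z,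
      dist z' z ≤ ρ ∧ e.fn z'.2 + timeQuad a B z.1 z'.1 - η ≤ w z' := by
    have hc : Continuous fun z' : ℝ × E d => e.fn z'.2 + timeQuad a B z.1 z'.1 - η - w z' := by
      have h1 := e.continuous_fn
      have h2 := hw.continuous
      unfold timeQuad
      fun_prop
    have h0 : ∀ᶠ z' in 𝓝 z, e.fn z'.2 + timeQuad a B z.1 z'.1 - η - w z' < 0 :=
      hc.continuousAt.eventually_lt continuousAt_const (by simp [timeQuad, he, hη])
    filter_upwards [Metric.closedBall_mem_nhds z hρ, h0] with z' h1 h2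
    exact ⟨h1, by linarith⟩
  have h1 := hz.frequently hnear
  have h2 := h1.and_eventually ((hev.filter_mono inf_le_left).and (mem_inf_of_right (mem_principal_self bad)))
  obtain ⟨i, ⟨hi1, hi2⟩, hi3, hi4⟩ := h2.exists
  replace hi4 : 1 < v i (n i).1 (n i).2 - w (ζ i) := hi4
  -- With `μ` the maximal excess, `w + μ` lies above the grid function and meets it at `ζ i`, which
  -- is close to `z`. The result `FLin ≤ ε / 4` contradicts `FLin ≥ ε - ε / 2`.
  obtain ⟨ξ, hξU, hξQ, hξ⟩ := hi3 (v i (n i).1 (n i).2 - w (ζ i)) (by linarith)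
    (fun k hk y hy hdist => by
      have h3 := hle _ hdist
      have h4 := hn i k hk y hy
      rw [timeQuad]
      linarith)
    ⟨(n i).1, (hnN i).1, (n i).2, (hnN i).2, hi1, by linarith⟩
  have h5 := hξ α
  have h6 := hLip ξ.1 hξQ ξ.2 (jet w ξ.1 (w ξ.1)).2
  have h7 := hsuper ξ.1 hξQ
  have h8 : K * ‖ξ.2 - (jet w ξ.1 (w ξ.1)).2‖ ≤ K * (2 * κ) := by
    have := le_of_lt (show ‖ξ.2 - (jet w ξ.1 (w ξ.1)).2‖ < 2 * κ from hξU)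
    gcongr
  have h9 : 𝔭.FLin α (ξ.1, ξ.2) - 𝔭.FLin α (ξ.1, (jet w ξ.1 (w ξ.1)).2) ≥ -(ε / 2) := by
    linarith [(abs_le.1 h6).1]
  change ε ≤ 𝔭.FLin α (ξ.1, (jet w ξ.1 (w ξ.1)).2) at h7
  linarith

/-- Numerical solutions are bounded uniformly in the refinement level. -/
theorem exists_bound [CompactSpace A] (hd : 0 < d) (hcons : 𝔰.IsConsistent)
    (hdiff : 𝔰.HasArtificialDiffusion) (hstep : 𝔰.TimeStepRestriction) (hPr : 𝔰.IsProjection Pr)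
    (hv : 𝔰.IsNumericalSolution v) (hsuper : 𝔭.HasStrictSupersolution) :
    ∃ C, ∀ᶠ i in atTop, ∀ k ≤ 𝔰.N i, ∀ y ∈ (𝔰.mesh i).vertices, |v i k y| ≤ C := by
  obtain ⟨α, w, hw, ε, hε, h⟩ := hsuper
  have : Nonempty A := ⟨α⟩
  obtain ⟨C, hC⟩ := Problem.isCompact_Q (𝔭 := 𝔭).exists_bound_of_continuousOn hw.continuous.continuousOn
  refine ⟨C + 1, ?_⟩
  filter_upwards [eventually_le_supersolution hd hcons hdiff hstep hPr hv hw hε h] with i hi k hk y hy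
  rw [abs_of_nonneg (hv.nonneg hcons hdiff hstep hk y hy)]
  have := (le_abs_self _).trans (hC _ (mem_Q hk (𝔰.vertex_mem hy)))
  linarith [hi k hk y hy]

end Discretisation

end HJBFEM

/-! ### Semicontinuous envelopes and limits along nodes -/

namespace HJBFEM

section Envelopes

variable {X : Type*} [TopologicalSpace X] {S : Set X} {u : X → ℝ} {C : ℝ} {x : X}

/-- No boundedness is needed, since the real infimum is by definition the negated supremum of the
negated set. All lower statements thus reduce to upper ones. -/
theorem lowerEnvelope_eq_neg (S : Set X) (u : X → ℝ) (x : X) :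
    lowerEnvelope S u x = -upperEnvelope S (-u) x := by
  rw [lowerEnvelope, upperEnvelope, liminf_eq, limsup_eq, Real.sInf_def, neg_neg]
  congr 1
  ext a
  simp

theorem isBoundedUnder_le_of_abs_le (hu : ∀ x ∈ S, |u x| ≤ C) :
    IsBoundedUnder (· ≤ ·) (𝓝[S] x) u :=
  isBoundedUnder_of_eventually_le (a := C)
    (eventually_mem_nhdsWithin.mono fun y hy => (abs_le.1 (hu y hy)).2)

theorem isBoundedUnder_ge_of_abs_le (hu : ∀ x ∈ S, |u x| ≤ C) :
    IsBoundedUnder (· ≥ ·) (𝓝[S] x) u :=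
  isBoundedUnder_of_eventually_ge (a := -C)
    (eventually_mem_nhdsWithin.mono fun y hy => (abs_le.1 (hu y hy)).1)

theorem le_upperEnvelope (hu : ∀ x ∈ S, |u x| ≤ C) (hx : x ∈ S) : u x ≤ upperEnvelope S u x :=
  le_limsup_of_frequently_le
    (fun h => (mem_of_mem_nhdsWithin hx h : ¬ u x ≤ u x) le_rfl) (isBoundedUnder_le_of_abs_le hu)

theorem eventually_lt_of_upperEnvelope_lt (hu : ∀ x ∈ S, |u x| ≤ C) {b : ℝ}
    (hb : upperEnvelope S u x < b) : ∀ᶠ y in 𝓝[S] x, u y < b :=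
  eventually_lt_of_limsup_lt hb (isBoundedUnder_le_of_abs_le hu)

theorem upperEnvelope_le (hu : ∀ x ∈ S, |u x| ≤ C) (hx : x ∈ S) {b : ℝ}
    (h : ∀ᶠ y in 𝓝[S] x, u y ≤ b) : upperEnvelope S u x ≤ b := by
  have : (𝓝[S] x).NeBot := mem_closure_iff_nhdsWithin_neBot.1 (subset_closure hx)
  exact limsup_le_of_le (isBoundedUnder_ge_of_abs_le hu).isCoboundedUnder_le h

theorem abs_upperEnvelope_le (hu : ∀ x ∈ S, |u x| ≤ C) (hx : x ∈ S) :
    |upperEnvelope S u x| ≤ C :=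
  abs_le.2 ⟨(abs_le.1 (hu x hx)).1.trans (le_upperEnvelope hu hx),
    upperEnvelope_le hu hx (eventually_mem_nhdsWithin.mono fun y hy => (abs_le.1 (hu y hy)).2)⟩

theorem upperSemicontinuousOn_upperEnvelope (hu : ∀ x ∈ S, |u x| ≤ C) :
    UpperSemicontinuousOn (upperEnvelope S u) S := by
  intro x hx b hb
  obtain ⟨b', hb', hb'b⟩ := exists_between hb
  have h := eventually_eventually_nhdsWithin.2 (eventually_lt_of_upperEnvelope_lt hu hb')
  filter_upwards [h, self_mem_nhdsWithin] with y hy hyS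
  exact (upperEnvelope_le hu hyS (hy.mono fun _ h => h.le)).trans_lt hb'b

theorem upperEnvelope_eq (hu : ∀ x ∈ S, |u x| ≤ C) (hu' : UpperSemicontinuousOn u S) (hx : x ∈ S) :
    upperEnvelope S u x = u x :=
  le_antisymm (le_of_forall_gt_imp_ge_of_dense fun b hb =>
    upperEnvelope_le hu hx ((hu' x hx b hb).mono fun _ h => h.le)) (le_upperEnvelope hu hx)

end Envelopes

variable {d : ℕ} {A : Type*} [TopologicalSpace A] {𝔭 : Problem d A}

namespace Discretisation

variable (𝔰 : Discretisation 𝔭) {v : ℕ → ℕ → E d → ℝ} {z : ℝ × E d}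

theorem eventually_nodesTo {p : ℕ × ℕ × E d → Prop} : (∀ᶠ n in 𝔰.nodesTo z, p n) ↔
    ∃ ρ > 0, ∀ᶠ i in atTop, ∀ k ≤ 𝔰.N i, ∀ y ∈ (𝔰.mesh i).vertices,
      dist ((k : ℝ) * 𝔰.h i, y) z ≤ ρ → p (i, k, y) := by
  have hb := (((atTop_basis (α := ℕ)).comap (fun n : ℕ × ℕ × E d => n.1)).inf
    ((Metric.nhds_basis_closedBall (x := z)).comap
      (fun n : ℕ × ℕ × E d => ((n.2.1 : ℝ) * 𝔰.h n.1, n.2.2)))).inf_principal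
        {n | n.2.1 ≤ 𝔰.N n.1 ∧ n.2.2 ∈ (𝔰.mesh n.1).vertices}
  rw [nodesTo, hb.eventually_iff]
  constructor
  · rintro ⟨⟨i₀, ρ⟩, ⟨-, hρ⟩, h⟩
    refine ⟨ρ, hρ, ?_⟩
    filter_upwards [eventually_ge_atTop i₀] with i hi k hk y hy hd
    exact h ⟨⟨hi, hd⟩, hk, hy⟩
  · rintro ⟨ρ, hρ, h⟩
    obtain ⟨i₀, hi₀⟩ := eventually_atTop.1 h
    refine ⟨(i₀, ρ), ⟨trivial, hρ⟩, ?_⟩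
    rintro ⟨i, k, y⟩ ⟨⟨hi, hd⟩, hk, hy⟩
    exact hi₀ i hi k hk y hy hd

/-- Along the trivial filter the limit superior would be `⊥`. Nodes near `z` exist on all fine
levels: a vertex of an element that contains the space point, at the time step just before the time.
-/
theorem nodesTo_neBot (hz : z ∈ 𝔭.Q) : (𝔰.nodesTo z).NeBot := by
  rw [neBot_iff]
  intro hbot
  have hev : ∀ᶠ n in 𝔰.nodesTo z, False := by rw [hbot]; exact eventually_bot
  obtain ⟨ρ, hρ, h⟩ := 𝔰.eventually_nodesTo.1 hev
  obtain ⟨i, hi, hs, hh⟩ := (h.and ((𝔰.size_tendsto.eventually (gt_mem_nhds hρ)).and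
    (𝔰.h_tendsto.eventually (gt_mem_nhds hρ)))).exists
  obtain ⟨⟨ht0, htT⟩, hx⟩ := hz
  obtain ⟨s, hs', hxs⟩ := Mesh.exists_element (𝔰.isMesh i) hx
  obtain ⟨y, hy⟩ := (𝔰.mesh i).nonempty_of_mem_faces hs'.1
  have hpos := 𝔰.h_pos i
  refine hi ⌊z.1 / 𝔰.h i⌋₊ ?_ y (Mesh.mem_vertices_of_mem hs'.1 hy) ?_
  · refine Nat.floor_le_of_le ?_
    rw [div_le_iff₀ hpos, 𝔰.N_mul_h]
    exact htT
  · refine max_le ?_ ((𝔰.dist_le_size hs' (subset_convexHull ℝ _ hy) hxs).trans hs.le)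
    have h1 := Nat.floor_le (div_nonneg ht0 hpos.le)
    have h2 := Nat.lt_floor_add_one (z.1 / 𝔰.h i)
    rw [le_div_iff₀ hpos] at h1
    rw [div_lt_iff₀ hpos, add_mul, one_mul] at h2
    rw [Real.dist_eq, abs_le]
    constructor <;> linarith

/-- `U` is the (finite) upper envelope of the grid functions `v` on the closed cylinder. -/
structure IsUpperLimit (v : ℕ → ℕ → E d → ℝ) (U : ℝ × E d → ℝ) : Prop where
  le : ∀ z ∈ 𝔭.Q, ∀ ε > 0, ∃ ρ > 0, ∀ᶠ i in atTop, ∀ k ≤ 𝔰.N i, ∀ y ∈ (𝔰.mesh i).vertices,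
    dist ((k : ℝ) * 𝔰.h i, y) z ≤ ρ → v i k y ≤ U z + ε
  frequently : ∀ z ∈ 𝔭.Q, ∀ ε > 0, ∀ ρ > 0, ∃ᶠ i in atTop, ∃ k ≤ 𝔰.N i,
    ∃ y ∈ (𝔰.mesh i).vertices, dist ((k : ℝ) * 𝔰.h i, y) z ≤ ρ ∧ U z - ε ≤ v i k y

theorem upperLimit_finite {C : ℝ}
    (hC : ∀ᶠ i in atTop, ∀ k ≤ 𝔰.N i, ∀ y ∈ (𝔰.mesh i).vertices, |v i k y| ≤ C) (hz : z ∈ 𝔭.Q) :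
    ((𝔰.upperLimit v z).toReal : EReal) = 𝔰.upperLimit v z ∧ |(𝔰.upperLimit v z).toReal| ≤ C := by
  have := 𝔰.nodesTo_neBot hz
  have hev : ∀ᶠ n in 𝔰.nodesTo z, |v n.1 n.2.1 n.2.2| ≤ C :=
    𝔰.eventually_nodesTo.2 ⟨1, one_pos, hC.mono fun i hi k hk y hy _ => hi k hk y hy⟩
  have h1 : 𝔰.upperLimit v z ≤ (C : EReal) := limsup_le_of_le (by isBoundedDefault)
    (hev.mono fun n hn => EReal.coe_le_coe_iff.2 (abs_le.1 hn).2)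
  have h2 : ((-C : ℝ) : EReal) ≤ 𝔰.upperLimit v z := le_limsup_of_frequently_le
    (hev.mono fun n hn => EReal.coe_le_coe_iff.2 (abs_le.1 hn).1).frequently (by isBoundedDefault)
  have h3 : ((𝔰.upperLimit v z).toReal : EReal) = 𝔰.upperLimit v z :=
    EReal.coe_toReal (fun h => by simp [h] at h1) (fun h => by simp [h] at h2)
  refine ⟨h3, ?_⟩
  rw [← h3, EReal.coe_le_coe_iff] at h1 h2
  exact abs_le.2 ⟨h2, h1⟩

theorem isUpperLimit_upperLimit {C : ℝ}
    (hC : ∀ᶠ i in atTop, ∀ k ≤ 𝔰.N i, ∀ y ∈ (𝔰.mesh i).vertices, |v i k y| ≤ C) :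
    𝔰.IsUpperLimit v fun z => (𝔰.upperLimit v z).toReal where
  le z hz ε hε := by
    have h := (𝔰.upperLimit_finite hC hz).1
    refine (𝔰.eventually_nodesTo (p := fun n => v n.1 n.2.1 n.2.2 ≤ _ + ε)).1 ?_
    have h2 : 𝔰.upperLimit v z < (((𝔰.upperLimit v z).toReal + ε : ℝ) : EReal) := by
      conv_lhs => rw [← h]
      exact EReal.coe_lt_coe_iff.2 (by linarith)
    exact (eventually_lt_of_limsup_lt h2).mono fun n hn => (EReal.coe_lt_coe_iff.1 hn).le
  frequently z hz ε hε ρ hρ := by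
    have h := (𝔰.upperLimit_finite hC hz).1
    have h2 : (((𝔰.upperLimit v z).toReal - ε : ℝ) : EReal) < 𝔰.upperLimit v z := by
      conv_rhs => rw [← h]
      exact EReal.coe_lt_coe_iff.2 (by linarith)
    intro hcon
    refine frequently_lt_of_lt_limsup (by isBoundedDefault) h2
      (𝔰.eventually_nodesTo.2 ⟨ρ, hρ, hcon.mono fun i hi k hk y hy hd hlt => ?_⟩)
    exact hi ⟨k, hk, y, hy, hd, (EReal.coe_lt_coe_iff.1 hlt).le⟩

theorem lowerLimit_eq_neg (v : ℕ → ℕ → E d → ℝ) (z : ℝ × E d) :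
    𝔰.lowerLimit v z = -𝔰.upperLimit (-v) z := by
  have h : (fun n : ℕ × ℕ × E d => (((-v) n.1 n.2.1 n.2.2 : ℝ) : EReal)) =
      -fun n : ℕ × ℕ × E d => (v n.1 n.2.1 n.2.2 : EReal) := funext fun n => EReal.coe_neg _
  rw [upperLimit, lowerLimit, h, EReal.limsup_neg, neg_neg]

variable {𝔰} {U : ℝ × E d → ℝ}

/-- Values near `U z'` are attained at nodes close to `z'`, and for `z'` close to `z` these nodes
are also governed by the upper bound at `z`. -/
theorem IsUpperLimit.upperSemicontinuousOn (hU : 𝔰.IsUpperLimit v U) :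
    UpperSemicontinuousOn U 𝔭.Q := by
  intro z hz b hb
  obtain ⟨ρ, hρ, h⟩ := hU.le z hz ((b - U z) / 3) (by linarith)
  filter_upwards [self_mem_nhdsWithin, mem_nhdsWithin_of_mem_nhds (Metric.closedBall_mem_nhds z (half_pos hρ))]
    with z' hz' hd
  obtain ⟨i, ⟨k, hk, y, hy, hd', h1⟩, h2⟩ :=
    ((hU.frequently z' hz' ((b - U z) / 3) (by linarith) (ρ / 2) (half_pos hρ)).and_eventually h).exists
  have h3 := h2 k hk y hy (by
    rw [Metric.mem_closedBall] at hd
    linarith [dist_triangle ((k : ℝ) * 𝔰.h i, y) z' z])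
  linarith

/-- Bounds for the upper envelope hold approximately and uniformly for the grid functions. -/
theorem IsUpperLimit.eventually_le (hU : 𝔰.IsUpperLimit v U) {K : Set (ℝ × E d)} (hK : IsCompact K)
    (hKQ : K ⊆ 𝔭.Q) {φ : ℝ × E d → ℝ} (hφ : ContinuousOn φ K) (hUφ : ∀ z ∈ K, U z ≤ φ z) {η : ℝ}
    (hη : 0 < η) : ∀ᶠ i in atTop, ∀ k ≤ 𝔰.N i, ∀ y ∈ (𝔰.mesh i).vertices,
      ((k : ℝ) * 𝔰.h i, y) ∈ K → v i k y ≤ φ (k * 𝔰.h i, y) + η := by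
  -- Membership in `K` is doubled: compact induction varies one copy over subsets, the other keeps
  -- the nodes in `K`.
  suffices h : ∀ᶠ i in atTop, ∀ k ≤ 𝔰.N i, ∀ y ∈ (𝔰.mesh i).vertices,
      ((k : ℝ) * 𝔰.h i, y) ∈ K → ((k : ℝ) * 𝔰.h i, y) ∈ K → v i k y ≤ φ (k * 𝔰.h i, y) + η from
    h.mono fun i hi k hk y hy hK => hi k hk y hy hK hK
  refine hK.induction_on (p := fun t => ∀ᶠ i in atTop, ∀ k ≤ 𝔰.N i, ∀ y ∈ (𝔰.mesh i).vertices,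
      ((k : ℝ) * 𝔰.h i, y) ∈ t → ((k : ℝ) * 𝔰.h i, y) ∈ K → v i k y ≤ φ (k * 𝔰.h i, y) + η) ?_ ?_ ?_ ?_
  · simp
  · exact fun s t hst ht => ht.mono fun i hi k hk y hy hs => hi k hk y hy (hst hs)
  · intro s t hs ht
    filter_upwards [hs, ht] with i h1 h2 k hk y hy h
    exact h.elim (h1 k hk y hy) (h2 k hk y hy)
  · intro z hz
    obtain ⟨ρ, hρ, h⟩ := hU.le z (hKQ hz) (η / 2) (half_pos hη)
    have h1 : ∀ᶠ z' in 𝓝[K] z, φ z - η / 2 < φ z' :=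
      (hφ z hz).eventually (lt_mem_nhds (by linarith))
    refine ⟨{z' | φ z - η / 2 < φ z'} ∩ Metric.closedBall z ρ, inter_mem h1
      (mem_nhdsWithin_of_mem_nhds (Metric.closedBall_mem_nhds z hρ)), ?_⟩
    filter_upwards [h] with i hi k hk y hy hmem _
    have h2 := hi k hk y hy hmem.2
    have h3 : φ z - η / 2 < φ (k * 𝔰.h i, y) := hmem.1
    linarith [hUφ z hz]

/-- At a local maximum of `U - ψ` the grid functions are touched from above by a quadratic function
with almost the derivatives of `ψ`. -/
theorem IsUpperLimit.frequently_touching (hU : 𝔰.IsUpperLimit v U) (hd : 0 < d)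
    {ψ : ℝ × E d → ℝ} (hψ : ContDiff ℝ 2 ψ) (hz : z ∈ 𝔭.Q)
    (hmax : IsLocalMaxOn (fun z' => U z' - ψ z') 𝔭.Q z) {κ : ℝ} (hκ : 0 < κ) :
    ∃ (e : Quad d) (B ρ δ : ℝ), 0 < ρ ∧ 0 < δ ∧
      (e.lap, e.grad z.2, (jet ψ z (U z)).2.2.2.1, e.fn z.2 + (U z - ψ z)) =
        (jet ψ z (U z)).2 + (κ, 0, 0, 0) ∧
      ∀ η > 0, ∃ᶠ i in atTop,
        (∀ k ≤ 𝔰.N i, ∀ y ∈ (𝔰.mesh i).vertices, dist ((k : ℝ) * 𝔰.h i, y) z ≤ ρ →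
          v i k y ≤ e.fn y + timeQuad (jet ψ z (U z)).2.2.2.1 B z.1 (k * 𝔰.h i) +
            ((U z - ψ z) + η - δ * dist ((k : ℝ) * 𝔰.h i, y) z ^ 2)) ∧
        ∃ k ≤ 𝔰.N i, ∃ y ∈ (𝔰.mesh i).vertices, dist ((k : ℝ) * 𝔰.h i, y) z ≤ ρ ∧
          e.fn y + timeQuad (jet ψ z (U z)).2.2.2.1 B z.1 (k * 𝔰.h i) + ((U z - ψ z) - η) ≤ v i k y := by
  obtain ⟨e, B, ρ₁, δ, hρ₁, hδ, he, hj, hj', hle⟩ := exists_quad_above hd hψ z hκ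
  obtain ⟨ρ₂, hρ₂, hball⟩ := (nhdsWithin_hasBasis Metric.nhds_basis_closedBall _).eventually_iff.1 hmax
  refine ⟨e, B, min ρ₁ ρ₂, δ, lt_min hρ₁ hρ₂, hδ, ?_, fun η hη => ?_⟩
  · rw [hj, hj', he, add_sub_cancel]
    simp [jet]
  · set a := (jet ψ z (U z)).2.2.2.1
    have hK : IsCompact (Metric.closedBall z (min ρ₁ ρ₂) ∩ 𝔭.Q) :=
      Problem.isCompact_Q.inter_left Metric.isClosed_closedBall
    have hA := hU.eventually_le hK inter_subset_right (φ := fun z' => ψ z' + (U z - ψ z))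
      (hψ.continuous.add continuous_const).continuousOn (fun z' hz' => by
        have := hball ⟨Metric.closedBall_subset_closedBall (min_le_right _ _) hz'.1, hz'.2⟩
        linarith) hη
    have hc : Continuous fun z' : ℝ × E d => e.fn z'.2 + timeQuad a B z.1 z'.1 := by
      have := e.continuous_fn
      unfold timeQuad
      fun_prop
    have h0 : ∀ᶠ z' in 𝓝 z, e.fn z'.2 + timeQuad a B z.1 z'.1 < ψ z + η / 2 :=
      hc.continuousAt.eventually_lt continuousAt_const (by simp [timeQuad, he, hη])
    obtain ⟨ρ₃, hρ₃, hball'⟩ := Metric.nhds_basis_closedBall.eventually_iff.1 h0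
    -- The contact is almost attained near `z` infinitely often, while the upper bound holds on all
    -- late levels; hence both hold frequently, which is enough for a contradiction later.
    have hB := hU.frequently z hz (η / 2) (half_pos hη) (min (min ρ₁ ρ₂) ρ₃)
      (lt_min (lt_min hρ₁ hρ₂) hρ₃)
    refine (hB.and_eventually hA).mono ?_
    rintro i ⟨⟨k₀, hk₀, y₀, hy₀, hd₀, hB⟩, hA⟩
    refine ⟨fun k hk y hy hdist => ?_, k₀, hk₀, y₀, hy₀, hd₀.trans (min_le_left _ _), ?_⟩
    · have h1 := hA k hk y hy ⟨hdist, mem_Q hk (𝔰.vertex_mem hy)⟩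
      have h2 := hle _ (hdist.trans (min_le_left _ _))
      have h3 : a * (k * 𝔰.h i - z.1) + B * (k * 𝔰.h i - z.1) ^ 2 =
        timeQuad a B z.1 (k * 𝔰.h i) := rfl
      change _ ≤ e.fn y + (a * (k * 𝔰.h i - z.1) + B * (k * 𝔰.h i - z.1) ^ 2) at h2
      rw [h3] at h2
      linarith
    · have h1 := hball' (hd₀.trans (min_le_right _ _))
      simp only at h1
      linarith

end Discretisation

end HJBFEM

/-! ### The envelopes as viscosity sub- and supersolutions -/

namespace HJBFEM

variable {d : ℕ} {A : Type*} [TopologicalSpace A] {𝔭 : Problem d A}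

namespace Problem

/-- A positive lower envelope bounds `F` away from zero on a whole neighbourhood. This leaves room
for the perturbed Laplacian, the discretised jet and the consistency error. -/
theorem eventually_lt_F {J : OpArg d} (h : 0 < 𝔭.FLower J) :
    ∃ ε > 0, ∀ᶠ ζ in 𝓝 J, ζ.1 ∈ 𝔭.Q → ε < 𝔭.F ζ := by
  obtain ⟨ε, hε, hlt⟩ := EReal.lt_iff_exists_real_btwn.1 h
  refine ⟨ε, EReal.coe_pos.1 hε, ?_⟩
  have := eventually_lt_of_lt_liminf hlt
  rw [eventually_nhdsWithin_iff] at this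
  exact this.mono fun ζ hζ hQ => EReal.coe_lt_coe_iff.1 (hζ ⟨hQ, mem_univ _⟩)

theorem eventually_F_lt {J : OpArg d} (h : 𝔭.FUpper J < 0) :
    ∃ ε > 0, ∀ᶠ ζ in 𝓝 J, ζ.1 ∈ 𝔭.Q → 𝔭.F ζ < -ε := by
  obtain ⟨ε, hlt, hε⟩ := EReal.lt_iff_exists_real_btwn.1 h
  refine ⟨-ε, neg_pos.2 (EReal.coe_neg'.1 hε), ?_⟩
  have := eventually_lt_of_limsup_lt hlt
  rw [eventually_nhdsWithin_iff] at this
  refine this.mono fun ζ hζ hQ => ?_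
  rw [neg_neg]
  exact EReal.coe_lt_coe_iff.1 (hζ ⟨hQ, mem_univ _⟩)

/-- Neighbourhoods of a jet are neighbourhoods of jets with slightly perturbed Laplacian. -/
theorem exists_perturbation {J : OpArg d} {p : OpArg d → Prop} (h : ∀ᶠ ζ in 𝓝 J, p ζ) :
    ∃ κ > 0, {ζ | p ζ} ∈ 𝓝 (J.1, J.2 + (κ, 0, 0, 0)) ∧ {ζ | p ζ} ∈ 𝓝 (J.1, J.2 - (κ, 0, 0, 0)) := by
  have h1 := eventually_eventually_nhds.2 h
  have hp : Tendsto (fun κ : ℝ => ((J.1, J.2 + (κ, 0, 0, 0)) : OpArg d)) (𝓝 0) (𝓝 J) := by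
    have : Continuous (fun κ : ℝ => ((J.1, J.2 + (κ, 0, 0, 0)) : OpArg d)) := by fun_prop
    convert this.tendsto 0
    simp [← Prod.zero_eq_mk]
  have hm : Tendsto (fun κ : ℝ => ((J.1, J.2 - (κ, 0, 0, 0)) : OpArg d)) (𝓝 0) (𝓝 J) := by
    have : Continuous (fun κ : ℝ => ((J.1, J.2 - (κ, 0, 0, 0)) : OpArg d)) := by fun_prop
    convert this.tendsto 0
    simp [← Prod.zero_eq_mk]
  have h2 := ((hp.eventually h1).and (hm.eventually h1)).filter_mono
    (nhdsWithin_le_nhds (s := Ioi 0))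
  obtain ⟨κ, ⟨h3, h4⟩, hκ⟩ := (h2.and self_mem_nhdsWithin).exists
  exact ⟨κ, hκ, h3, h4⟩

theorem IsSupersolution.congr {u w : ℝ × E d → ℝ} (hu : 𝔭.IsSupersolution u)
    (h : EqOn u w 𝔭.Q) : 𝔭.IsSupersolution w := by
  have henv : lowerEnvelope 𝔭.Q u = lowerEnvelope 𝔭.Q w := funext fun z =>
    liminf_congr (eventually_mem_nhdsWithin.mono fun _ hy => h hy)
  obtain ⟨⟨C, hC⟩, hu⟩ := hu
  exact ⟨⟨C, fun z hz => h hz ▸ hC z hz⟩, henv ▸ hu⟩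

/-- The upper envelope of a subsolution is a subsolution. -/
theorem IsSubsolution.upperEnvelope {u : ℝ × E d → ℝ} (hu : 𝔭.IsSubsolution u) :
    UpperSemicontinuousOn (upperEnvelope 𝔭.Q u) 𝔭.Q ∧ 𝔭.IsSubsolution (upperEnvelope 𝔭.Q u) := by
  obtain ⟨⟨C, hC⟩, hu⟩ := hu
  have husc := upperSemicontinuousOn_upperEnvelope hC
  have hC' : ∀ z ∈ 𝔭.Q, |HJBFEM.upperEnvelope 𝔭.Q u z| ≤ C := fun z hz => abs_upperEnvelope_le hC hz
  have hidem : ∀ z ∈ 𝔭.Q, HJBFEM.upperEnvelope 𝔭.Q (HJBFEM.upperEnvelope 𝔭.Q u) z =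
      HJBFEM.upperEnvelope 𝔭.Q u z := fun z hz => upperEnvelope_eq hC' husc hz
  refine ⟨husc, ⟨C, hC'⟩, fun ψ hψ z hz hmax => ?_⟩
  rw [hidem z hz]
  refine hu ψ hψ z hz (hmax.congr (eventually_mem_nhdsWithin.mono fun z' hz' => ?_) ?_)
  · simp only [hidem z' hz']
  · exact hz

/-- The lower envelope of a supersolution is a supersolution. -/
theorem IsSupersolution.lowerEnvelope {u : ℝ × E d → ℝ} (hu : 𝔭.IsSupersolution u) :
    LowerSemicontinuousOn (lowerEnvelope 𝔭.Q u) 𝔭.Q ∧ 𝔭.IsSupersolution (lowerEnvelope 𝔭.Q u) := by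
  obtain ⟨⟨C, hC⟩, hu⟩ := hu
  have hC₁ : ∀ z ∈ 𝔭.Q, |(-u) z| ≤ C := fun z hz => by rw [Pi.neg_apply, abs_neg]; exact hC z hz
  have heq : HJBFEM.lowerEnvelope 𝔭.Q u = -HJBFEM.upperEnvelope 𝔭.Q (-u) :=
    funext fun z => lowerEnvelope_eq_neg _ _ _
  have husc := upperSemicontinuousOn_upperEnvelope hC₁
  have hC' : ∀ z ∈ 𝔭.Q, |HJBFEM.upperEnvelope 𝔭.Q (-u) z| ≤ C :=
    fun z hz => abs_upperEnvelope_le hC₁ hz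
  have hidem : ∀ z ∈ 𝔭.Q, HJBFEM.lowerEnvelope 𝔭.Q (HJBFEM.lowerEnvelope 𝔭.Q u) z =
      HJBFEM.lowerEnvelope 𝔭.Q u z := fun z hz => by
    rw [lowerEnvelope_eq_neg, heq, neg_neg, upperEnvelope_eq hC' husc hz, Pi.neg_apply]
  refine ⟨?_, ⟨C, fun z hz => ?_⟩, fun ψ hψ z hz hmin => ?_⟩
  · rw [heq]
    intro z hz b hb
    exact (husc z hz (-b) (by simpa using neg_lt_neg hb)).mono fun z' h => by
      simpa using neg_lt_neg h
  · rw [heq, Pi.neg_apply, abs_neg]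
    exact hC' z hz
  · rw [hidem z hz]
    refine hu ψ hψ z hz (hmin.congr (eventually_mem_nhdsWithin.mono fun z' hz' => ?_) ?_)
    · simp only [hidem z' hz']
    · exact hz

end Problem

namespace Discretisation

variable {𝔰 : Discretisation 𝔭} {Pr : ∀ i, smoothFunctions d →ₗ[ℝ] (𝔰.mesh i).P1}
  {v : ℕ → ℕ → E d → ℝ} {U : ℝ × E d → ℝ} {C : ℝ}

/-- The upper envelope of the numerical solutions is a subsolution. -/
theorem IsUpperLimit.isSubsolution [CompactSpace A] [Nonempty A] (hd : 0 < d)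
    (hcons : 𝔰.IsConsistent) (hdiff : 𝔰.HasArtificialDiffusion) (hstep : 𝔰.TimeStepRestriction)
    (hPr : 𝔰.IsProjection Pr) (hv : 𝔰.IsNumericalSolution v) (hU : 𝔰.IsUpperLimit v U)
    (hC : ∀ z ∈ 𝔭.Q, |U z| ≤ C) : 𝔭.IsSubsolution U := by
  have henv : ∀ z ∈ 𝔭.Q, upperEnvelope 𝔭.Q U z = U z :=
    fun z hz => upperEnvelope_eq hC hU.upperSemicontinuousOn hz
  refine ⟨⟨C, hC⟩, fun ψ hψ z hz hmax => ?_⟩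
  rw [henv z hz]
  have hmax' : IsLocalMaxOn (fun z' => U z' - ψ z') 𝔭.Q z :=
    hmax.congr (eventually_mem_nhdsWithin.mono fun z' hz' => by simp only [henv z' hz'])
      hz
  by_contra! hcon
  obtain ⟨ε, hε, hF⟩ := Problem.eventually_lt_F hcon
  obtain ⟨κ, hκ, hnhds, -⟩ := Problem.exists_perturbation hF
  obtain ⟨e, B, ρ, δ, hρ, hδ, hj, hfreq⟩ := hU.frequently_touching hd hψ hz hmax' hκ
  rw [← hj] at hnhds
  obtain ⟨η, hη, hev⟩ := exists_FLin_le hcons hdiff hstep hPr hv e _ B _ z hρ hδ hε hnhds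
  obtain ⟨i, ⟨hA, hB⟩, hi⟩ := ((hfreq η hη).and_eventually hev).exists
  -- Here the test function makes contact with `U` itself, so the excess `μ` is zero.
  obtain ⟨ζ, hζ, hζQ, hle⟩ := hi 0 le_rfl (by simpa only [add_zero] using hA)
    (by simpa only [add_zero] using hB)
  exact absurd (Problem.F_le hle) (not_le.2 (hζ hζQ))

/-- The lower envelope of the numerical solutions is a supersolution. -/
theorem IsUpperLimit.isSupersolution [CompactSpace A] [Nonempty A] (hd : 0 < d)
    (hcons : 𝔰.IsConsistent) (hdiff : 𝔰.HasArtificialDiffusion) (hstep : 𝔰.TimeStepRestriction)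
    (hPr : 𝔰.IsProjection Pr) (hv : 𝔰.IsNumericalSolution v) (hU : 𝔰.IsUpperLimit (-v) U)
    (hC : ∀ z ∈ 𝔭.Q, |U z| ≤ C) : 𝔭.IsSupersolution (-U) := by
  have henv : ∀ z ∈ 𝔭.Q, lowerEnvelope 𝔭.Q (-U) z = -U z := fun z hz => by
    rw [lowerEnvelope_eq_neg, neg_neg, upperEnvelope_eq hC hU.upperSemicontinuousOn hz]
  refine ⟨⟨C, fun z hz => by rw [Pi.neg_apply, abs_neg]; exact hC z hz⟩, fun ψ hψ z hz hmin => ?_⟩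
  rw [henv z hz]
  have hmax : IsLocalMaxOn (fun z' => U z' - (-ψ) z') 𝔭.Q z := by
    have h := hmin.neg
    refine h.congr (eventually_mem_nhdsWithin.mono fun z' hz' => ?_) ?_
    · simp only [henv z' hz', Pi.neg_apply]; ring
    · exact hz
  by_contra! hcon
  obtain ⟨ε, hε, hF⟩ := Problem.eventually_F_lt hcon
  obtain ⟨κ, hκ, -, hnhds⟩ := Problem.exists_perturbation hF
  have hψ' : ContDiff ℝ 2 (-ψ) := hψ.neg
  obtain ⟨e, B, ρ, δ, hρ, hδ, hj, hfreq⟩ := hU.frequently_touching hd hψ' hz hmax hκ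
  -- Raising the Laplacian of `-ψ` by `κ` is lowering that of `ψ`; hence the other half of
  -- `exists_perturbation` is the one in use.
  have hjet : (jet ψ z (-U z)).2 - (κ, 0, 0, 0) = -((jet (-ψ) z (U z)).2 + (κ, 0, 0, 0)) := by
    have := jet_neg hψ z (-U z)
    rw [neg_neg] at this
    rw [this, neg_add, neg_neg, sub_eq_add_neg]
  rw [hjet, ← hj] at hnhds
  obtain ⟨η, hη, hev⟩ := exists_le_F hcons hdiff hstep hPr hv e _ B _ z hρ hδ hε hnhds
  obtain ⟨i, ⟨hA, hB⟩, hi⟩ := ((hfreq η hη).and_eventually hev).exists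
  obtain ⟨ζ, hζ, hζQ, hle⟩ := hi hA hB
  exact absurd (hζ hζQ) (not_lt.2 hle)

end Discretisation

end HJBFEM

/-! ### Uniform convergence and the main theorem -/

namespace HJBFEM

theorem tendsto_zero_of_eventually_le_ofReal {f : ℕ → ℝ≥0∞}
    (h : ∀ ε > 0, ∀ᶠ i in atTop, f i ≤ ENNReal.ofReal ε) : Tendsto f atTop (𝓝 0) := by
  refine ENNReal.tendsto_nhds_zero.2 fun ε hε => ?_
  obtain ⟨r, hr0, hr⟩ := ENNReal.lt_iff_exists_nnreal_btwn.1 hε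
  refine (h r (by exact_mod_cast hr0)).mono fun i hi => hi.trans ?_
  rw [ENNReal.ofReal_coe_nnreal]
  exact hr.le

variable {d : ℕ} {A : Type*} [TopologicalSpace A] {𝔭 : Problem d A}

namespace Discretisation

variable {𝔰 : Discretisation 𝔭} {v : ℕ → ℕ → E d → ℝ} {u U : ℝ × E d → ℝ}

/-- Bounded grid functions have a finite upper envelope. -/
theorem exists_isUpperLimit {C : ℝ}
    (hC : ∀ᶠ i in atTop, ∀ k ≤ 𝔰.N i, ∀ y ∈ (𝔰.mesh i).vertices, |v i k y| ≤ C) :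
    ∃ U, 𝔰.IsUpperLimit v U ∧ (∀ z ∈ 𝔭.Q, |U z| ≤ C) ∧
      ∀ z ∈ 𝔭.Q, 𝔰.upperLimit v z = (U z : EReal) :=
  ⟨_, 𝔰.isUpperLimit_upperLimit hC, fun _ hz => (𝔰.upperLimit_finite hC hz).2,
    fun _ hz => (𝔰.upperLimit_finite hC hz).1.symm⟩

/-- The lower envelope lies below the upper envelope. -/
theorem IsUpperLimit.neg_le {U' : ℝ × E d → ℝ} (hU : 𝔰.IsUpperLimit v U)
    (hU' : 𝔰.IsUpperLimit (-v) U') {z : ℝ × E d} (hz : z ∈ 𝔭.Q) : -U' z ≤ U z := by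
  refine le_of_forall_pos_le_add fun ε hε => ?_
  obtain ⟨ρ, hρ, h⟩ := hU'.le z hz (ε / 2) (half_pos hε)
  obtain ⟨ρ', hρ', h'⟩ := hU.le z hz (ε / 2) (half_pos hε)
  obtain ⟨i, ⟨k, hk, y, hy, hd, -⟩, h1, h2⟩ := ((hU.frequently z hz 1 one_pos (min ρ ρ')
    (lt_min hρ hρ')).and_eventually (h.and h')).exists
  have h3 := h1 k hk y hy (hd.trans (min_le_left _ _))
  have h4 := h2 k hk y hy (hd.trans (min_le_right _ _))
  simp only [Pi.neg_apply] at h3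
  linarith

/-- The grid functions attain the final time data, if the envelopes agree. -/
theorem IsUpperLimit.final_time (hv : 𝔰.IsNumericalSolution v) (hU : 𝔰.IsUpperLimit v u)
    (hU' : 𝔰.IsUpperLimit (-v) (-u)) {x : E d} (hx : x ∈ 𝔭.P) : u (𝔭.T, x) = 𝔭.vT x := by
  have hz : (𝔭.T, x) ∈ 𝔭.Q := ⟨⟨𝔭.T_pos.le, le_rfl⟩, hx⟩
  refine eq_of_abs_sub_eq_zero (le_antisymm (le_of_forall_pos_le_add fun ε hε => ?_) (abs_nonneg _))
  obtain ⟨ρ, hρ, h⟩ := hU'.le _ hz (ε / 2) (half_pos hε)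
  obtain ⟨ρ', hρ', h'⟩ := hU.le _ hz (ε / 2) (half_pos hε)
  obtain ⟨r, hr, hvT⟩ := Metric.continuousOn_iff.1 𝔭.vT_cont x hx (ε / 2) (half_pos hε)
  obtain ⟨i, h1, h2, hs⟩ := (h.and (h'.and (𝔰.size_tendsto.eventually
    (gt_mem_nhds (lt_min (lt_min hρ hρ') hr))))).exists
  obtain ⟨s, hs', hxs⟩ := Mesh.exists_element (𝔰.isMesh i) hx
  obtain ⟨y, hy⟩ := (𝔰.mesh i).nonempty_of_mem_faces hs'.1
  have hyv := Mesh.mem_vertices_of_mem hs'.1 hy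
  have hd := (𝔰.dist_le_size hs' (subset_convexHull ℝ _ hy) hxs).trans_lt hs
  have hd' : ∀ r, dist y x ≤ r → 0 ≤ r → dist ((𝔰.N i : ℝ) * 𝔰.h i, y) (𝔭.T, x) ≤ r :=
    fun r h h0 => by
      rw [Prod.dist_eq, 𝔰.N_mul_h, dist_self]
      exact max_le h0 h
  -- At the last time level the nodal values are those of `vT`. The two envelopes squeeze them to `u
  -- (T, x)`, while continuity of `vT` brings them to `vT x`.
  have h3 := h1 (𝔰.N i) le_rfl y hyv
    (hd' _ (hd.le.trans ((min_le_left _ _).trans (min_le_left _ _))) hρ.le)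
  have h4 := h2 (𝔰.N i) le_rfl y hyv
    (hd' _ (hd.le.trans ((min_le_left _ _).trans (min_le_right _ _))) hρ'.le)
  have h5 := abs_lt.1 (hvT y (𝔰.vertex_mem hyv) (hd.trans_le (min_le_right _ _)))
  simp only [Pi.neg_apply, (hv i).2.1 y hyv] at h3 h4
  rw [zero_add, abs_le]
  constructor <;> linarith

/-- Uniform convergence at the time steps. -/
theorem IsUpperLimit.eventually_abs_sub_le (hv : 𝔰.IsNumericalSolution v)
    (hU : 𝔰.IsUpperLimit v u) (hU' : 𝔰.IsUpperLimit (-v) (-u)) (hu : ContinuousOn u 𝔭.Q) {ε : ℝ}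
    (hε : 0 < ε) : ∀ᶠ i in atTop, ∀ k ≤ 𝔰.N i, ∀ x ∈ 𝔭.P, |v i k x - u (k * 𝔰.h i, x)| ≤ ε := by
  have hQ := Problem.isCompact_Q (𝔭 := 𝔭)
  obtain ⟨δ, hδ, huc⟩ := Metric.uniformContinuousOn_iff.1 (hQ.uniformContinuousOn_of_continuous hu)
    (ε / 2) (half_pos hε)
  filter_upwards [hU.eventually_le hQ subset_rfl hu (fun _ _ => le_rfl) (half_pos hε),
    hU'.eventually_le hQ subset_rfl hu.neg (fun _ _ => le_rfl) (half_pos hε),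
    𝔰.size_tendsto.eventually (gt_mem_nhds hδ)] with i h1 h2 hs k hk x hx
  obtain ⟨s, hs', hxs⟩ := Mesh.exists_element (𝔰.isMesh i) hx
  obtain ⟨μ, hμ, hμ1, hμx⟩ := Mesh.mem_convexHull.1 hxs
  have hvx : v i k x = ∑ y ∈ s, μ y * v i k y := by
    rw [← hμx]
    exact Mesh.P1_combination ((hv i).1 k hk) hs' hμ hμ1
  -- Barycentric coordinates write the error at `x` as a convex combination of deviations at
  -- vertices, and uniform continuity of `u` bridges from the vertices to `x`.
  have hsum : v i k x - u (k * 𝔰.h i, x) = ∑ y ∈ s, μ y * (v i k y - u (k * 𝔰.h i, x)) := by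
    simp only [mul_sub, Finset.sum_sub_distrib, ← Finset.sum_mul, hμ1, one_mul, hvx]
  rw [hsum]
  have hterm : ∀ y ∈ s, |v i k y - u (k * 𝔰.h i, x)| ≤ ε := fun y hy => by
    have hyv := Mesh.mem_vertices_of_mem hs'.1 hy
    have hyQ := mem_Q hk (𝔰.vertex_mem hyv)
    have h3 := h1 k hk y hyv hyQ
    have h4 := h2 k hk y hyv hyQ
    have h5 := huc _ hyQ _ (mem_Q hk hx) (by
      rw [Prod.dist_eq, dist_self]
      exact max_lt hδ ((𝔰.dist_le_size hs' (subset_convexHull ℝ _ hy) hxs).trans_lt hs))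
    rw [Real.dist_eq, abs_lt] at h5
    simp only [Pi.neg_apply] at h4
    rw [abs_le]
    constructor <;> linarith
  calc |∑ y ∈ s, μ y * (v i k y - u (k * 𝔰.h i, x))|
      ≤ ∑ y ∈ s, |μ y * (v i k y - u (k * 𝔰.h i, x))| := Finset.abs_sum_le_sum_abs _ _
    _ ≤ ∑ y ∈ s, μ y * ε := Finset.sum_le_sum fun y hy => by
        rw [abs_mul, abs_of_nonneg (hμ y hy)]
        exact mul_le_mul_of_nonneg_left (hterm y hy) (hμ y hy)
    _ = ε := by rw [← Finset.sum_mul, hμ1, one_mul]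

/-- Uniform convergence of the interpolants in time. -/
theorem eventually_timeInterpolant (hu : ContinuousOn u 𝔭.Q)
    (hconv : ∀ ε > 0, ∀ᶠ i in atTop, ∀ k ≤ 𝔰.N i, ∀ x ∈ 𝔭.P,
      |v i k x - u (k * 𝔰.h i, x)| ≤ ε) {ε : ℝ} (hε : 0 < ε) :
    ∀ᶠ i in atTop, ∀ z ∈ Ioo 0 𝔭.T ×ˢ 𝔭.Ω, |𝔰.timeInterpolant v i z - u z| ≤ ε := by
  have hQ := Problem.isCompact_Q (𝔭 := 𝔭)
  obtain ⟨δ, hδ, huc⟩ := Metric.uniformContinuousOn_iff.1 (hQ.uniformContinuousOn_of_continuous hu)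
    (ε / 2) (half_pos hε)
  filter_upwards [hconv (ε / 2) (half_pos hε), 𝔰.h_tendsto.eventually (gt_mem_nhds hδ)]
    with i hi hh
  rintro ⟨t, x⟩ ⟨⟨ht0, htT⟩, hx⟩
  have hx := interior_subset hx
  have hpos := 𝔰.h_pos i
  set k := ⌊t / 𝔰.h i⌋₊ with hk
  have h1 := Nat.floor_le (div_nonneg ht0.le hpos.le)
  have h2 := Nat.lt_floor_add_one (t / 𝔰.h i)
  rw [← hk, le_div_iff₀ hpos] at h1
  rw [← hk, div_lt_iff₀ hpos, add_mul, one_mul] at h2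
  -- Because `t < T`, the level `k + 1` used by the interpolation still belongs to the time grid.
  have hkN : k < 𝔰.N i := by
    rw [hk, Nat.floor_lt (div_nonneg ht0.le hpos.le), div_lt_iff₀ hpos, 𝔰.N_mul_h]
    exact htT
  have htQ : (t, x) ∈ 𝔭.Q := ⟨⟨ht0.le, htT.le⟩, hx⟩
  have hclose : ∀ j ≤ 𝔰.N i, |(j : ℝ) * 𝔰.h i - t| < δ → |v i j x - u (t, x)| ≤ ε := fun j hj hd => by
    have h3 := hi j hj x hx
    have h4 := huc _ (mem_Q hj hx) _ htQ (by
      rw [Prod.dist_eq, dist_self]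
      exact max_lt hd hδ)
    rw [Real.dist_eq] at h4
    linarith [abs_sub_le (v i j x) (u (j * 𝔰.h i, x)) (u (t, x))]
  have h3 := hclose k hkN.le (by rw [abs_lt]; constructor <;> linarith)
  have h4 := hclose (k + 1) hkN (by push_cast; rw [abs_lt]; constructor <;> linarith)
  have f0 := Int.fract_nonneg (t / 𝔰.h i)
  have f1 := (Int.fract_lt_one (t / 𝔰.h i)).le
  simp only [timeInterpolant, ← hk]
  set θ := Int.fract (t / 𝔰.h i)
  have hsum : (1 - θ) * v i k x + θ * v i (k + 1) x - u (t, x) =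
    (1 - θ) * (v i k x - u (t, x)) + θ * (v i (k + 1) x - u (t, x)) := by ring
  rw [hsum]
  refine (abs_add_le _ _).trans ?_
  rw [abs_mul, abs_mul, abs_of_nonneg f0, abs_of_nonneg (sub_nonneg.2 f1)]
  nlinarith [mul_le_mul_of_nonneg_left h3 (sub_nonneg.2 f1), mul_le_mul_of_nonneg_left h4 f0]

end Discretisation

end HJBFEM

theorem theorem8p2 {d : ℕ} (hd : 2 ≤ d) {A : Type*} [MetricSpace A] [CompactSpace A]
    (𝔭 : HJBFEM.Problem d A) (𝔰 : HJBFEM.Discretisation 𝔭)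
    (hcons : 𝔰.IsConsistent) (hdiff : 𝔰.HasArtificialDiffusion) (hstep : 𝔰.TimeStepRestriction)
    (hproj : 𝔰.HasEllipticProjection) (hsuper : 𝔭.HasStrictSupersolution)
    (hcomp : 𝔭.Comparison)
    (v : ℕ → ℕ → HJBFEM.E d → ℝ) (hv : 𝔰.IsNumericalSolution v) :
    ∃ u : ℝ × HJBFEM.E d → ℝ,
      𝔭.IsViscositySolution u ∧ (∀ x ∈ 𝔭.P, u (𝔭.T, x) = 𝔭.vT x) ∧
      (∀ u' : ℝ × HJBFEM.E d → ℝ, 𝔭.IsViscositySolution u' → EqOn u' u 𝔭.Q) ∧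
      (∀ z ∈ 𝔭.Q, 𝔰.lowerLimit v z = (u z : EReal) ∧ 𝔰.upperLimit v z = (u z : EReal)) ∧
      Tendsto (fun i => ⨆ k ∈ Iic (𝔰.N i), ⨆ x ∈ 𝔭.P, ‖v i k x - u ((k : ℝ) * 𝔰.h i, x)‖ₑ)
        atTop (𝓝 0) ∧
      Tendsto (fun i => eLpNorm (fun z => 𝔰.timeInterpolant v i z - u z) ⊤
        (volume.restrict (Ioo 0 𝔭.T ×ˢ 𝔭.Ω))) atTop (𝓝 0) := by
  obtain ⟨Pr, hgal, -, htend⟩ := hproj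
  have hPr : 𝔰.IsProjection Pr := ⟨hgal, htend⟩
  have hd0 : 0 < d := by omega
  have : Nonempty A := ⟨hsuper.choose⟩
  obtain ⟨C, hC⟩ := HJBFEM.Discretisation.exists_bound hd0 hcons hdiff hstep hPr hv hsuper
  have hC' : ∀ᶠ i in atTop, ∀ k ≤ 𝔰.N i, ∀ y ∈ (𝔰.mesh i).vertices, |(-v) i k y| ≤ C :=
    hC.mono fun i hi k hk y hy => by simpa using hi k hk y hy
  obtain ⟨u, hU, hub, hlim⟩ := HJBFEM.Discretisation.exists_isUpperLimit hC
  obtain ⟨U', hU', hub', hlim'⟩ := HJBFEM.Discretisation.exists_isUpperLimit hC'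
  have husc := hU.upperSemicontinuousOn
  have hlsc : LowerSemicontinuousOn (-U') 𝔭.Q := fun z hz b hb =>
    (hU'.upperSemicontinuousOn z hz (-b) (by simpa using neg_lt_neg hb)).mono fun z' h => by
      simpa using neg_lt_neg h
  have hsub := hU.isSubsolution hd0 hcons hdiff hstep hPr hv hub
  have hsup := hU'.isSupersolution hd0 hcons hdiff hstep hPr hv hub'
  -- One inequality holds by construction of the envelopes, the other is the comparison principle.
  -- Their common value is upper and lower semicontinuous, hence continuous.
  have heq : EqOn (-U') u 𝔭.Q := fun z hz =>
    le_antisymm (hU.neg_le hU' hz) (hcomp u (-U') husc hsub hlsc hsup z hz)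
  have hU'' : 𝔰.IsUpperLimit (-v) (-u) := by
    have h : ∀ z ∈ 𝔭.Q, (-u) z = U' z := fun z hz => by
      rw [Pi.neg_apply, ← heq hz, Pi.neg_apply, neg_neg]
    exact ⟨fun z hz => by rw [h z hz]; exact hU'.le z hz,
      fun z hz => by rw [h z hz]; exact hU'.frequently z hz⟩
  have hcont : ContinuousOn u 𝔭.Q := continuousOn_iff_lower_upperSemicontinuousOn.2
    ⟨fun z hz b hb => by
      filter_upwards [hlsc z hz b (hb.trans_eq (heq hz).symm), self_mem_nhdsWithin] with z' h hz'
      exact h.trans_eq (heq hz'), husc⟩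
  have hconv : ∀ ε > 0, ∀ᶠ i in atTop, ∀ k ≤ 𝔰.N i, ∀ x ∈ 𝔭.P,
      |v i k x - u (k * 𝔰.h i, x)| ≤ ε := fun ε hε => hU.eventually_abs_sub_le hv hU'' hcont hε
  refine ⟨u, ⟨hsub, hsup.congr heq⟩, fun x hx => hU.final_time hv hU'' hx, ?_, ?_, ?_, ?_⟩
  · rintro u' ⟨hu₁, hu₂⟩ z hz
    obtain ⟨C₁, hC₁⟩ := hu₁.1
    -- Another solution need not be semicontinuous, so comparison is applied to its envelopes: `u'`
    -- lies below its upper envelope, which lies below the supersolution `-U'`, and symmetrically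
    -- from below.
    obtain ⟨h1, h2⟩ := hu₁.upperEnvelope
    obtain ⟨h3, h4⟩ := hu₂.lowerEnvelope
    have hneg : ∀ z ∈ 𝔭.Q, |(-u') z| ≤ C₁ := fun z hz => by simpa using hC₁ z hz
    refine le_antisymm ?_ ?_
    · calc u' z ≤ HJBFEM.upperEnvelope 𝔭.Q u' z := HJBFEM.le_upperEnvelope hC₁ hz
        _ ≤ (-U') z := hcomp _ _ h1 h2 hlsc hsup z hz
        _ = u z := heq hz
    · have h5 := hcomp _ _ husc hsub h3 h4 z hz
      have h6 : (-u') z ≤ HJBFEM.upperEnvelope 𝔭.Q (-u') z := HJBFEM.le_upperEnvelope hneg hz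
      rw [HJBFEM.lowerEnvelope_eq_neg] at h5
      rw [Pi.neg_apply] at h6
      linarith
  · intro z hz
    refine ⟨?_, hlim z hz⟩
    rw [𝔰.lowerLimit_eq_neg, hlim' z hz, ← EReal.coe_neg, ← heq hz, Pi.neg_apply]
  · refine HJBFEM.tendsto_zero_of_eventually_le_ofReal fun ε hε => ?_
    filter_upwards [hconv ε hε] with i hi
    refine iSup₂_le fun k hk => iSup₂_le fun x hx => ?_
    rw [← ofReal_norm, Real.norm_eq_abs]
    exact ENNReal.ofReal_le_ofReal (hi k hk x hx)
  · refine HJBFEM.tendsto_zero_of_eventually_le_ofReal fun ε hε => ?_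
    filter_upwards [HJBFEM.Discretisation.eventually_timeInterpolant hcont hconv hε] with i hi
    rw [eLpNorm_exponent_top]
    refine eLpNormEssSup_le_of_ae_enorm_bound ?_
    filter_upwards [ae_restrict_mem (measurableSet_Ioo.prod isOpen_interior.measurableSet)] with z hz
    rw [← ofReal_norm, Real.norm_eq_abs]
    exact ENNReal.ofReal_le_ofReal (hi z hz)
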